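/- **Theorem (quantitative Carleman estimate).** Let $n\ge 1$, $\Lambda\ge 1$, $M\ge 0$. Write $B_4=\{x\in\mathbb R^n:|x|<4\}$, $Q_4=B_4\times[0,16]$, $dX=dx\,dt$, and $\nabla$, $\operatorname{div}$ for the gradient and divergence in $x$. For a function $f$ on $Q_4$ that is Lipschitz in $x\in B_4$ for each $t$, put $$\|f\|_{1,1/2}=\|f\|_{L^\infty(Q_4)}+\|\nabla f\|_{L^\infty(Q_4)}+\sup_{(x,t),(x,s)\in Q_4}\frac{|f(x,t)-f(x,s)|}{|t-s|^{1/2}},$$ and for a vector field $b=(b_1,\dots,b_n)$ put $\|b\|_{1,1/2}=\sup_i\|b_i\|_{1,1/2}$. Let $$G(x,t)=t^{-n/2}e^{-|x|^2/4t}\quad(t>0),\qquad \theta(t)=t^{1/2}\Big(\log\frac1t\Big)^{3/2}\quad(0<t\le \tfrac12),$$ and, for $\lambda>0$ and $0\le\lambda t\le\frac12$, $$\sigma(t)=t\exp\Big[-\int_0^{\lambda t}\Big(1-\exp\Big(-\int_0^s\theta(\tau)\frac{d\tau}{\tau}\Big)\Big)\frac{ds}{s}\Big].$$ For $a>0$ set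 $\sigma_a(t)=\sigma(t+a)$ and $G_a(x,t)=G(x,t+a)$. There exist constants $N>1$ and $\delta\in(0,1)$, depending only on $n,\Lambda,M$, such that the following holds. Let $A=[a_{ij}]$ be a symmetric matrix-valued function on $\mathbb R^n\times[0,\infty)$ with $A(0,0)=\mathbb I_n$ and, for all $x,y,\xi\in\mathbb R^n$, $s,t\ge0$ and all $i,j$, $$\Lambda^{-1}|\xi|^2\le\langle A(x,t)\xi,\xi\rangle\le\Lambda|\xi|^2,\qquad |a_{ij}(x,t)-a_{ij}(y,s)|\le M\big(|x-y|+|t-s|^{1/2}\big).$$ Let $b$ and $V$ be a vector field and a function with $\|b\|_{1,1/2}<\infty$, $\|V\|_{1,1/2}<\infty$, and put $$Lw=w_t+\operatorname{div}(A(x,t)\nabla w)+\langle b(x,t),\nabla w\rangle+V(x,t)w.$$ If $$\alpha\ge N\big(1+\|b\|_{1,1/2}+\|V\|_{1,1/2}^{1/2}\big)\qquad\text{and}\qquad\lambda=\alpha/\delta^2,$$ then for all $0<a\le\frac1{4\lambda}$ and all $w\in C_0^\infty(B_4\times[0,\frac1{4\lambda}))$ (functions smooth up to $t=0$, with compact support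 in $B_4\times[0,\frac1{4\lambda})$, not required to vanish at $t=0$, extended by zero to $\mathbb R^n\times[0,\infty)$), $$\begin{aligned} &\alpha^2\int_{B_4\times[0,\frac1{4\lambda})}\sigma_a^{-2\alpha}w^2G_a\,dX+\alpha\int_{B_4\times[0,\frac1{4\lambda})}\sigma_a^{1-2\alpha}|\nabla w|^2G_a\,dX\\ &\quad\le N\int_{B_4\times[0,\frac1{4\lambda})}\sigma_a^{1-2\alpha}(Lw)^2G_a\,dX+N^{2\alpha}\alpha^{2\alpha}\sup_{t\ge0}\int_{\mathbb R^n}\big[w^2+|\nabla w|^2\big](x,t)\,dx\\ &\qquad+\sigma(a)^{-2\alpha}\Big(-\frac aN\int_{\mathbb R^n}|\nabla w(x,0)|^2G(x,a)\,dx+N\alpha\int_{\mathbb R^n}w^2(x,0)G(x,a)\,dx\Big). \end{aligned}$$ -/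

import Mathlib

open MeasureTheory Set
open scoped ContDiff

namespace ParabolicCarleman

noncomputable section

/-- `ℝⁿ` with its Euclidean norm. -/
abbrev E (n : ℕ) : Type := EuclideanSpace ℝ (Fin n)

/-- The space-time cylinder `Q₄ = B₄ × [0, 16]`. -/
def Q4 (n : ℕ) : Set (E n × ℝ) := Metric.ball (0 : E n) 4 ×ˢ Icc (0 : ℝ) 16

/-- The spatial gradient `∇ₓ f (x, t)`. -/
def gradX {n : ℕ} (f : E n → ℝ → ℝ) (x : E n) (t : ℝ) : E n :=
  gradient (fun y => f y t) x

/-- The divergence of a vector field on `ℝⁿ`: `∑ᵢ ∂ᵢ Fᵢ`. -/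
def divX {n : ℕ} (F : E n → E n) (x : E n) : ℝ :=
  ∑ i : Fin n, fderiv ℝ F x (EuclideanSpace.single i (1 : ℝ)) i

/-- The norm `‖f‖_{1,1/2}`, with values in `[0, ∞]`:
`‖f‖_{L^∞(Q₄)} + ‖∇ₓ f‖_{L^∞(Q₄)} + sup |f(x,t) - f(x,s)| / |t-s|^{1/2}`,
the supremum over all `(x,t), (x,s) ∈ Q₄`. -/
def scalarNorm {n : ℕ} (f : E n → ℝ → ℝ) : ENNReal :=
  eLpNorm (fun p : E n × ℝ => f p.1 p.2) ⊤ (volume.restrict (Q4 n))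
    + eLpNorm (fun p : E n × ℝ => gradX f p.1 p.2) ⊤ (volume.restrict (Q4 n))
    + ⨆ (x ∈ Metric.ball (0 : E n) 4) (t ∈ Icc (0 : ℝ) 16) (s ∈ Icc (0 : ℝ) 16),
        ENNReal.ofReal (|f x t - f x s| / |t - s| ^ (1 / 2 : ℝ))

/-- The norm `‖b‖_{1,1/2}` of a vector field: the supremum of the norms of its components. -/
def vectorNorm {n : ℕ} (b : E n → ℝ → E n) : ENNReal :=
  ⨆ i : Fin n, scalarNorm (fun x t => b x t i)

/-- `f` has finite `‖·‖_{1,1/2}` norm; that `∇ₓ f` exists as an `L^∞` function means that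
`f (·, t)` is Lipschitz in the (convex) ball `B₄` (its gradient then exists almost everywhere). -/
def FiniteNorm {n : ℕ} (f : E n → ℝ → ℝ) : Prop :=
  (∀ t ∈ Icc (0 : ℝ) 16, ∃ K, LipschitzOnWith K (fun x => f x t) (Metric.ball (0 : E n) 4)) ∧
    scalarNorm f ≠ ⊤

/-- The hypotheses on the leading coefficients: for `t, s ≥ 0`, symmetry, ellipticity with constant
`Λ`, and `|aᵢⱼ(x,t) - aᵢⱼ(y,s)| ≤ M (|x-y| + |t-s|^{1/2})`. -/
structure IsAdmissible {n : ℕ} (Λ M : ℝ) (A : E n → ℝ → Matrix (Fin n) (Fin n) ℝ) : Prop where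
  symm : ∀ x t, 0 ≤ t → (A x t).IsSymm
  lower : ∀ x t, 0 ≤ t → ∀ ξ : E n, Λ⁻¹ * ‖ξ‖ ^ 2 ≤ inner ℝ (Matrix.toEuclideanLin (A x t) ξ) ξ
  upper : ∀ x t, 0 ≤ t → ∀ ξ : E n, inner ℝ (Matrix.toEuclideanLin (A x t) ξ) ξ ≤ Λ * ‖ξ‖ ^ 2
  regular : ∀ x y t s, 0 ≤ t → 0 ≤ s → ∀ i j,
    |A x t i j - A y s i j| ≤ M * (‖x - y‖ + |t - s| ^ (1 / 2 : ℝ))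

/-- The backward parabolic operator
`L w = w_t + div (A(x,t) ∇w) + ⟨b(x,t), ∇w⟩ + V(x,t) w`.
For `A` Lipschitz in `x` and `w` smooth, the divergence is defined for almost every `x`. -/
def opL {n : ℕ} (A : E n → ℝ → Matrix (Fin n) (Fin n) ℝ) (b : E n → ℝ → E n) (V : E n → ℝ → ℝ)
    (w : E n → ℝ → ℝ) (x : E n) (t : ℝ) : ℝ :=
  deriv (fun s => w x s) t
    + divX (fun y => Matrix.toEuclideanLin (A y t) (gradX w y t)) x
    + inner ℝ (b x t) (gradX w x t)
    + V x t * w x t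

/-- The class `C₀^∞(B₄ × [0,T))`: functions that are smooth up to the time `t = 0` (where they need
not vanish), and whose support in `{t ≥ 0}` is a compact subset of `B₄ × [0,T)`. Values at `t < 0`
are irrelevant. -/
def IsTestFunction {n : ℕ} (T : ℝ) (w : E n → ℝ → ℝ) : Prop :=
  ContDiffOn ℝ ∞ (fun p : E n × ℝ => w p.1 p.2) (univ ×ˢ Ici (0 : ℝ)) ∧
    ∃ K : Set (E n × ℝ), IsCompact K ∧ K ⊆ Metric.ball (0 : E n) 4 ×ˢ Ico (0 : ℝ) T ∧
      ∀ x t, 0 ≤ t → (x, t) ∉ K → w x t = 0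

/-- `G(x,t) = t^{-n/2} e^{-|x|²/(4t)}`, used for `t > 0`. -/
def gaussG {n : ℕ} (x : E n) (t : ℝ) : ℝ :=
  t ^ (-(n : ℝ) / 2) * Real.exp (-‖x‖ ^ 2 / (4 * t))

/-- `θ(t) = t^{1/2} (log (1/t))^{3/2}`, used for `0 < t ≤ 1/2`. -/
def theta (t : ℝ) : ℝ := t ^ (1 / 2 : ℝ) * Real.log (1 / t) ^ (3 / 2 : ℝ)

/-- `σ(t) = t exp[- ∫₀^{λt} (1 - exp(- ∫₀^s θ(τ) dτ/τ)) ds/s]`, used for `0 ≤ λ t ≤ 1/2`. -/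
def sigma (lam t : ℝ) : ℝ :=
  t * Real.exp (-∫ s in (0 : ℝ)..(lam * t), (1 - Real.exp (-∫ τ in (0 : ℝ)..s, theta τ / τ)) / s)

end

end ParabolicCarleman

open ParabolicCarleman

/-! Put s = t + a and f = σ_a^{-α} w, and work in L²(G dx dt) with G taken at time s. Since σ'/σ =
1/ρ with ρ = s/γ, conjugation turns L into f_t + (α/ρ) f + div(A∇f) + ⟨b,∇f⟩ + V f. This splits into
an essentially antisymmetric part f_t + ⟨Z,∇f⟩ + F f/2, Z = Ax/(2s) + b, and a symmetric part Sf + U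
f, where Sf = G⁻¹ div(G A∇f) and U = α/ρ + V − F/2. Here F is (∂ₜG − div(A∇G) + div(bG))/G without
the terms in which A or b is differentiated: F must itself be differentiated once, and the
coefficients are only Lipschitz. The omitted terms are bounded and return as errors. The
normalisation A(0,0) = I makes F small near the origin, of size α|x|/s + |x|³/s².

Test the symmetric part with 2ρ times the antisymmetric part, and the whole with (θ/2) f. By
`commutator_identity` the result is a G-divergence, minus the time derivative of G times φ =
ρ⟨A∇f,∇f⟩ − (α + θ/4 + ρ(V − F/2)) f², plus a quadratic form. If ρ were s and A the identity, the
leading part of the gradient commutator would cancel. Because σ is a modification of t with sρ'/ρ =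
1 + θ(λs), a positive part of size θ|∇f|² + (αθ/s) f² survives (`PointBounds.commForm_ge`).

The errors are weighted by |x| + √s + αs on |∇f|², by α + |x|²/s on |f||∇f|, and by α² + α|x|/s +
|x|³/s² on f². Where |x|² ≤ k² αs log(1/(λs)), they are at most a multiple of δ times the positive
part (`err_le_main`); the worst one, |x|³, is of size αs·δ·θ(λs), which is why θ(τ) is τ^{1/2}
log(1/τ)^{3/2}. Elsewhere G is a power of λs so high that it beats σ^{-2α}, and this yields the term
N^{2α} α^{2α} sup (`gaussG_le_outerBound`, `outerBound_mul_sigma_le`). Finally θ(λs) ≥ αs, so the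
positive part dominates αs|∇f|² + α² f².

The coefficients are only Hölder 1/2 in time and cannot be differentiated in t. The identity is
therefore applied to frozen coefficients (`exists_frozen`): A at time 0, b and V at a generic time
in (0,a). The price is an error √s |D²f| plus lower order terms. A Rellich identity (`divG_rellich`,
`PointBounds.hessSq_le`) controls |D²f|² by (Sf)², lower order terms and a G-divergence, with a
spare factor s that allows absorption.

Integration in x removes the divergences. Integration in t leaves −∫Gφ at t = 0, since w vanishes at
the final time; there ρ ≥ a makes the gradient term negative (`neg_integral_boundaryDensity_le`). -/

open scoped Topology

/-! ### The time weights θ, γ and σ. -/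

namespace ParabolicCarleman

/-- A numerical constant bounding `theta τ / τ ^ (1/4)`. -/
noncomputable def thetaConst : ℝ := 6 ^ (3 / 2 : ℝ)

/-- The primitive `∫₀^s θ(τ) dτ/τ`. -/
noncomputable def bigTheta (s : ℝ) : ℝ := ∫ τ in (0 : ℝ)..s, theta τ / τ

/-- The function `γ(s) = s σ'(s) / σ(s) = exp (-∫₀^{λ s} θ(τ) dτ/τ)`. -/
noncomputable def gam (lam s : ℝ) : ℝ := Real.exp (-bigTheta (lam * s))

lemma thetaConst_ge_one : 1 ≤ thetaConst :=
  Real.one_le_rpow (by norm_num) (by norm_num)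

lemma theta_nonneg {τ : ℝ} (h : 0 < τ) (h1 : τ ≤ 1) : 0 ≤ theta τ := by
  have : 0 ≤ Real.log (1 / τ) := Real.log_nonneg (by rw [le_div_iff₀ h]; linarith)
  unfold theta; positivity

/-- The logarithm is traded for a power: log y ≤ 6 y^{1/6}, and the exponent 3/2 then costs
τ^{-1/4}, which leaves half of the factor τ^{1/2}. Hence θ(τ)/τ is integrable at 0. -/
lemma theta_le_rpow {τ : ℝ} (h : 0 < τ) (h1 : τ ≤ 1) : theta τ ≤ thetaConst * τ ^ (1 / 4 : ℝ) := by
  have h2 : 0 ≤ Real.log (1 / τ) := Real.log_nonneg (by rw [le_div_iff₀ h]; linarith)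
  have h3 := Real.log_le_rpow_div (x := 1 / τ) (by positivity) (show (0 : ℝ) < 1 / 6 by norm_num)
  have h4 : Real.log (1 / τ) ^ (3 / 2 : ℝ) ≤ (6 * τ ^ (-(1 / 6) : ℝ)) ^ (3 / 2 : ℝ) := by
    apply Real.rpow_le_rpow h2 _ (by norm_num)
    rw [Real.rpow_neg h.le]
    rw [one_div, Real.inv_rpow h.le] at h3
    rw [one_div]
    linarith
  have h5 : (6 * τ ^ (-(1 / 6) : ℝ)) ^ (3 / 2 : ℝ) = thetaConst * τ ^ (-(1 / 4) : ℝ) := by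
    rw [Real.mul_rpow (by norm_num) (by positivity), ← Real.rpow_mul h.le, thetaConst]
    norm_num
  unfold theta
  calc τ ^ (1 / 2 : ℝ) * Real.log (1 / τ) ^ (3 / 2 : ℝ)
      ≤ τ ^ (1 / 2 : ℝ) * (thetaConst * τ ^ (-(1 / 4) : ℝ)) := by
        rw [← h5]; gcongr
    _ = thetaConst * (τ ^ (1 / 2 : ℝ) * τ ^ (-(1 / 4) : ℝ)) := by ring
    _ = _ := by rw [← Real.rpow_add h]; norm_num

lemma theta_le {τ : ℝ} (h : 0 < τ) (h1 : τ ≤ 1) : theta τ ≤ thetaConst := by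
  have h2 := theta_le_rpow h h1
  have h3 : τ ^ (1 / 4 : ℝ) ≤ 1 := Real.rpow_le_one h.le h1 (by norm_num)
  have h4 := thetaConst_ge_one
  nlinarith

lemma theta_div_le {τ : ℝ} (h : 0 < τ) (h1 : τ ≤ 1) :
    theta τ / τ ≤ thetaConst * τ ^ (-(3 / 4) : ℝ) := by
  rw [div_le_iff₀ h, mul_assoc]
  nth_rewrite 3 [← Real.rpow_one τ]
  rw [← Real.rpow_add h]
  norm_num
  simpa using theta_le_rpow h h1

lemma continuousAt_theta {τ : ℝ} (h : 0 < τ) : ContinuousAt theta τ := by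
  unfold theta
  have h1 : ContinuousAt (fun τ : ℝ => Real.log (1 / τ)) τ := by
    apply ContinuousAt.log _ (by positivity)
    exact continuousAt_const.div continuousAt_id h.ne'
  exact (continuousAt_id.rpow_const (Or.inr (by norm_num))).mul
    (h1.rpow_const (Or.inr (by norm_num)))

lemma continuousOn_theta_div : ContinuousOn (fun τ => theta τ / τ) (Ioi 0) := fun _ h =>
  ((continuousAt_theta h).div continuousAt_id (ne_of_gt h)).continuousWithinAt

lemma intervalIntegrable_const_mul_rpow (C s : ℝ) :
    IntervalIntegrable (fun τ : ℝ => C * τ ^ (-(3 / 4) : ℝ)) volume 0 s :=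
  (intervalIntegral.intervalIntegrable_rpow' (by norm_num)).const_mul _

lemma integral_const_mul_rpow (C : ℝ) (s : ℝ) :
    ∫ τ in (0 : ℝ)..s, C * τ ^ (-(3 / 4) : ℝ) = 4 * C * s ^ (1 / 4 : ℝ) := by
  rw [intervalIntegral.integral_const_mul, integral_rpow (Or.inl (by norm_num))]
  norm_num
  ring

/-- A function on `(0, s]` that is continuous and bounded by a multiple of `τ^{-3/4}`. -/
lemma intervalIntegrable_of_le_rpow {f : ℝ → ℝ} {C s : ℝ} (hs : 0 < s)
    (hf : ContinuousOn f (Ioc 0 s)) (h0 : ∀ τ ∈ Ioc 0 s, 0 ≤ f τ)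
    (h1 : ∀ τ ∈ Ioc 0 s, f τ ≤ C * τ ^ (-(3 / 4) : ℝ)) :
    IntervalIntegrable f volume 0 s := by
  have hI := (intervalIntegrable_const_mul_rpow C s)
  rw [intervalIntegrable_iff_integrableOn_Ioc_of_le hs.le] at hI ⊢
  refine Integrable.mono' hI (hf.aestronglyMeasurable measurableSet_Ioc) ?_
  refine (ae_restrict_iff' measurableSet_Ioc).2 (Filter.Eventually.of_forall fun τ hτ => ?_)
  rw [Real.norm_of_nonneg (h0 τ hτ)]
  exact h1 τ hτ

lemma integral_le_of_le_rpow {f : ℝ → ℝ} {C s : ℝ} (hs : 0 < s)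
    (hf : ContinuousOn f (Ioc 0 s)) (h0 : ∀ τ ∈ Ioc 0 s, 0 ≤ f τ)
    (h1 : ∀ τ ∈ Ioc 0 s, f τ ≤ C * τ ^ (-(3 / 4) : ℝ)) :
    0 ≤ ∫ τ in (0 : ℝ)..s, f τ ∧ ∫ τ in (0 : ℝ)..s, f τ ≤ 4 * C * s ^ (1 / 4 : ℝ) := by
  have hI := intervalIntegrable_of_le_rpow hs hf h0 h1
  have hJ := intervalIntegrable_const_mul_rpow C s
  rw [← integral_const_mul_rpow]
  simp only [intervalIntegral.integral_of_le hs.le]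
  rw [intervalIntegrable_iff_integrableOn_Ioc_of_le hs.le] at hI hJ
  exact ⟨setIntegral_nonneg measurableSet_Ioc h0, setIntegral_mono_on hI hJ measurableSet_Ioc h1⟩

lemma intervalIntegrable_theta_div {s : ℝ} (h : 0 < s) (h1 : s ≤ 1) :
    IntervalIntegrable (fun τ => theta τ / τ) volume 0 s :=
  intervalIntegrable_of_le_rpow h (continuousOn_theta_div.mono fun _ h => h.1)
    (fun _ hτ => div_nonneg (theta_nonneg hτ.1 (hτ.2.trans h1)) hτ.1.le)
    (fun _ hτ => theta_div_le hτ.1 (hτ.2.trans h1))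

lemma bigTheta_bounds {s : ℝ} (h : 0 < s) (h1 : s ≤ 1) :
    0 ≤ bigTheta s ∧ bigTheta s ≤ 4 * thetaConst * s ^ (1 / 4 : ℝ) :=
  integral_le_of_le_rpow h (continuousOn_theta_div.mono fun _ h => h.1)
    (fun _ hτ => div_nonneg (theta_nonneg hτ.1 (hτ.2.trans h1)) hτ.1.le)
    (fun _ hτ => theta_div_le hτ.1 (hτ.2.trans h1))

lemma stronglyMeasurableAtFilter_of_continuousOn_Ioi {f : ℝ → ℝ} {s : ℝ} (hs : 0 < s)
    {u : ℝ} (hu : s < u) (hf : ContinuousOn f (Ioo 0 u)) :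
    StronglyMeasurableAtFilter f (nhds s) volume :=
  ContinuousOn.stronglyMeasurableAtFilter isOpen_Ioo hf s ⟨hs, hu⟩

lemma hasDerivAt_bigTheta {s : ℝ} (h : 0 < s) (h1 : s ≤ 1) :
    HasDerivAt bigTheta (theta s / s) s :=
  intervalIntegral.integral_hasDerivAt_right (intervalIntegrable_theta_div h h1)
    (stronglyMeasurableAtFilter_of_continuousOn_Ioi h (lt_add_one s)
      (continuousOn_theta_div.mono fun _ h => h.1))
    ((continuousAt_theta h).div continuousAt_id h.ne')

lemma sigma_integrand_cont {s : ℝ} (h : 0 < s) (h1 : s ≤ 1) :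
    ContinuousAt (fun s => (1 - Real.exp (-bigTheta s)) / s) s := by
  have := (hasDerivAt_bigTheta h h1).continuousAt
  exact (continuousAt_const.sub this.neg.rexp).div continuousAt_id h.ne'

/-- By 1 − e^{-y} ≤ y the integrand inherits the integrable singularity s^{-3/4}. Its primitive is
therefore bounded, and σ is comparable to its argument with constants independent of λ. -/
lemma sigma_integrand_bounds {s : ℝ} (h : 0 < s) (h1 : s ≤ 1) :
    0 ≤ (1 - Real.exp (-bigTheta s)) / s ∧
      (1 - Real.exp (-bigTheta s)) / s ≤ 4 * thetaConst * s ^ (-(3 / 4) : ℝ) := by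
  obtain ⟨h2, h3⟩ := bigTheta_bounds h h1
  have h4 : Real.exp (-bigTheta s) ≤ 1 := by simpa using h2
  have h5 := Real.add_one_le_exp (-bigTheta s)
  refine ⟨div_nonneg (by linarith) h.le, ?_⟩
  rw [div_le_iff₀ h, mul_assoc]
  nth_rewrite 3 [← Real.rpow_one s]
  rw [← Real.rpow_add h]
  norm_num at h3 ⊢
  linarith

/-- The primitive in the definition of `sigma`. -/
noncomputable def sigmaExponent (s : ℝ) : ℝ :=
  ∫ u in (0 : ℝ)..s, (1 - Real.exp (-bigTheta u)) / u

lemma sigma_eq (lam t : ℝ) : sigma lam t = t * Real.exp (-sigmaExponent (lam * t)) := rfl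

lemma sigmaExponent_bounds {s : ℝ} (h : 0 < s) (h1 : s ≤ 1) :
    0 ≤ sigmaExponent s ∧ sigmaExponent s ≤ 16 * thetaConst := by
  have h2 := integral_le_of_le_rpow (f := fun s => (1 - Real.exp (-bigTheta s)) / s) h
    (fun _ hτ => (sigma_integrand_cont hτ.1 (hτ.2.trans h1)).continuousWithinAt)
    (fun _ hτ => (sigma_integrand_bounds hτ.1 (hτ.2.trans h1)).1)
    (fun _ hτ => (sigma_integrand_bounds hτ.1 (hτ.2.trans h1)).2)
  refine ⟨h2.1, h2.2.trans ?_⟩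
  have h3 : s ^ (1 / 4 : ℝ) ≤ 1 := Real.rpow_le_one h.le h1 (by norm_num)
  nlinarith [thetaConst_ge_one]

lemma hasDerivAt_sigmaExponent {s : ℝ} (h : 0 < s) (h1 : s < 1) :
    HasDerivAt sigmaExponent ((1 - Real.exp (-bigTheta s)) / s) s :=
  intervalIntegral.integral_hasDerivAt_right
    (intervalIntegrable_of_le_rpow h
      (fun _ hτ => (sigma_integrand_cont hτ.1 (hτ.2.trans h1.le)).continuousWithinAt)
      (fun _ hτ => (sigma_integrand_bounds hτ.1 (hτ.2.trans h1.le)).1)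
      (fun _ hτ => (sigma_integrand_bounds hτ.1 (hτ.2.trans h1.le)).2))
    (stronglyMeasurableAtFilter_of_continuousOn_Ioi h h1
      (fun _ hτ => (sigma_integrand_cont hτ.1 hτ.2.le).continuousWithinAt))
    (sigma_integrand_cont h h1.le)

section
variable {lam s : ℝ}

lemma gam_bounds (hl : 0 < lam) (hs : 0 < s) (h : lam * s ≤ 1) :
    Real.exp (-(4 * thetaConst)) ≤ gam lam s ∧ gam lam s ≤ 1 := by
  have h0 : 0 < lam * s := by positivity
  obtain ⟨h2, h3⟩ := bigTheta_bounds h0 h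
  have h4 : (lam * s) ^ (1 / 4 : ℝ) ≤ 1 := Real.rpow_le_one h0.le h (by norm_num)
  unfold gam
  constructor
  · apply Real.exp_le_exp.2
    nlinarith [thetaConst_ge_one]
  · simpa using h2

lemma sigma_bounds (hl : 0 < lam) (hs : 0 < s) (h : lam * s ≤ 1) :
    s * Real.exp (-(16 * thetaConst)) ≤ sigma lam s ∧ sigma lam s ≤ s := by
  obtain ⟨h2, h3⟩ := sigmaExponent_bounds (show 0 < lam * s by positivity) h
  rw [sigma_eq]
  constructor
  · gcongr
  · have : Real.exp (-sigmaExponent (lam * s)) ≤ 1 := by simpa using h2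
    nlinarith

lemma sigma_pos (hs : 0 < s) : 0 < sigma lam s := by
  rw [sigma_eq]; positivity

lemma hasDerivAt_gam (hl : 0 < lam) (hs : 0 < s) (h : lam * s ≤ 1) :
    HasDerivAt (gam lam) (-(gam lam s * theta (lam * s) / s)) s := by
  have h0 : 0 < lam * s := by positivity
  have hd : HasDerivAt (fun s => lam * s) lam s := by
    simpa using (hasDerivAt_id s).const_mul lam
  have h1 : HasDerivAt (gam lam) _ s := ((hasDerivAt_bigTheta h0 h).comp s hd).neg.exp
  refine h1.congr_deriv ?_
  change gam lam s * _ = _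
  field_simp

lemma hasDerivAt_sigma (hl : 0 < lam) (hs : 0 < s) (h : lam * s < 1) :
    HasDerivAt (sigma lam) (sigma lam s * gam lam s / s) s := by
  have h0 : 0 < lam * s := by positivity
  have hd : HasDerivAt (fun s => lam * s) lam s := by
    simpa using (hasDerivAt_id s).const_mul lam
  have h1 : HasDerivAt (sigma lam) _ s :=
    (hasDerivAt_id s).mul ((hasDerivAt_sigmaExponent h0 h).comp s hd).neg.exp
  refine h1.congr_deriv ?_
  change 1 * Real.exp (-sigmaExponent (lam * s)) + s * (Real.exp (-sigmaExponent (lam * s)) * _) = _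
  rw [sigma_eq]
  simp only [gam]
  field_simp
  ring

lemma log_inv_ge (hs : 0 < s) (h : s ≤ 1 / 2) : 1 / 2 ≤ Real.log (1 / s) := by
  have h1 : Real.log 2 ≤ Real.log (1 / s) :=
    Real.log_le_log (by norm_num) (by rw [le_div_iff₀ hs]; linarith)
  linarith [Real.log_two_gt_d9]

/-- On (0,1/2] the logarithm stays above 1/2, so θ keeps a fixed share of the square root. This is
what lets θ dominate the errors √s and αs, which carry no logarithm. -/
lemma theta_ge_sqrt (hs : 0 < s) (h : s ≤ 1 / 2) : Real.sqrt s ≤ 4 * theta s := by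
  have h1 := log_inv_ge hs h
  have h2 : (1 / 4 : ℝ) ≤ Real.log (1 / s) ^ (3 / 2 : ℝ) := by
    calc (1 / 4 : ℝ) = (1 / 2 : ℝ) ^ (2 : ℝ) := by norm_num
      _ ≤ (1 / 2 : ℝ) ^ (3 / 2 : ℝ) :=
        Real.rpow_le_rpow_of_exponent_ge (by norm_num) (by norm_num) (by norm_num)
      _ ≤ _ := by gcongr
  unfold theta
  rw [Real.sqrt_eq_rpow]
  nlinarith [Real.rpow_nonneg hs.le (1 / 2)]

lemma theta_pos (hs : 0 < s) (h : s ≤ 1 / 2) : 0 < theta s := by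
  have := theta_ge_sqrt hs h
  have := Real.sqrt_pos.2 hs
  linarith

lemma hasDerivAt_theta_mul (hl : 0 < lam) (hs : 0 < s) (h : lam * s ≤ 1 / 2) :
    HasDerivAt (fun s => theta (lam * s))
      (theta (lam * s) / s * (1 / 2 - 3 / (2 * Real.log (1 / (lam * s))))) s := by
  have h0 : 0 < lam * s := by positivity
  have hlog := log_inv_ge h0 h
  have hd : HasDerivAt (fun s => lam * s) lam s := by
    simpa using (hasDerivAt_id s).const_mul lam
  have h1 : HasDerivAt (fun s : ℝ => Real.log (1 / (lam * s))) (-(1 / s)) s := by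
    have h2 : HasDerivAt (fun s : ℝ => -Real.log (lam * s)) (-(lam / (lam * s))) s :=
      (hd.log h0.ne').neg
    simp only [one_div, Real.log_inv]
    refine h2.congr_deriv ?_
    field_simp
  have h2 := h1.rpow_const (p := 3 / 2) (Or.inl (by linarith))
  have h3 := hd.rpow_const (p := 1 / 2) (Or.inl h0.ne')
  have h4 : HasDerivAt (fun s => theta (lam * s)) _ s := h3.mul h2
  refine h4.congr_deriv ?_
  unfold theta
  have e1 : (lam * s) ^ (1 / 2 - 1 : ℝ) = (lam * s) ^ (1 / 2 : ℝ) / (lam * s) := by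
    rw [Real.rpow_sub h0, Real.rpow_one]
  have e2 : Real.log (1 / (lam * s)) ^ (3 / 2 - 1 : ℝ)
      = Real.log (1 / (lam * s)) ^ (3 / 2 : ℝ) / Real.log (1 / (lam * s)) := by
    rw [Real.rpow_sub (by linarith), Real.rpow_one]
  have hl0 : Real.log (1 / (lam * s)) ≠ 0 := by linarith
  rw [e1, e2]
  field_simp
  ring

/-- With the logarithm at least 1/2 the bracket lies between −5/2 and 1/2. So the derivative of
θ(λs) has size θ/s, which is small against αθ/s. -/
lemma abs_theta_deriv_le (hl : 0 < lam) (hs : 0 < s) (h : lam * s ≤ 1 / 2) :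
    |theta (lam * s) / s * (1 / 2 - 3 / (2 * Real.log (1 / (lam * s))))|
      ≤ 4 * (theta (lam * s) / s) := by
  have h0 : 0 < lam * s := by positivity
  have hlog := log_inv_ge h0 h
  have hθ := theta_pos h0 h
  rw [abs_mul, abs_of_pos (by positivity : 0 < theta (lam * s) / s), mul_comm]
  gcongr
  have h1 : 0 < 3 / (2 * Real.log (1 / (lam * s))) := by positivity
  have h2 : 3 / (2 * Real.log (1 / (lam * s))) ≤ 3 := by
    rw [div_le_iff₀ (by positivity)]; linarith
  rw [abs_le]; constructor <;> linarith

end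

end ParabolicCarleman

/-! ### Lipschitz calculus, traces and the divergence theorem with Gaussian weight. -/

namespace ParabolicCarleman

/-- A Lebesgue number δ of a finite cover of the support handles pairs at distance less than δ; for
distant pairs the bound 2B on the oscillation gives the slope 2B/δ. -/
lemma exists_lipschitzWith_of_locallyLipschitz {F F' : Type*} [NormedAddCommGroup F]
    [NormedAddCommGroup F'] {f : F → F'} (hf : LocallyLipschitz f) (hc : HasCompactSupport f) :
    ∃ C, LipschitzWith C f := by
  classical
  choose C U hU hL using hf
  obtain ⟨t, ht⟩ := hc.isCompact.elim_finite_subcover (fun x => interior (U x))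
    (fun x => isOpen_interior) (fun x _ => mem_iUnion.2 ⟨x, mem_interior_iff_mem_nhds.2 (hU x)⟩)
  have hK : tsupport f ⊆ ⋃ i : t, interior (U i) := by
    intro x hx; have := ht hx; simp only [mem_iUnion] at this ⊢
    obtain ⟨i, hi, h⟩ := this; exact ⟨⟨i, hi⟩, h⟩
  obtain ⟨δ, hδ, hleb⟩ := lebesgue_number_lemma_of_metric hc.isCompact
    (fun i : t => isOpen_interior) hK
  obtain ⟨B, hB⟩ : ∃ B, ∀ x, ‖f x‖ ≤ B := by
    have hcont : Continuous f := LocallyLipschitz.continuous fun x => ⟨C x, U x, hU x, hL x⟩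
    obtain ⟨B, hB⟩ := hc.exists_bound_of_continuous hcont
    exact ⟨B, hB⟩
  have hB0 : 0 ≤ B := (norm_nonneg _).trans (hB 0)
  set K : NNReal := t.sup C + Real.toNNReal (2 * B / δ) with hKdef
  have key : ∀ x y, x ∈ tsupport f → dist x y < δ → dist (f x) (f y) ≤ K * dist x y := by
    intro x y hx hxy
    obtain ⟨i, hi⟩ := hleb x hx
    have h1 := (hL i).dist_le_mul x (interior_subset (hi (Metric.mem_ball_self hδ))) y
      (interior_subset (hi (by rwa [Metric.mem_ball, dist_comm])))
    refine h1.trans ?_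
    gcongr
    have h2 : C i ≤ t.sup C := Finset.le_sup i.2
    exact h2.trans (by rw [hKdef]; exact le_self_add)
  refine ⟨K, LipschitzWith.of_dist_le_mul fun x y => ?_⟩
  by_cases hxy : dist x y < δ
  · by_cases hx : x ∈ tsupport f
    · exact key x y hx hxy
    · by_cases hy : y ∈ tsupport f
      · rw [dist_comm, dist_comm x y]; exact key y x hy (by rwa [dist_comm])
      · rw [image_eq_zero_of_notMem_tsupport hx, image_eq_zero_of_notMem_tsupport hy, dist_self]
        positivity
  · push Not at hxy
    have h1 : dist (f x) (f y) ≤ 2 * B := by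
      rw [dist_eq_norm]; exact (norm_sub_le _ _).trans (by linarith [hB x, hB y])
    have h2 : (2 * B / δ : ℝ) ≤ K := by
      rw [hKdef]; push_cast
      linarith [Real.le_coe_toNNReal (2 * B / δ), (t.sup C).coe_nonneg]
    calc dist (f x) (f y) ≤ 2 * B / δ * δ := by rw [div_mul_cancel₀ _ hδ.ne']; exact h1
      _ ≤ K * dist x y := by gcongr

section LocallyLipschitz
set_option linter.unusedSectionVars false
variable {F F₁ F₂ F₃ : Type*} [NormedAddCommGroup F] [NormedSpace ℝ F]
  [NormedAddCommGroup F₁] [NormedSpace ℝ F₁] [NormedAddCommGroup F₂] [NormedSpace ℝ F₂]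
  [NormedAddCommGroup F₃] [NormedSpace ℝ F₃]

/-- Bilinear operations are C¹, hence locally Lipschitz, so all the product rules below are
instances of this composition. -/
lemma locallyLipschitz_comp₂ {B : F₁ × F₂ → F₃} (hB : ContDiff ℝ 1 B) {f : F → F₁} {g : F → F₂}
    (hf : LocallyLipschitz f) (hg : LocallyLipschitz g) :
    LocallyLipschitz fun x => B (f x, g x) :=
  hB.locallyLipschitz.comp (hf.prodMk hg)

lemma locallyLipschitz_smul {f : F → ℝ} {g : F → F₂}
    (hf : LocallyLipschitz f) (hg : LocallyLipschitz g) :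
    LocallyLipschitz fun x => f x • g x :=
  locallyLipschitz_comp₂ (B := fun q : ℝ × F₂ => q.1 • q.2) (by fun_prop) hf hg

lemma locallyLipschitz_mul {f : F → ℝ} {g : F → ℝ}
    (hf : LocallyLipschitz f) (hg : LocallyLipschitz g) :
    LocallyLipschitz fun x => f x * g x := locallyLipschitz_smul hf hg

lemma locallyLipschitz_add {f : F → F₂} {g : F → F₂}
    (hf : LocallyLipschitz f) (hg : LocallyLipschitz g) :
    LocallyLipschitz fun x => f x + g x :=
  locallyLipschitz_comp₂ (B := fun q : F₂ × F₂ => q.1 + q.2) (by fun_prop) hf hg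

lemma locallyLipschitz_sub {f : F → F₂} {g : F → F₂}
    (hf : LocallyLipschitz f) (hg : LocallyLipschitz g) :
    LocallyLipschitz fun x => f x - g x :=
  locallyLipschitz_comp₂ (B := fun q : F₂ × F₂ => q.1 - q.2) (by fun_prop) hf hg

lemma locallyLipschitz_const_mul (c : ℝ) {g : F → ℝ}
    (hg : LocallyLipschitz g) : LocallyLipschitz fun x => c * g x :=
  locallyLipschitz_mul (LocallyLipschitz.const c) hg

lemma locallyLipschitz_mul_const {g : F → ℝ}
    (hg : LocallyLipschitz g) (c : ℝ) : LocallyLipschitz fun x => g x * c :=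
  locallyLipschitz_mul hg (LocallyLipschitz.const c)

lemma locallyLipschitz_const_smul (c : ℝ) {g : F → F₂}
    (hg : LocallyLipschitz g) : LocallyLipschitz fun x => c • g x :=
  locallyLipschitz_smul (LocallyLipschitz.const c) hg

lemma locallyLipschitz_clm_apply {f : F → F₁ →L[ℝ] F₂} {g : F → F₁}
    (hf : LocallyLipschitz f) (hg : LocallyLipschitz g) :
    LocallyLipschitz fun x => f x (g x) :=
  locallyLipschitz_comp₂ (B := fun q : (F₁ →L[ℝ] F₂) × F₁ => q.1 q.2) (by fun_prop) hf hg

lemma locallyLipschitz_inner {F₁ : Type*} [NormedAddCommGroup F₁] [InnerProductSpace ℝ F₁]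
    {f : F → F₁} {g : F → F₁} (hf : LocallyLipschitz f) (hg : LocallyLipschitz g) :
    LocallyLipschitz fun x => inner ℝ (f x) (g x) :=
  (show ContDiff ℝ 1 (fun q : F₁ × F₁ => inner ℝ q.1 q.2) from contDiff_inner).locallyLipschitz.comp
    (hf.prodMk hg)

lemma ContDiff.locallyLipschitz' {f : F → F₁} (hf : ContDiff ℝ ∞ f) : LocallyLipschitz f :=
  (hf.of_le (by simp)).locallyLipschitz

end LocallyLipschitz

variable {n : ℕ}

/-- The trace of a linear map of `ℝⁿ`. -/
noncomputable def tr (T : E n →L[ℝ] E n) : ℝ := ∑ i, T (EuclideanSpace.single i (1 : ℝ)) i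

lemma tr_add (S T : E n →L[ℝ] E n) : tr (S + T) = tr S + tr T := by
  simp [tr, Finset.sum_add_distrib]

lemma tr_sub (S T : E n →L[ℝ] E n) : tr (S - T) = tr S - tr T := by
  simp [tr, Finset.sum_sub_distrib]

lemma tr_smul (c : ℝ) (T : E n →L[ℝ] E n) : tr (c • T) = c * tr T := by
  simp [tr, Finset.mul_sum]

lemma tr_one : tr (1 : E n →L[ℝ] E n) = n := by
  simp [tr]

/-- The trace as a continuous linear functional. -/
noncomputable def trL (n : ℕ) : (E n →L[ℝ] E n) →L[ℝ] ℝ :=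
  LinearMap.toContinuousLinearMap
    { toFun := tr, map_add' := tr_add, map_smul' := tr_smul }

lemma trL_apply (T : E n →L[ℝ] E n) : trL n T = tr T := rfl

lemma abs_apply_le_norm (x : E n) (i : Fin n) : |x i| ≤ ‖x‖ := by
  simpa using PiLp.norm_apply_le x i

lemma abs_tr_le (T : E n →L[ℝ] E n) : |tr T| ≤ n * ‖T‖ := by
  calc |tr T| ≤ ∑ i : Fin n, |T (EuclideanSpace.single i (1 : ℝ)) i| := Finset.abs_sum_le_sum_abs _ _
    _ ≤ ∑ i : Fin n, ‖T‖ := by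
        refine Finset.sum_le_sum fun i _ => (abs_apply_le_norm _ _).trans ?_
        simpa using T.le_opNorm (EuclideanSpace.single i (1 : ℝ))
    _ = n * ‖T‖ := by simp

lemma tr_smulRight (φ : E n →L[ℝ] ℝ) (y : E n) : tr (φ.smulRight y) = φ y := by
  have h : y = ∑ i, y i • EuclideanSpace.single i (1 : ℝ) := by
    ext j
    simp [Finset.sum_apply, Pi.single_apply]
  conv_rhs => rw [h]
  simp [tr, mul_comm]

lemma integrable_of_bounded_of_isCompact {α : Type*} [TopologicalSpace α] [T2Space α]
    [MeasurableSpace α] [OpensMeasurableSpace α] {μ : Measure α} [IsFiniteMeasureOnCompacts μ]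
    {f : α → ℝ} {K : Set α} (hK : IsCompact K) {B : ℝ} (hf : AEStronglyMeasurable f μ)
    (hB : ∀ x, |f x| ≤ B) (h0 : ∀ x ∉ K, f x = 0) : Integrable f μ := by
  have hI : IntegrableOn f K μ :=
    Measure.integrableOn_of_bounded (M := B) hK.measure_lt_top.ne hf
      (Filter.Eventually.of_forall hB)
  exact hI.integrable_of_forall_notMem_eq_zero h0

/-- The divergence theorem for compactly supported Lipschitz vector fields. -/
lemma integral_tr_fderiv {Y : E n → E n} (h : LocallyLipschitz Y) (hc : HasCompactSupport Y) :
    Integrable (fun x => tr (fderiv ℝ Y x)) ∧ ∫ x, tr (fderiv ℝ Y x) = 0 := by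
  obtain ⟨C, hC⟩ := exists_lipschitzWith_of_locallyLipschitz h hc
  have hint2 : ∀ i, Integrable (fun x => fderiv ℝ Y x (EuclideanSpace.single i (1 : ℝ)) i) := by
    intro i
    refine integrable_of_bounded_of_isCompact (hc.fderiv (𝕜 := ℝ)).isCompact (B := C) ?_ ?_ ?_
    · have h1 := measurable_fderiv_apply_const ℝ Y (EuclideanSpace.single i (1 : ℝ))
      exact ((EuclideanSpace.proj (𝕜 := ℝ) i).continuous.measurable.comp h1).aestronglyMeasurable
    · intro x
      refine (abs_apply_le_norm _ _).trans ?_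
      refine (ContinuousLinearMap.le_opNorm _ _).trans ?_
      simpa using norm_fderiv_le_of_lipschitz ℝ hC
    · intro x hx
      rw [image_eq_zero_of_notMem_tsupport hx]; simp
  refine ⟨integrable_finsetSum _ fun i _ => hint2 i, ?_⟩
  unfold tr
  rw [integral_finsetSum _ fun i _ => hint2 i]
  refine Finset.sum_eq_zero fun i _ => ?_
  have hg : LipschitzWith C (fun x => Y x i) := by
    refine LipschitzWith.of_dist_le_mul fun x y => ?_
    refine le_trans ?_ (hC.dist_le_mul x y)
    rw [dist_eq_norm, dist_eq_norm]
    exact PiLp.norm_apply_le (Y x - Y y) i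
  have hgc : HasCompactSupport (fun x => Y x i) := hc.comp_left (g := fun y : E n => y i) rfl
  -- Integration by parts of the Lipschitz component against the constant 1, whose derivative
  -- vanishes; the direction is −eᵢ because the formula reverses the sign.
  have h1 := LipschitzWith.integral_lineDeriv_mul_eq (μ := volume)
    (LipschitzWith.const (α := E n) (1 : ℝ)) hg hgc (-EuclideanSpace.single i (1 : ℝ))
  simp only [neg_neg, mul_one] at h1
  have h2 : ∫ x, fderiv ℝ Y x (EuclideanSpace.single i (1 : ℝ)) i
      = ∫ x, lineDeriv ℝ (fun x => Y x i) x (EuclideanSpace.single i (1 : ℝ)) := by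
    refine integral_congr_ae ?_
    filter_upwards [hC.ae_differentiableAt] with x hx
    have h3 : HasFDerivAt (fun x => Y x i) ((EuclideanSpace.proj i).comp (fderiv ℝ Y x)) x :=
      (EuclideanSpace.proj (𝕜 := ℝ) i).hasFDerivAt.comp x hx.hasFDerivAt
    rw [(h3.hasLineDerivAt _).lineDeriv]
    rfl
  rw [h2, ← h1]
  simp [lineDeriv]

lemma gaussG_pos {s : ℝ} (hs : 0 < s) (x : E n) : 0 < gaussG x s := by
  unfold gaussG; positivity

lemma hasFDerivAt_gaussG {s : ℝ} (hs : 0 < s) (x : E n) :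
    HasFDerivAt (fun y : E n => gaussG y s)
      (-(gaussG x s / (2 * s)) • innerSL ℝ x) x := by
  have h1 : HasFDerivAt (fun y : E n => -‖y‖ ^ 2 / (4 * s))
      ((-(1 / (2 * s))) • innerSL ℝ x) x := by
    have := ((hasStrictFDerivAt_norm_sq x).hasFDerivAt.const_mul (-(1 / (4 * s)))).congr_fderiv
      (g' := (-(1 / (2 * s))) • innerSL ℝ x) (by
        ext v; simp; field_simp; ring)
    refine this.congr_of_eventuallyEq (Filter.Eventually.of_forall fun y => ?_)
    simp only
    field_simp
  refine (h1.exp.const_mul (s ^ (-(n : ℝ) / 2))).congr_fderiv ?_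
  ext v
  simp [gaussG]
  field_simp

lemma contDiff_gaussG (s : ℝ) : ContDiff ℝ ∞ (fun y : E n => gaussG y s) := by
  unfold gaussG
  exact contDiff_const.mul (((contDiff_norm_sq ℝ).neg.div_const _).exp)

lemma tr_fderiv_smul {h : E n → ℝ} {Y : E n → E n} {x : E n} {h' : E n →L[ℝ] ℝ}
    {Y' : E n →L[ℝ] E n} (hh : HasFDerivAt h h' x) (hY : HasFDerivAt Y Y' x) :
    tr (fderiv ℝ (fun y => h y • Y y) x) = h x * tr Y' + h' (Y x) := by
  have h1 : HasFDerivAt (fun y => h y • Y y) (h x • Y' + h'.smulRight (Y x)) x := hh.smul hY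
  rw [h1.fderiv, tr_add, tr_smul, tr_smulRight]

/-- The divergence theorem with respect to the Gaussian weight. -/
lemma integral_gaussG_div {s : ℝ} (hs : 0 < s) {Y : E n → E n} (h : LocallyLipschitz Y)
    (hc : HasCompactSupport Y) :
    Integrable (fun x => gaussG x s * (tr (fderiv ℝ Y x) - inner ℝ x (Y x) / (2 * s))) ∧
      ∫ x, gaussG x s * (tr (fderiv ℝ Y x) - inner ℝ x (Y x) / (2 * s)) = 0 := by
  obtain ⟨C, hC⟩ := exists_lipschitzWith_of_locallyLipschitz h hc
  have h1 := integral_tr_fderiv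
    (locallyLipschitz_smul (ContDiff.locallyLipschitz' (contDiff_gaussG s)) h)
    (HasCompactSupport.smul_left (f := fun x : E n => gaussG x s) hc)
  have h2 : (fun x => tr (fderiv ℝ (fun y => gaussG y s • Y y) x)) =ᵐ[volume]
      fun x => gaussG x s * (tr (fderiv ℝ Y x) - inner ℝ x (Y x) / (2 * s)) := by
    filter_upwards [hC.ae_differentiableAt] with x hx
    rw [tr_fderiv_smul (hasFDerivAt_gaussG hs x) hx.hasFDerivAt]
    simp
    ring
  exact ⟨h1.1.congr h2, by rw [← integral_congr_ae h2, h1.2]⟩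

end ParabolicCarleman

/-! ### Hessians, the weighted divergence, and the fields of the conjugated operator. -/

namespace ParabolicCarleman
variable {n : ℕ}

section Hessian
variable {f : E n → ℝ}

lemma contDiff_gradient (hf : ContDiff ℝ ∞ f) : ContDiff ℝ ∞ (gradient f) := by
  have h1 : ContDiff ℝ ∞ (fderiv ℝ f) := hf.fderiv_right (by simp)
  exact (InnerProductSpace.toDual ℝ (E n)).symm.contDiff.comp h1

/-- The Hessian of `f` as a linear map. -/
noncomputable def hess (f : E n → ℝ) (x : E n) : E n →L[ℝ] E n := fderiv ℝ (gradient f) x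

lemma contDiff_hess (hf : ContDiff ℝ ∞ f) : ContDiff ℝ ∞ (hess f) :=
  (contDiff_gradient hf).fderiv_right (by simp)

lemma hasFDerivAt_of_contDiff (hf : ContDiff ℝ ∞ f) (x : E n) :
    HasFDerivAt f (innerSL ℝ (gradient f x)) x := by
  have h1 := (hf.differentiable (by simp) x).hasGradientAt.hasFDerivAt
  exact h1

lemma hasFDerivAt_gradient (hf : ContDiff ℝ ∞ f) (x : E n) :
    HasFDerivAt (gradient f) (hess f x) x :=
  ((contDiff_gradient hf).differentiable (by simp) x).hasFDerivAt

lemma hasFDerivAt_hess (hf : ContDiff ℝ ∞ f) (x : E n) :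
    HasFDerivAt (hess f) (fderiv ℝ (hess f) x) x :=
  ((contDiff_hess hf).differentiable (by simp) x).hasFDerivAt

lemma inner_gradient_eq (hf : ContDiff ℝ ∞ f) (x v : E n) :
    inner ℝ (gradient f x) v = fderiv ℝ f x v := by
  rw [(hasFDerivAt_of_contDiff hf x).fderiv]; rfl

lemma hess_symm (hf : ContDiff ℝ ∞ f) (x u v : E n) :
    inner ℝ (hess f x u) v = inner ℝ u (hess f x v) := by
  have h2 : ∀ u v, inner ℝ (hess f x u) v = fderiv ℝ (fderiv ℝ f) x u v := by
    intro u v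
    have h3 : HasFDerivAt (fun y => inner ℝ (gradient f y) v)
        ((innerSL ℝ v).comp (hess f x)) x := by
      have := (innerSL ℝ v).hasFDerivAt.comp x (hasFDerivAt_gradient hf x)
      refine this.congr_of_eventuallyEq (Filter.Eventually.of_forall fun y => ?_)
      simp
    have h4 : HasFDerivAt (fun y => fderiv ℝ f y v)
        ((ContinuousLinearMap.apply ℝ ℝ v).comp (fderiv ℝ (fderiv ℝ f) x)) x := by
      have h5 : ContDiff ℝ ∞ (fderiv ℝ f) := hf.fderiv_right (by simp)
      exact (ContinuousLinearMap.apply ℝ ℝ v).hasFDerivAt.comp x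
        (h5.differentiable (by simp) x).hasFDerivAt
    have h6 : (fun y => inner ℝ (gradient f y) v) = fun y => fderiv ℝ f y v := by
      ext y; exact inner_gradient_eq hf y v
    rw [h6] at h3
    have h7 := congrArg (fun T => T u) (h3.unique h4)
    simpa [real_inner_comm] using h7
  have hs := (hf.contDiffAt (x := x)).isSymmSndFDerivAt
    (by rw [minSmoothness_of_isRCLikeNormedField]; exact WithTop.coe_le_coe.2 le_top)
  rw [h2, hs u v, ← h2, real_inner_comm]

/-- Equality of mixed third derivatives. It makes the third order terms cancel in `divG_rellich`,
which is why the Rellich field gives second order information only. -/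
lemma fderiv_hess_symm (hf : ContDiff ℝ ∞ f) (x u v : E n) :
    fderiv ℝ (hess f) x u v = fderiv ℝ (hess f) x v u := by
  have hs := ((contDiff_gradient hf).contDiffAt (x := x)).isSymmSndFDerivAt
    (by rw [minSmoothness_of_isRCLikeNormedField]; exact WithTop.coe_le_coe.2 le_top)
  exact hs u v

end Hessian

/-- The divergence adapted to the Gaussian weight. -/
noncomputable def divG (s : ℝ) (Y : E n → E n) (x : E n) : ℝ :=
  tr (fderiv ℝ Y x) - inner ℝ x (Y x) / (2 * s)

lemma divG_add {s : ℝ} {Y W : E n → E n} {x : E n} (hY : DifferentiableAt ℝ Y x)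
    (hW : DifferentiableAt ℝ W x) :
    divG s (fun y => Y y + W y) x = divG s Y x + divG s W x := by
  have h1 : HasFDerivAt (fun y => Y y + W y) (fderiv ℝ Y x + fderiv ℝ W x) x :=
    hY.hasFDerivAt.add hW.hasFDerivAt
  simp only [divG, h1.fderiv, tr_add, inner_add_right]
  ring

lemma divG_smul {s : ℝ} {h : E n → ℝ} {Y : E n → E n} {x : E n} (hh : DifferentiableAt ℝ h x)
    (hY : DifferentiableAt ℝ Y x) :
    divG s (fun y => h y • Y y) x = h x * divG s Y x + fderiv ℝ h x (Y x) := by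
  rw [divG, tr_fderiv_smul hh.hasFDerivAt hY.hasFDerivAt, divG, inner_smul_right]
  ring

section Fields
variable (A : E n → E n →L[ℝ] E n) (b : E n → E n) (V : E n → ℝ) (s : ℝ) (f q : E n → ℝ)

/-- The flux `A ∇f`. -/
noncomputable def flux (y : E n) : E n := A y (gradient f y)

/-- The drift `A x / (2 s) + b`. -/
noncomputable def drift (y : E n) : E n := (1 / (2 * s)) • A y y + b y

/-- The coefficient of `1/s` in the regular part of `(∂ₜG - div (A ∇G) + div (b G)) / G`. -/
noncomputable def potP (y : E n) : ℝ := (tr (A y) - n) / 2 - inner ℝ (b y) y / 2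

/-- The coefficient of `1/s²` in the regular part of `(∂ₜG - div (A ∇G) + div (b G)) / G`. -/
noncomputable def potQ (y : E n) : ℝ := -inner ℝ (A y y - y) y / 4

/-- The regular part of `(∂ₜG - div (A ∇G) + div (b G)) / G`. -/
noncomputable def potF (y : E n) : ℝ := potP A b y / s + potQ A y / s ^ 2

/-- The antisymmetric part of the conjugated operator. -/
noncomputable def antiPart (y : E n) : ℝ :=
  q y + inner ℝ (drift A b s y) (gradient f y) + potF A b s y * f y / 2

/-- The second order symmetric operator `G⁻¹ div (G A ∇f)`. -/
noncomputable def symPart (y : E n) : ℝ := divG s (flux A f) y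

/-- The density (relative to `G`) of the boundary energy. -/
noncomputable def density (ρ k₀ : ℝ) (y : E n) : ℝ :=
  ρ * inner ℝ (flux A f y) (gradient f y)
    - (k₀ + ρ * (V y - potF A b s y / 2)) * f y ^ 2

/-- The Rellich type vector field. -/
noncomputable def rellich (y : E n) : E n := tr (hess f y) • flux A f y - hess f y (flux A f y)

variable {A b V s f q}

lemma hasFDerivAt_flux {x : E n} (hA : DifferentiableAt ℝ A x) (hf : ContDiff ℝ ∞ f) :
    DifferentiableAt ℝ (flux A f) x ∧ ∀ v, fderiv ℝ (flux A f) x v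
      = fderiv ℝ A x v (gradient f x) + A x (hess f x v) := by
  have h := hA.hasFDerivAt.clm_apply (hasFDerivAt_gradient hf x)
  refine ⟨h.differentiableAt, fun v => ?_⟩
  have h' : HasFDerivAt (flux A f) _ x := h
  rw [h'.fderiv]
  simp [add_comm]

lemma hasFDerivAt_apply_self {x : E n} (hA : DifferentiableAt ℝ A x) :
    DifferentiableAt ℝ (fun y => A y y) x ∧ ∀ v, fderiv ℝ (fun y => A y y) x v
      = fderiv ℝ A x v x + A x v := by
  have h := hA.hasFDerivAt.clm_apply (hasFDerivAt_id x)
  refine ⟨h.differentiableAt, fun v => ?_⟩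
  have h' : HasFDerivAt (fun y => A y y) _ x := h
  rw [h'.fderiv]
  simp [add_comm]

lemma hasFDerivAt_drift {x : E n} (hA : DifferentiableAt ℝ A x) (hb : DifferentiableAt ℝ b x) :
    DifferentiableAt ℝ (drift A b s) x ∧ ∀ v, fderiv ℝ (drift A b s) x v
      = (1 / (2 * s)) • (fderiv ℝ A x v x + A x v) + fderiv ℝ b x v := by
  obtain ⟨h1, h2⟩ := hasFDerivAt_apply_self hA
  have h : HasFDerivAt (drift A b s) _ x :=
    (h1.hasFDerivAt.const_smul (1 / (2 * s))).add hb.hasFDerivAt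
  refine ⟨h.differentiableAt, fun v => ?_⟩
  rw [h.fderiv]
  simp [h2]

lemma hasFDerivAt_inner {Y W : E n → E n} {x : E n} (hY : DifferentiableAt ℝ Y x)
    (hW : DifferentiableAt ℝ W x) :
    DifferentiableAt ℝ (fun y => inner ℝ (Y y) (W y)) x ∧
      ∀ v, fderiv ℝ (fun y => inner ℝ (Y y) (W y)) x v
        = inner ℝ (Y x) (fderiv ℝ W x v) + inner ℝ (fderiv ℝ Y x v) (W x) :=
  ⟨hY.inner ℝ hW, fun v => fderiv_inner_apply ℝ hY hW v⟩

lemma hasFDerivAt_potP {x : E n} (hA : DifferentiableAt ℝ A x) (hb : DifferentiableAt ℝ b x) :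
    DifferentiableAt ℝ (potP A b) x ∧ ∀ v, fderiv ℝ (potP A b) x v
      = tr (fderiv ℝ A x v) / 2 - (inner ℝ (fderiv ℝ b x v) x + inner ℝ (b x) v) / 2 := by
  obtain ⟨h1, h2⟩ := hasFDerivAt_inner (W := fun y => y) hb differentiableAt_id
  have h3 : HasFDerivAt (fun y => tr (A y)) ((trL n).comp (fderiv ℝ A x)) x :=
    (trL n).hasFDerivAt.comp x hA.hasFDerivAt
  have h : HasFDerivAt (potP A b)
      ((1 / 2 : ℝ) • ((trL n).comp (fderiv ℝ A x))
        - (1 / 2 : ℝ) • fderiv ℝ (fun y => inner ℝ (b y) y) x) x := by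
    refine (((h3.sub_const (n : ℝ)).const_mul (1 / 2)).sub
      (h1.hasFDerivAt.const_mul (1 / 2))).congr_of_eventuallyEq
      (Filter.Eventually.of_forall fun y => ?_)
    simp [potP]; ring
  refine ⟨h.differentiableAt, fun v => ?_⟩
  rw [h.fderiv]
  simp only [sub_apply, smul_apply, h2, fderiv_fun_id,
    ContinuousLinearMap.comp_apply, trL_apply, smul_eq_mul, ContinuousLinearMap.id_apply]
  ring

lemma hasFDerivAt_potQ {x : E n} (hA : DifferentiableAt ℝ A x) :
    DifferentiableAt ℝ (potQ A) x ∧ ∀ v, fderiv ℝ (potQ A) x v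
      = -(inner ℝ (fderiv ℝ A x v x + A x v - v) x + inner ℝ (A x x - x) v) / 4 := by
  obtain ⟨h1, h2⟩ := hasFDerivAt_apply_self hA
  have h4 : HasFDerivAt (fun y => A y y - y) _ x := h1.hasFDerivAt.sub (hasFDerivAt_id x)
  obtain ⟨h5, h6⟩ := hasFDerivAt_inner (W := fun y => y) h4.differentiableAt differentiableAt_id
  have h : HasFDerivAt (potQ A)
      ((-1 / 4 : ℝ) • fderiv ℝ (fun y => inner ℝ (A y y - y) y) x) x := by
    refine (h5.hasFDerivAt.const_mul (-1 / 4)).congr_of_eventuallyEq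
      (Filter.Eventually.of_forall fun y => ?_)
    simp [potQ]; ring
  refine ⟨h.differentiableAt, fun v => ?_⟩
  rw [h.fderiv]
  simp only [sub_apply, smul_apply, h6, fderiv_fun_id,
    h4.fderiv, h2, smul_eq_mul, ContinuousLinearMap.id_apply, sub_apply]
  ring

lemma hasFDerivAt_potF {x : E n} (hA : DifferentiableAt ℝ A x) (hb : DifferentiableAt ℝ b x) :
    DifferentiableAt ℝ (potF A b s) x ∧ ∀ v, fderiv ℝ (potF A b s) x v
      = fderiv ℝ (potP A b) x v / s + fderiv ℝ (potQ A) x v / s ^ 2 := by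
  have h : HasFDerivAt (potF A b s)
      ((1 / s) • fderiv ℝ (potP A b) x + (1 / s ^ 2) • fderiv ℝ (potQ A) x) x := by
    refine (((hasFDerivAt_potP hA hb).1.hasFDerivAt.const_mul (1 / s)).add
      ((hasFDerivAt_potQ hA).1.hasFDerivAt.const_mul (1 / s ^ 2))).congr_of_eventuallyEq
      (Filter.Eventually.of_forall fun y => ?_)
    simp [potF]; ring
  refine ⟨h.differentiableAt, fun v => ?_⟩
  rw [h.fderiv]
  simp
  ring

lemma hasFDerivAt_antiPart {x : E n} (hA : DifferentiableAt ℝ A x) (hb : DifferentiableAt ℝ b x)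
    (hf : ContDiff ℝ ∞ f) (hq : ContDiff ℝ ∞ q) :
    DifferentiableAt ℝ (antiPart A b s f q) x ∧ ∀ v, fderiv ℝ (antiPart A b s f q) x v
      = inner ℝ (gradient q x) v + inner ℝ (fderiv ℝ (drift A b s) x v) (gradient f x)
        + inner ℝ (drift A b s x) (hess f x v)
        + (fderiv ℝ (potF A b s) x v * f x + potF A b s x * inner ℝ (gradient f x) v) / 2 := by
  obtain ⟨h1, h2⟩ := hasFDerivAt_inner (hasFDerivAt_drift (s := s) hA hb).1
    (hasFDerivAt_gradient hf x).differentiableAt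
  have h3 := (hasFDerivAt_potF (s := s) hA hb).1.hasFDerivAt
  have h : HasFDerivAt (antiPart A b s f q) _ x :=
    ((hasFDerivAt_of_contDiff hq x).add h1.hasFDerivAt).add
      ((h3.mul (hasFDerivAt_of_contDiff hf x)).mul_const (1 / 2)) |>.congr_of_eventuallyEq
      (Filter.Eventually.of_forall fun y => by simp [antiPart]; ring)
  refine ⟨h.differentiableAt, fun v => ?_⟩
  rw [h.fderiv]
  simp only [add_apply, smul_apply, h2, smul_eq_mul,
    (hasFDerivAt_gradient hf x).fderiv, innerSL_apply_apply]
  ring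

lemma hasFDerivAt_density {ρ k₀ : ℝ} {x : E n} (hA : DifferentiableAt ℝ A x)
    (hb : DifferentiableAt ℝ b x) (hV : DifferentiableAt ℝ V x) (hf : ContDiff ℝ ∞ f) :
    DifferentiableAt ℝ (density A b V s f ρ k₀) x ∧ ∀ v, fderiv ℝ (density A b V s f ρ k₀) x v
      = ρ * (inner ℝ (fderiv ℝ (flux A f) x v) (gradient f x) + inner ℝ (flux A f x) (hess f x v))
        - ρ * (fderiv ℝ V x v - fderiv ℝ (potF A b s) x v / 2) * f x ^ 2
        - 2 * (k₀ + ρ * (V x - potF A b s x / 2)) * f x * inner ℝ (gradient f x) v := by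
  obtain ⟨h1, h2⟩ := hasFDerivAt_inner (hasFDerivAt_flux hA hf).1
    (hasFDerivAt_gradient hf x).differentiableAt
  have h3 := (hasFDerivAt_potF (s := s) hA hb).1.hasFDerivAt
  have h4 := ((hV.hasFDerivAt.sub (h3.mul_const (1 / 2))).const_mul ρ).const_add k₀
  have h5 := hasFDerivAt_of_contDiff hf x
  have h : HasFDerivAt (density A b V s f ρ k₀) _ x :=
    (h1.hasFDerivAt.const_mul ρ).sub (h4.mul (h5.mul h5)) |>.congr_of_eventuallyEq
      (Filter.Eventually.of_forall fun y => by simp [density]; ring)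
  refine ⟨h.differentiableAt, fun v => ?_⟩
  rw [h.fderiv]
  simp only [add_apply, sub_apply,
    smul_apply, h2, smul_eq_mul,
    (hasFDerivAt_gradient hf x).fderiv, innerSL_apply_apply, Pi.mul_apply, Pi.sub_apply]
  ring

lemma differentiableAt_rellich {x : E n} (hA : DifferentiableAt ℝ A x) (hf : ContDiff ℝ ∞ f) :
    DifferentiableAt ℝ (rellich A f) x := by
  have h1 := (hasFDerivAt_flux hA hf).1
  have h2 : DifferentiableAt ℝ (fun y => tr (hess f y)) x :=
    (trL n).differentiableAt.comp x (hasFDerivAt_hess hf x).differentiableAt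
  exact (h2.smul h1).sub ((hasFDerivAt_hess hf x).differentiableAt.clm_apply h1)

/-- The pointwise form of the second order (Rellich) identity. -/
lemma divG_rellich {x : E n} (hA : DifferentiableAt ℝ A x) (hf : ContDiff ℝ ∞ f) :
    divG s (rellich A f) x = tr (hess f x) * symPart A s f x
      - tr ((hess f x).comp (fderiv ℝ (flux A f) x))
      + inner ℝ x (hess f x (flux A f x)) / (2 * s) := by
  obtain ⟨h1, h1'⟩ := hasFDerivAt_flux hA hf
  have h2 : HasFDerivAt (fun y => tr (hess f y)) ((trL n).comp (fderiv ℝ (hess f) x)) x :=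
    (trL n).hasFDerivAt.comp x (hasFDerivAt_hess hf x)
  have h3 := (hasFDerivAt_hess hf x).clm_apply h1.hasFDerivAt
  have h4 : HasFDerivAt (rellich A f) _ x := (h2.smul h1.hasFDerivAt).sub h3
  have h5 : ((fderiv ℝ (hess f) x).flip (flux A f x)) = fderiv ℝ (hess f) x (flux A f x) := by
    ext1 v; exact fderiv_hess_symm hf x v _
  rw [divG, h4.fderiv, symPart, divG, tr_sub, tr_add, tr_add, tr_smul, tr_smulRight, h5]
  simp only [rellich, inner_sub_right, inner_smul_right, ContinuousLinearMap.comp_apply,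
    trL_apply]
  ring

end Fields

end ParabolicCarleman

/-! ### The commutator identity. -/

namespace ParabolicCarleman
variable {n : ℕ} {A : E n → E n →L[ℝ] E n} {b : E n → E n} {V : E n → ℝ} {s : ℝ} {f q : E n → ℝ}

/-- The vector field of the first order multiplier. -/
noncomputable def multField (A : E n → E n →L[ℝ] E n) (b : E n → E n) (V : E n → ℝ) (s : ℝ)
    (f q : E n → ℝ) (ρ k₀ θ : ℝ) (y : E n) : E n :=
  (2 * ρ * antiPart A b s f q y + θ / 2 * f y) • flux A f y
    + (-density A b V s f ρ k₀ y) • drift A b s y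

/-- The quadratic form produced by the commutators. -/
noncomputable def commForm (A : E n → E n →L[ℝ] E n) (b : E n → E n) (V : E n → ℝ) (s : ℝ)
    (f : E n → ℝ) (ρ k₀ θ U ρt kt : ℝ) (x : E n) : ℝ :=
  let X := flux A f x
  let p := gradient f x
  let Z := drift A b s x
  let F₁ := (1 / (2 * s)) * (∑ i, (fderiv ℝ A x (EuclideanSpace.single i 1) x) i)
    + tr (fderiv ℝ b x)
  ρt * inner ℝ X p - θ / 2 * inner ℝ X p + θ / 2 * U * f x ^ 2 - kt * f x ^ 2
    + ρ * inner ℝ (fderiv ℝ A x Z p) p - 2 * ρ * inner ℝ (fderiv ℝ (drift A b s) x X) p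
    - ρ * fderiv ℝ (potF A b s) x X * f x
    - ρ * (fderiv ℝ V x Z - fderiv ℝ (potF A b s) x Z / 2) * f x ^ 2
    + F₁ * (ρ * inner ℝ X p - (k₀ + ρ * (V x - potF A b s x / 2)) * f x ^ 2)

/-- The time derivative of the energy density `G φ`, divided by `G`. -/
noncomputable def densityDeriv (A : E n → E n →L[ℝ] E n) (b : E n → E n) (V : E n → ℝ) (s : ℝ)
    (f q : E n → ℝ) (ρ k₀ ρt kt : ℝ) (x : E n) : ℝ :=
  ρt * inner ℝ (flux A f x) (gradient f x) + 2 * ρ * inner ℝ (flux A f x) (gradient q x)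
    - kt * f x ^ 2 - 2 * (k₀ + ρ * (V x - potF A b s x / 2)) * f x * q x
    + density A b V s f ρ k₀ x * (-n / (2 * s) + ‖x‖ ^ 2 / (4 * s ^ 2))

lemma tr_drift {x : E n} (hA : DifferentiableAt ℝ A x) (hb : DifferentiableAt ℝ b x) :
    tr (fderiv ℝ (drift A b s) x) = (1 / (2 * s)) * (tr (A x)
      + ∑ i, (fderiv ℝ A x (EuclideanSpace.single i 1) x) i) + tr (fderiv ℝ b x) := by
  simp only [tr, (hasFDerivAt_drift (s := s) hA hb).2]
  simp only [PiLp.add_apply, PiLp.smul_apply, smul_eq_mul, Finset.sum_add_distrib,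
    ← Finset.mul_sum]
  ring

/-- The field (2ρ·antiPart + θf/2) A∇f produces the symmetric operator times the multiplier, and −φZ
the transport of the energy density φ. The second derivatives of f cancel between the two, by
symmetry of A and of the Hessian. The condition `hU` makes the coefficient of f·antiPart on the left
agree with the f² coefficient of φ. -/
lemma commutator_identity (hs : 0 < s) {x : E n} (hA : DifferentiableAt ℝ A x)
    (hsymm : ∀ u v, inner ℝ (A x u) v = inner ℝ u (A x v))
    (hb : DifferentiableAt ℝ b x) (hV : DifferentiableAt ℝ V x)
    (hf : ContDiff ℝ ∞ f) (hq : ContDiff ℝ ∞ q) (ρ k₀ θ U ρt kt : ℝ)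
    (hU : ρ * U + θ / 4 = k₀ + ρ * (V x - potF A b s x / 2)) :
    2 * ρ * antiPart A b s f q x * (symPart A s f x + U * f x)
      + θ / 2 * f x * (antiPart A b s f q x + symPart A s f x + U * f x)
    = divG s (multField A b V s f q ρ k₀ θ) x - densityDeriv A b V s f q ρ k₀ ρt kt x
      + commForm A b V s f ρ k₀ θ U ρt kt x := by
  obtain ⟨dX, hX⟩ := hasFDerivAt_flux hA hf
  obtain ⟨dZ, hZ⟩ := hasFDerivAt_drift (s := s) hA hb
  obtain ⟨dg, hg⟩ := hasFDerivAt_antiPart (s := s) hA hb hf hq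
  obtain ⟨dφ, hφ⟩ := hasFDerivAt_density (s := s) (ρ := ρ) (k₀ := k₀) hA hb hV hf
  have df := hasFDerivAt_of_contDiff hf x
  have dc : HasFDerivAt (fun y => 2 * ρ * antiPart A b s f q y + θ / 2 * f y)
      ((2 * ρ) • fderiv ℝ (antiPart A b s f q) x + (θ / 2) • innerSL ℝ (gradient f x)) x :=
    (dg.hasFDerivAt.const_mul (2 * ρ)).add (df.const_mul (θ / 2))
  have e1 : divG s (multField A b V s f q ρ k₀ θ) x
      = (2 * ρ * antiPart A b s f q x + θ / 2 * f x) * symPart A s f x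
        + (2 * ρ * fderiv ℝ (antiPart A b s f q) x (flux A f x)
          + θ / 2 * inner ℝ (gradient f x) (flux A f x))
        - density A b V s f ρ k₀ x * divG s (drift A b s) x
        - fderiv ℝ (density A b V s f ρ k₀) x (drift A b s x) := by
    unfold multField
    rw [divG_add (dc.differentiableAt.fun_smul dX) (dφ.fun_neg.fun_smul dZ),
      divG_smul dc.differentiableAt dX, divG_smul dφ.fun_neg dZ, dc.fderiv,
      dφ.hasFDerivAt.fun_neg.fderiv, symPart]
    simp only [add_apply, smul_apply, neg_apply, smul_eq_mul, innerSL_apply_apply]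
    ring
  -- The weighted divergence of Z plus ∂ₜ log G: the pure Gaussian terms cancel against A = I, so
  -- only A − I enters at order s⁻². The remaining sum collects the derivatives of A and b that
  -- `potF` leaves out.
  have e2 : divG s (drift A b s) x + (-n / (2 * s) + ‖x‖ ^ 2 / (4 * s ^ 2))
      = potF A b s x + ((1 / (2 * s)) * (∑ i, (fderiv ℝ A x (EuclideanSpace.single i 1) x) i)
    + tr (fderiv ℝ b x)) := by
    rw [divG, tr_drift hA hb]
    simp only [drift, potF, potP, potQ, inner_add_right, inner_smul_right, inner_sub_left,
      real_inner_self_eq_norm_sq]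
    rw [real_inner_comm x (b x), real_inner_comm x (A x x)]
    field_simp
    ring
  rw [e1, hg, hφ, hX]
  simp only [commForm, densityDeriv]
  have e3 : divG s (drift A b s) x = potF A b s x + ((1 / (2 * s)) *
      (∑ i, (fderiv ℝ A x (EuclideanSpace.single i 1) x) i)
      + tr (fderiv ℝ b x)) - (-n / (2 * s) + ‖x‖ ^ 2 / (4 * s ^ 2)) := by linarith
  rw [e3]
  have s1 : inner ℝ (gradient f x) (flux A f x) = inner ℝ (flux A f x) (gradient f x) :=
    real_inner_comm _ _
  have s2 : inner ℝ (gradient q x) (flux A f x) = inner ℝ (flux A f x) (gradient q x) :=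
    real_inner_comm _ _
  have s3 : inner ℝ (drift A b s x) (hess f x (flux A f x))
      = inner ℝ (flux A f x) (hess f x (drift A b s x)) := by
    rw [← hess_symm hf, real_inner_comm]
  have s4 : inner ℝ (A x (hess f x (drift A b s x))) (gradient f x)
      = inner ℝ (flux A f x) (hess f x (drift A b s x)) := by
    rw [hsymm, real_inner_comm]; rfl
  have s5 : antiPart A b s f q x = q x + inner ℝ (gradient f x) (drift A b s x)
      + potF A b s x * f x / 2 := by
    rw [antiPart, real_inner_comm]
  rw [inner_add_left, s1, s2, s3, s4, s5]
  have s6 : density A b V s f ρ k₀ x = ρ * inner ℝ (flux A f x) (gradient f x)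
    - (k₀ + ρ * (V x - potF A b s x / 2)) * f x ^ 2 := rfl
  rw [s6, ← hU]
  ring

end ParabolicCarleman

/-! ### Pointwise bounds for the coefficients and the error weights. -/

namespace ParabolicCarleman
variable {n : ℕ}

/-- Bounds on frozen coefficients at a point of differentiability. -/
structure PointBounds (A : E n → E n →L[ℝ] E n) (b : E n → E n) (V : E n → ℝ) (C α : ℝ)
    (x : E n) : Prop where
  one_le : 1 ≤ C
  dim_le : (n : ℝ) ≤ C
  norm_le : ‖x‖ ≤ 4
  diffA : DifferentiableAt ℝ A x
  diffb : DifferentiableAt ℝ b x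
  diffV : DifferentiableAt ℝ V x
  symm : ∀ u v, inner ℝ (A x u) v = inner ℝ u (A x v)
  lower : ∀ v, C⁻¹ * ‖v‖ ^ 2 ≤ inner ℝ (A x v) v
  boundA : ‖A x‖ ≤ C
  boundA_sub : ‖A x - 1‖ ≤ C * ‖x‖
  boundA' : ‖fderiv ℝ A x‖ ≤ C
  boundb : ‖b x‖ ≤ C * α
  boundb' : ‖fderiv ℝ b x‖ ≤ C * α
  boundV : |V x| ≤ C * α ^ 2
  boundV' : ‖fderiv ℝ V x‖ ≤ C * α ^ 2

section
variable {A : E n → E n →L[ℝ] E n} {b : E n → E n} {V : E n → ℝ} {C α s : ℝ} {x : E n}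

lemma PointBounds.norm_A_apply (h : PointBounds A b V C α x) (v : E n) : ‖A x v‖ ≤ C * ‖v‖ :=
  ContinuousLinearMap.le_of_opNorm_le _ h.boundA v

lemma PointBounds.norm_A_apply_sub (h : PointBounds A b V C α x) (v : E n) :
    ‖A x v - v‖ ≤ C * ‖x‖ * ‖v‖ :=
  ContinuousLinearMap.le_of_opNorm_le _ h.boundA_sub v

lemma PointBounds.norm_A'_apply (h : PointBounds A b V C α x) (v w : E n) :
    ‖fderiv ℝ A x v w‖ ≤ C * ‖v‖ * ‖w‖ :=
  ContinuousLinearMap.le_of_opNorm_le _ (ContinuousLinearMap.le_of_opNorm_le _ h.boundA' v) w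

lemma PointBounds.norm_b'_apply (h : PointBounds A b V C α x) (v : E n) :
    ‖fderiv ℝ b x v‖ ≤ C * α * ‖v‖ :=
  ContinuousLinearMap.le_of_opNorm_le _ h.boundb' v

lemma PointBounds.norm_V'_apply (h : PointBounds A b V C α x) (v : E n) :
    |fderiv ℝ V x v| ≤ C * α ^ 2 * ‖v‖ :=
  ContinuousLinearMap.le_of_opNorm_le _ h.boundV' v

lemma abs_inner_le (u v : E n) {a c : ℝ} (hu : ‖u‖ ≤ a) (hv : ‖v‖ ≤ c) :
    |inner ℝ u v| ≤ a * c :=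
  (abs_real_inner_le_norm u v).trans
    (mul_le_mul hu hv (norm_nonneg _) ((norm_nonneg _).trans hu))

lemma PointBounds.norm_drift (h : PointBounds A b V C α x) (hs : 0 < s) :
    s * ‖drift A b s x‖ ≤ C * (‖x‖ + α * s) := by
  have h1 : ‖drift A b s x‖ ≤ (1 / (2 * s)) * (C * ‖x‖) + C * α := by
    refine (norm_add_le _ _).trans (add_le_add ?_ h.boundb)
    rw [norm_smul, Real.norm_of_nonneg (by positivity)]
    exact mul_le_mul_of_nonneg_left (h.norm_A_apply x) (by positivity)
  have hC := h.one_le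
  have : 0 ≤ C * ‖x‖ := by positivity
  calc s * ‖drift A b s x‖ ≤ s * ((1 / (2 * s)) * (C * ‖x‖) + C * α) := by gcongr
    _ = C * ‖x‖ / 2 + C * (α * s) := by field_simp
    _ ≤ _ := by linarith

/-- The bound on A − I supplies the factor ‖x‖ in the trace term, and C absorbs the dimension; the
drift b costs a factor α. -/
lemma PointBounds.abs_potP (h : PointBounds A b V C α x) (hα : 1 ≤ α) :
    |potP A b x| ≤ C ^ 2 * (α * ‖x‖) := by
  have hC := h.one_le
  have h1 : |tr (A x) - n| ≤ C * (C * ‖x‖) := by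
    rw [← tr_one (n := n), ← tr_sub]
    refine (abs_tr_le _).trans (mul_le_mul h.dim_le h.boundA_sub (norm_nonneg _) (by linarith))
  have h2 := abs_inner_le (b x) x h.boundb le_rfl
  have h3 : C * α * ‖x‖ ≤ C ^ 2 * (α * ‖x‖) := by
    have : C * (α * ‖x‖) ≤ C * (C * (α * ‖x‖)) :=
      mul_le_mul_of_nonneg_left (le_mul_of_one_le_left (by positivity) hC) (by linarith)
    nlinarith
  have h4 : C * (C * ‖x‖) ≤ C ^ 2 * (α * ‖x‖) := by
    have : ‖x‖ ≤ α * ‖x‖ := by nlinarith [norm_nonneg x]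
    nlinarith [sq_nonneg C]
  unfold potP
  rw [abs_le] at *
  constructor <;> linarith

/-- Two powers of ‖x‖ come from the quadratic form and the third from A − I. This cubic term is the
most demanding error, and it fixes the shape of θ. -/
lemma PointBounds.abs_potQ (h : PointBounds A b V C α x) :
    |potQ A x| ≤ C * ‖x‖ ^ 3 := by
  have hC := h.one_le
  have h2 := abs_inner_le (A x x - x) x (h.norm_A_apply_sub x) le_rfl
  have h3 : 0 ≤ C * ‖x‖ ^ 3 := by positivity
  have h4 : C * ‖x‖ * ‖x‖ * ‖x‖ = C * ‖x‖ ^ 3 := by ring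
  unfold potQ
  rw [abs_le] at *
  constructor <;> linarith

lemma PointBounds.abs_potP' (h : PointBounds A b V C α x) (hα : 1 ≤ α) (v : E n) :
    |fderiv ℝ (potP A b) x v| ≤ 3 * C ^ 2 * α * ‖v‖ := by
  have hC := h.one_le
  rw [(hasFDerivAt_potP h.diffA h.diffb).2]
  have h1 : |tr (fderiv ℝ A x v)| ≤ C * (C * ‖v‖) := by
    refine (abs_tr_le _).trans (mul_le_mul h.dim_le
      (ContinuousLinearMap.le_of_opNorm_le _ h.boundA' v) (norm_nonneg _) (by linarith))
  have h2 := abs_inner_le (fderiv ℝ b x v) x (h.norm_b'_apply v) h.norm_le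
  have h3 := abs_inner_le (b x) v h.boundb le_rfl
  have h4 : C * (α * ‖v‖) ≤ C ^ 2 * (α * ‖v‖) := by gcongr; nlinarith
  have h5 : C ^ 2 * ‖v‖ ≤ C ^ 2 * (α * ‖v‖) := by
    gcongr; nlinarith [norm_nonneg v]
  rw [abs_le] at *
  constructor <;> nlinarith

lemma PointBounds.abs_potQ' (h : PointBounds A b V C α x) (v : E n) :
    |fderiv ℝ (potQ A) x v| ≤ C * ‖x‖ ^ 2 * ‖v‖ := by
  have hC := h.one_le
  rw [(hasFDerivAt_potQ h.diffA).2, add_sub_assoc, inner_add_left]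
  have h1 := abs_inner_le (fderiv ℝ A x v x) x (h.norm_A'_apply v x) le_rfl
  have h2 := abs_inner_le (A x v - v) x (h.norm_A_apply_sub v) le_rfl
  have h3 := abs_inner_le (A x x - x) v (h.norm_A_apply_sub x) le_rfl
  have h4 : 0 ≤ C * ‖x‖ ^ 2 * ‖v‖ := by positivity
  rw [abs_le] at *
  constructor <;> nlinarith

lemma PointBounds.abs_potF (h : PointBounds A b V C α x) (hα : 1 ≤ α) (hs : 0 < s) :
    |potF A b s x| ≤ C ^ 2 * (α * ‖x‖ / s + ‖x‖ ^ 3 / s ^ 2) := by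
  have hC := h.one_le
  have h1 : |potP A b x / s| ≤ C ^ 2 * (α * ‖x‖ / s) := by
    rw [abs_div, abs_of_pos hs, ← mul_div_assoc]
    gcongr; exact h.abs_potP hα
  have h2 : |potQ A x / s ^ 2| ≤ C ^ 2 * (‖x‖ ^ 3 / s ^ 2) := by
    rw [abs_div, abs_of_pos (by positivity : 0 < s ^ 2), ← mul_div_assoc]
    gcongr
    refine h.abs_potQ.trans ?_
    gcongr
    nlinarith
  unfold potF
  refine (abs_add_le _ _).trans ?_
  linarith

lemma PointBounds.abs_potF' (h : PointBounds A b V C α x) (hα : 1 ≤ α) (hs : 0 < s) (v : E n) :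
    s * |fderiv ℝ (potF A b s) x v| ≤ 3 * C ^ 2 * (α + ‖x‖ ^ 2 / s) * ‖v‖ := by
  have hC := h.one_le
  rw [(hasFDerivAt_potF h.diffA h.diffb).2]
  have h1 := h.abs_potP' hα v
  have h2 := h.abs_potQ' v
  have h3 : s * |fderiv ℝ (potP A b) x v / s + fderiv ℝ (potQ A) x v / s ^ 2|
      ≤ |fderiv ℝ (potP A b) x v| + |fderiv ℝ (potQ A) x v| / s := by
    calc s * |fderiv ℝ (potP A b) x v / s + fderiv ℝ (potQ A) x v / s ^ 2|
        ≤ s * (|fderiv ℝ (potP A b) x v / s| + |fderiv ℝ (potQ A) x v / s ^ 2|) := by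
          gcongr; exact abs_add_le _ _
      _ = _ := by
          rw [abs_div, abs_div, abs_of_pos hs, abs_of_pos (by positivity : 0 < s ^ 2)]
          field_simp
  have h4 : |fderiv ℝ (potQ A) x v| / s ≤ C * ‖x‖ ^ 2 * ‖v‖ / s := by gcongr
  have h5 : C * ‖x‖ ^ 2 * ‖v‖ / s ≤ 3 * C ^ 2 * (‖x‖ ^ 2 / s) * ‖v‖ := by
    have e : C * ‖x‖ ^ 2 * ‖v‖ / s = C * (‖x‖ ^ 2 / s) * ‖v‖ := by ring
    rw [e]
    gcongr; nlinarith
  nlinarith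

/-- The first order part of `(∂ₜG - div (A ∇G) + div (b G)) / G` is of lower order. -/
lemma PointBounds.abs_first (h : PointBounds A b V C α x) (hs : 0 < s) :
    s * |(1 / (2 * s)) * (∑ i, (fderiv ℝ A x (EuclideanSpace.single i 1) x) i)
      + tr (fderiv ℝ b x)| ≤ C ^ 2 * (‖x‖ + α * s) := by
  have hC := h.one_le
  have h1 : |∑ i, (fderiv ℝ A x (EuclideanSpace.single i 1) x) i| ≤ C * (C * ‖x‖) := by
    calc |∑ i, (fderiv ℝ A x (EuclideanSpace.single i 1) x) i|
        ≤ ∑ i, |(fderiv ℝ A x (EuclideanSpace.single i 1) x) i| := Finset.abs_sum_le_sum_abs _ _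
      _ ≤ ∑ i : Fin n, C * ‖x‖ := by
          refine Finset.sum_le_sum fun i _ => (abs_apply_le_norm _ _).trans ?_
          simpa using h.norm_A'_apply (EuclideanSpace.single i 1) x
      _ = n * (C * ‖x‖) := by simp
      _ ≤ _ := by gcongr; exact h.dim_le
  have h2 : |tr (fderiv ℝ b x)| ≤ C * (C * α) :=
    (abs_tr_le _).trans (mul_le_mul h.dim_le h.boundb' (norm_nonneg _) (by linarith))
  calc s * |(1 / (2 * s)) * (∑ i, (fderiv ℝ A x (EuclideanSpace.single i 1) x) i)
      + tr (fderiv ℝ b x)|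
      ≤ s * ((1 / (2 * s)) * (C * (C * ‖x‖)) + C * (C * α)) := by
        gcongr
        refine (abs_add_le _ _).trans (add_le_add ?_ h2)
        rw [abs_mul, abs_of_pos (by positivity : 0 < 1 / (2 * s))]
        gcongr
    _ = C ^ 2 * ‖x‖ / 2 + C ^ 2 * (α * s) := by field_simp
    _ ≤ _ := by nlinarith [show 0 ≤ C ^ 2 * ‖x‖ by positivity]

end

/-- Weight of `|∇f|²` in the error terms. -/
noncomputable def errP (α s e : ℝ) : ℝ := e + Real.sqrt s + α * s
/-- Weight of `|f| |∇f|` in the error terms. -/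
noncomputable def errC (α s e : ℝ) : ℝ := α + e ^ 2 / s
/-- Weight of `f²` in the error terms. -/
noncomputable def errF (α s e : ℝ) : ℝ := α ^ 2 + α * e / s + e ^ 3 / s ^ 2
/-- The total error density. -/
noncomputable def err (α s e w u : ℝ) : ℝ :=
  errP α s e * u ^ 2 + errC α s e * (|w| * u) + errF α s e * w ^ 2

end ParabolicCarleman

/-! ### Lower bound for the commutator form. -/

namespace ParabolicCarleman
variable {n : ℕ}
variable {A : E n → E n →L[ℝ] E n} {b : E n → E n} {V : E n → ℝ} {C α s : ℝ} {x : E n}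
  {f : E n → ℝ}

/-- The time derivative of `potF`, with `s` the time variable. -/
noncomputable def potFt (A : E n → E n →L[ℝ] E n) (b : E n → E n) (s : ℝ) (x : E n) : ℝ :=
  -(potP A b x) / s ^ 2 - 2 * potQ A x / s ^ 3

lemma errF_pieces {e : ℝ} (hα : 1 ≤ α) (hs : 0 < s) (he : 0 ≤ e) :
    α ^ 2 ≤ errF α s e ∧ α * e / s + e ^ 3 / s ^ 2 ≤ errF α s e := by
  have h1 : 0 ≤ α * e / s := by positivity
  have h2 : 0 ≤ e ^ 3 / s ^ 2 := by positivity
  have h3 : 0 ≤ α ^ 2 := by positivity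
  unfold errF
  constructor <;> linarith

lemma PointBounds.abs_potF_le (h : PointBounds A b V C α x) (hα : 1 ≤ α) (hs : 0 < s) :
    |potF A b s x| ≤ C ^ 2 * errF α s ‖x‖ := by
  refine (h.abs_potF hα hs).trans ?_
  have := h.one_le
  gcongr
  exact (errF_pieces hα hs (norm_nonneg x)).2

lemma PointBounds.abs_potV_le (h : PointBounds A b V C α x) (hα : 1 ≤ α) (hs : 0 < s) :
    |V x - potF A b s x / 2| ≤ 2 * C ^ 2 * errF α s ‖x‖ := by
  have h1 := h.abs_potF_le hα hs
  have h2 := h.boundV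
  have hC := h.one_le
  have h3 : C * α ^ 2 ≤ C ^ 2 * errF α s ‖x‖ := by
    have := (errF_pieces hα hs (norm_nonneg x)).1
    have h4 : C ≤ C ^ 2 := by nlinarith
    gcongr
  have h5 : 0 ≤ C ^ 2 * errF α s ‖x‖ := (abs_nonneg _).trans h1
  rw [abs_le] at *
  constructor <;> linarith

lemma PointBounds.abs_potFt (h : PointBounds A b V C α x) (hα : 1 ≤ α) (hs : 0 < s) :
    s * |potFt A b s x| ≤ 2 * C ^ 2 * errF α s ‖x‖ := by
  have hC := h.one_le
  have h1 := h.abs_potP hα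
  have h2 := h.abs_potQ
  have h3 : s * |potFt A b s x| ≤ |potP A b x| / s + 2 * |potQ A x| / s ^ 2 := by
    have e1 : |potFt A b s x| ≤ |potP A b x| / s ^ 2 + 2 * |potQ A x| / s ^ 3 := by
      unfold potFt
      refine (abs_sub _ _).trans (le_of_eq ?_)
      rw [abs_div, abs_div, abs_neg, abs_mul, abs_of_pos (by positivity : 0 < s ^ 2),
        abs_of_pos (by positivity : 0 < s ^ 3), abs_of_pos (by norm_num : (0 : ℝ) < 2)]
    calc s * |potFt A b s x| ≤ s * (|potP A b x| / s ^ 2 + 2 * |potQ A x| / s ^ 3) := by gcongr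
      _ = _ := by field_simp
  have h4 : |potP A b x| / s ≤ C ^ 2 * (α * ‖x‖) / s := by gcongr
  have h5 : 2 * |potQ A x| / s ^ 2 ≤ 2 * (C * ‖x‖ ^ 3) / s ^ 2 := by gcongr
  have h6 := (errF_pieces hα hs (norm_nonneg x)).2
  have h7 : C * (‖x‖ ^ 3 / s ^ 2) ≤ C ^ 2 * (‖x‖ ^ 3 / s ^ 2) := by gcongr; nlinarith
  have h8 : 0 ≤ C ^ 2 * (α * ‖x‖ / s) := by positivity
  have e1 : C ^ 2 * (α * ‖x‖) / s = C ^ 2 * (α * ‖x‖ / s) := by ring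
  have e2 : 2 * (C * ‖x‖ ^ 3) / s ^ 2 = 2 * (C * (‖x‖ ^ 3 / s ^ 2)) := by ring
  have h9 := mul_le_mul_of_nonneg_left h6 (by positivity : 0 ≤ 2 * C ^ 2)
  nlinarith

/-- Products of the two kinds of small factors. -/
lemma errP_mul_le {e : ℝ} (hα : 1 ≤ α) (hs : 0 < s) (he : 0 ≤ e) (he4 : e ≤ 4) :
    (e + α * s) * (α + e ^ 2 / s) ≤ 5 * s * errF α s e := by
  have h1 : s * errF α s e = α ^ 2 * s + α * e + e ^ 3 / s := by
    unfold errF; field_simp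
  have h2 : (e + α * s) * (α + e ^ 2 / s) = e * α + e ^ 3 / s + α ^ 2 * s + α * e ^ 2 := by
    field_simp; ring
  have h3 : α * e ^ 2 ≤ 4 * (α * e) := by nlinarith [mul_nonneg (by linarith : 0 ≤ α) he]
  have h4 : 0 ≤ e ^ 3 / s := by positivity
  have h5 : 0 ≤ α ^ 2 * s := by positivity
  have h6 : 0 ≤ α * e := by positivity
  rw [h2]
  linarith

lemma errF_nonneg {e : ℝ} (hα : 1 ≤ α) (hs : 0 < s) (he : 0 ≤ e) : 0 ≤ errF α s e :=
  (sq_nonneg α).trans (errF_pieces hα hs he).1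

lemma neg_le_of_abs_mul_sq_le {a K F c : ℝ} (h : |a| ≤ K * F) : a * c ^ 2 ≤ K * (F * c ^ 2) := by
  have := mul_le_mul_of_nonneg_right ((le_abs_self a).trans h) (sq_nonneg c)
  linarith

-- The gain comes from ρ': the part A/(2s) of DZ in −2ρ⟨DZ A∇f, ∇f⟩ consumes the 1 of 1 + θ, up to A
-- − I, and leaves (ρθ/s)⟨A∇f,∇f⟩. Half of θ is then given up to the multiplier (θ/2) f, which in
-- return yields (θα/(2ρ)) f². Every other term contains A − I, a derivative of a coefficient, F or
-- V, or the derivative m of θ/4; the last gives the separate term C(θ/s) f².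
set_option maxHeartbeats 2000000 in
lemma PointBounds.commForm_ge (h : PointBounds A b V C α x) (hα : 1 ≤ α) (hs : 0 < s)
    (hαs : α * s ≤ 1) {ρ θ m : ℝ} (hρ : s ≤ ρ) (hρC : ρ ≤ C * s)
    (hθ : 0 < θ) (hθC : θ ≤ C) (hm : |m| ≤ C * (θ / s)) :
    θ / (2 * C) * ‖gradient f x‖ ^ 2 + θ * α / (2 * C * s) * f x ^ 2
        - 200 * C ^ 6 * err α s ‖x‖ (f x) ‖gradient f x‖ - C * (θ / s) * f x ^ 2
      ≤ commForm A b V s f ρ (α + θ / 4) θ (α / ρ + (V x - potF A b s x / 2))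
        (ρ / s * (1 + θ))
        (ρ / s * (1 + θ) * (V x - potF A b s x / 2) - ρ * (potFt A b s x / 2) + m) x := by
  have hC := h.one_le
  have hC0 : 0 < C := by linarith
  have hρ0 : 0 < ρ := by linarith
  set p := gradient f x with hp
  set X := flux A f x with hXdef
  set Z := drift A b s x with hZdef
  set W := V x - potF A b s x / 2 with hW
  set F₁ := (1 / (2 * s)) * (∑ i, (fderiv ℝ A x (EuclideanSpace.single i 1) x) i)
    + tr (fderiv ℝ b x) with hF₁
  have hXe : X = A x p := rfl
  have hX : ‖X‖ ≤ C * ‖p‖ := h.norm_A_apply p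
  have e0 : 0 ≤ ‖x‖ := norm_nonneg x
  have u0 : 0 ≤ ‖p‖ := norm_nonneg p
  have hF0 : 0 ≤ errF α s ‖x‖ := errF_nonneg hα hs e0
  have hP0 : 0 ≤ ‖x‖ + α * s := by positivity
  have hPle : ‖x‖ + α * s ≤ errP α s ‖x‖ := by
    unfold errP; linarith [Real.sqrt_nonneg s]
  have hZ := h.norm_drift hs
  have hρZ : ρ * ‖Z‖ ≤ C ^ 2 * (‖x‖ + α * s) := by
    calc ρ * ‖Z‖ ≤ C * s * ‖Z‖ := by gcongr
      _ = C * (s * ‖Z‖) := by ring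
      _ ≤ C * (C * (‖x‖ + α * s)) := by gcongr
      _ = _ := by ring
  have hρs : ρ / s ≤ C := by rw [div_le_iff₀ hs]; exact hρC
  have hρs1 : 1 ≤ ρ / s := by rw [le_div_iff₀ hs]; linarith
  have C23 : C ^ 2 ≤ C ^ 6 := pow_le_pow_right₀ hC (by norm_num)
  have C33 : C ^ 3 ≤ C ^ 6 := pow_le_pow_right₀ hC (by norm_num)
  have C43 : C ^ 4 ≤ C ^ 6 := pow_le_pow_right₀ hC (by norm_num)
  have C53 : C ^ 5 ≤ C ^ 6 := pow_le_pow_right₀ hC (by norm_num)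
  set Q := C ^ 6 with hQ
  set P₀ := ‖x‖ + α * s with hP₀
  set Fe := errF α s ‖x‖ with hFe
  have Pu : 0 ≤ P₀ * ‖p‖ ^ 2 := by positivity
  -- main positive term
  have hXp := h.lower p
  have t0 : θ / (2 * C) * ‖p‖ ^ 2 ≤ (ρ / s * θ - θ / 2) * inner ℝ X p := by
    have : 0 ≤ inner ℝ X p := le_trans (by positivity) hXp
    have h2 : θ / 2 ≤ ρ / s * θ - θ / 2 := by nlinarith
    calc θ / (2 * C) * ‖p‖ ^ 2 = θ / 2 * (C⁻¹ * ‖p‖ ^ 2) := by field_simp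
      _ ≤ θ / 2 * inner ℝ X p := mul_le_mul_of_nonneg_left hXp (by positivity)
      _ ≤ _ := by gcongr
  -- A - 1
  have t1 : |ρ / s * (inner ℝ X p - inner ℝ (A x X) p)| ≤ Q * (P₀ * ‖p‖ ^ 2) := by
    have e1 : inner ℝ X p - inner ℝ (A x X) p = -inner ℝ X (A x p - p) := by
      rw [h.symm, inner_sub_right]; ring
    have h2 := abs_inner_le X (A x p - p) hX (h.norm_A_apply_sub p)
    rw [e1, abs_mul, abs_neg, abs_of_pos (by positivity)]
    calc ρ / s * |inner ℝ X (A x p - p)| ≤ C * (C * ‖p‖ * (C * ‖x‖ * ‖p‖)) := by gcongr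
      _ = C ^ 3 * (‖x‖ * ‖p‖ ^ 2) := by ring
      _ ≤ Q * (P₀ * ‖p‖ ^ 2) := by
          gcongr; rw [hP₀]; linarith [show 0 ≤ α * s by positivity]
  have t2 : |ρ * inner ℝ (fderiv ℝ A x Z p) p| ≤ Q * (P₀ * ‖p‖ ^ 2) := by
    have h2 := abs_inner_le (fderiv ℝ A x Z p) p (h.norm_A'_apply Z p) le_rfl
    rw [abs_mul, abs_of_pos hρ0]
    calc ρ * |inner ℝ (fderiv ℝ A x Z p) p| ≤ ρ * (C * ‖Z‖ * ‖p‖ * ‖p‖) := by gcongr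
      _ = C * (ρ * ‖Z‖) * ‖p‖ ^ 2 := by ring
      _ ≤ C * (C ^ 2 * P₀) * ‖p‖ ^ 2 := by gcongr
      _ = C ^ 3 * (P₀ * ‖p‖ ^ 2) := by ring
      _ ≤ _ := by gcongr
  have t3 : |ρ / s * inner ℝ (fderiv ℝ A x X x) p| ≤ Q * (P₀ * ‖p‖ ^ 2) := by
    have h2 := abs_inner_le (fderiv ℝ A x X x) p (h.norm_A'_apply X x) le_rfl
    rw [abs_mul, abs_of_pos (by positivity)]
    calc ρ / s * |inner ℝ (fderiv ℝ A x X x) p| ≤ C * (C * ‖X‖ * ‖x‖ * ‖p‖) := by gcongr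
      _ ≤ C * (C * (C * ‖p‖) * ‖x‖ * ‖p‖) := by gcongr
      _ = C ^ 3 * (‖x‖ * ‖p‖ ^ 2) := by ring
      _ ≤ Q * (P₀ * ‖p‖ ^ 2) := by
          gcongr; rw [hP₀]; linarith [show 0 ≤ α * s by positivity]
  have t4 : |2 * ρ * inner ℝ (fderiv ℝ b x X) p| ≤ 2 * Q * (P₀ * ‖p‖ ^ 2) := by
    have h2 := abs_inner_le (fderiv ℝ b x X) p (h.norm_b'_apply X) le_rfl
    rw [abs_mul, abs_of_pos (by positivity)]
    calc 2 * ρ * |inner ℝ (fderiv ℝ b x X) p| ≤ 2 * (C * s) * (C * α * ‖X‖ * ‖p‖) := by gcongr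
      _ ≤ 2 * (C * s) * (C * α * (C * ‖p‖) * ‖p‖) := by gcongr
      _ = 2 * C ^ 3 * ((α * s) * ‖p‖ ^ 2) := by ring
      _ ≤ 2 * Q * (P₀ * ‖p‖ ^ 2) := by gcongr; rw [hP₀]; linarith
  have t5 : |ρ * fderiv ℝ (potF A b s) x X * f x|
      ≤ 3 * Q * (errC α s ‖x‖ * (|f x| * ‖p‖)) := by
    have h2 := h.abs_potF' hα hs X
    have hcc : 0 ≤ α + ‖x‖ ^ 2 / s := by positivity
    rw [abs_mul, abs_mul, abs_of_pos hρ0]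
    calc ρ * |fderiv ℝ (potF A b s) x X| * |f x|
        ≤ C * s * |fderiv ℝ (potF A b s) x X| * |f x| := by gcongr
      _ = C * (s * |fderiv ℝ (potF A b s) x X|) * |f x| := by ring
      _ ≤ C * (3 * C ^ 2 * (α + ‖x‖ ^ 2 / s) * ‖X‖) * |f x| := by gcongr
      _ ≤ C * (3 * C ^ 2 * (α + ‖x‖ ^ 2 / s) * (C * ‖p‖)) * |f x| := by gcongr
      _ = 3 * C ^ 4 * (errC α s ‖x‖ * (|f x| * ‖p‖)) := by unfold errC; ring
      _ ≤ _ := by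
          have : 0 ≤ errC α s ‖x‖ := hcc
          gcongr
  have hWb : |W| ≤ 2 * C ^ 2 * Fe := h.abs_potV_le hα hs
  have h1θ : 1 + θ ≤ 2 * C := by linarith
  have t6 : |ρ / s * (1 + θ) * W - ρ * (potFt A b s x / 2)| ≤ 5 * Q * Fe := by
    have h2 := h.abs_potFt hα hs
    have a1 : |ρ / s * (1 + θ) * W| ≤ 4 * C ^ 4 * Fe := by
      rw [abs_mul, abs_of_pos (by positivity)]
      calc ρ / s * (1 + θ) * |W| ≤ C * (2 * C) * (2 * C ^ 2 * Fe) := by gcongr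
        _ = _ := by ring
    have a2 : |ρ * (potFt A b s x / 2)| ≤ C ^ 3 * Fe := by
      rw [abs_mul, abs_of_pos hρ0, abs_div, abs_of_pos (by norm_num : (0 : ℝ) < 2)]
      calc ρ * (|potFt A b s x| / 2) ≤ C * s * (|potFt A b s x| / 2) := by gcongr
        _ = C / 2 * (s * |potFt A b s x|) := by ring
        _ ≤ C / 2 * (2 * C ^ 2 * Fe) := by gcongr
        _ = _ := by ring
    have a3 : C ^ 4 * Fe ≤ Q * Fe := by gcongr
    have a4 : C ^ 3 * Fe ≤ Q * Fe := by gcongr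
    refine (abs_sub _ _).trans ?_
    linarith
  have t7 : |ρ * (fderiv ℝ V x Z - fderiv ℝ (potF A b s) x Z / 2)| ≤ 15 * Q * Fe := by
    have h2 := h.norm_V'_apply Z
    have h3 := h.abs_potF' hα hs Z
    have a1 : ρ * |fderiv ℝ V x Z| ≤ 5 * C ^ 3 * Fe := by
      calc ρ * |fderiv ℝ V x Z| ≤ ρ * (C * α ^ 2 * ‖Z‖) := by gcongr
        _ = C * α ^ 2 * (ρ * ‖Z‖) := by ring
        _ ≤ C * α ^ 2 * (C ^ 2 * P₀) := by gcongr
        _ = C ^ 3 * (α ^ 2 * P₀) := by ring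
        _ ≤ C ^ 3 * (Fe * 5) := by
            gcongr
            · exact (errF_pieces hα hs e0).1
            · linarith [h.norm_le]
        _ = _ := by ring
    have a2 : ρ * |fderiv ℝ (potF A b s) x Z| ≤ 15 * C ^ 4 * Fe := by
      have h4 := errP_mul_le hα hs e0 h.norm_le
      have hcc : 0 ≤ α + ‖x‖ ^ 2 / s := by positivity
      calc ρ * |fderiv ℝ (potF A b s) x Z| ≤ C * s * |fderiv ℝ (potF A b s) x Z| := by gcongr
        _ = C * (s * |fderiv ℝ (potF A b s) x Z|) := by ring
        _ ≤ C * (3 * C ^ 2 * (α + ‖x‖ ^ 2 / s) * ‖Z‖) := by gcongr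
        _ = 3 * C ^ 3 * (α + ‖x‖ ^ 2 / s) * (s * ‖Z‖) / s := by field_simp
        _ ≤ 3 * C ^ 3 * (α + ‖x‖ ^ 2 / s) * (C * P₀) / s := by gcongr
        _ = 3 * C ^ 4 * (P₀ * (α + ‖x‖ ^ 2 / s)) / s := by ring
        _ ≤ 3 * C ^ 4 * (5 * s * Fe) / s := by gcongr
        _ = _ := by field_simp; ring
    have a3 : C ^ 4 * Fe ≤ Q * Fe := by gcongr
    have a4 : C ^ 3 * Fe ≤ Q * Fe := by gcongr
    rw [abs_mul, abs_of_pos hρ0]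
    have a5 : |fderiv ℝ V x Z - fderiv ℝ (potF A b s) x Z / 2|
        ≤ |fderiv ℝ V x Z| + |fderiv ℝ (potF A b s) x Z| / 2 := by
      refine (abs_sub _ _).trans (le_of_eq ?_)
      rw [abs_div, abs_of_pos (by norm_num : (0 : ℝ) < 2)]
    have a6 := mul_le_mul_of_nonneg_left a5 hρ0.le
    have a7 : ρ * (|fderiv ℝ V x Z| + |fderiv ℝ (potF A b s) x Z| / 2)
      = ρ * |fderiv ℝ V x Z| + ρ * |fderiv ℝ (potF A b s) x Z| / 2 := by ring
    have a8 : 0 ≤ Q * Fe := by positivity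
    linarith
  have hF1 := h.abs_first hs
  rw [← hF₁] at hF1
  have t8 : |F₁ * (ρ * inner ℝ X p)| ≤ Q * (P₀ * ‖p‖ ^ 2) := by
    have h2 := abs_inner_le X p hX le_rfl
    rw [abs_mul, abs_mul, abs_of_pos hρ0]
    calc |F₁| * (ρ * |inner ℝ X p|) ≤ |F₁| * (C * s * (C * ‖p‖ * ‖p‖)) := by gcongr
      _ = C ^ 2 * ‖p‖ ^ 2 * (s * |F₁|) := by ring
      _ ≤ C ^ 2 * ‖p‖ ^ 2 * (C ^ 2 * P₀) := by gcongr
      _ = C ^ 4 * (P₀ * ‖p‖ ^ 2) := by ring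
      _ ≤ _ := by gcongr
  have hP₀F : P₀ * α ≤ 5 * s * Fe := by
    refine le_trans ?_ (errP_mul_le hα hs e0 h.norm_le)
    gcongr
    linarith [show 0 ≤ ‖x‖ ^ 2 / s by positivity]
  have t9 : |F₁ * (α + θ / 4 + ρ * W)| ≤ 25 * Q * Fe := by
    have a1 : |α + θ / 4 + ρ * W| ≤ 2 * C * α + C * s * |W| := by
      refine (abs_add_le _ _).trans ?_
      rw [abs_mul, abs_of_pos hρ0, abs_of_pos (by positivity)]
      gcongr
      nlinarith
    have a2 : s * |F₁| * |α + θ / 4 + ρ * W| ≤ s * (25 * Q * Fe) := by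
      calc s * |F₁| * |α + θ / 4 + ρ * W|
          ≤ (C ^ 2 * P₀) * (2 * C * α + C * s * |W|) := by gcongr
        _ = 2 * C ^ 3 * (P₀ * α) + C ^ 3 * s * (P₀ * |W|) := by ring
        _ ≤ 2 * C ^ 3 * (5 * s * Fe) + C ^ 3 * s * (5 * (2 * C ^ 2 * Fe)) := by
            gcongr
            linarith [h.norm_le]
        _ = s * (10 * (C ^ 3 * Fe) + 10 * (C ^ 5 * Fe)) := by ring
        _ ≤ s * (25 * Q * Fe) := by
            gcongr
            have a3 : C ^ 5 * Fe ≤ Q * Fe := by gcongr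
            have a4 : C ^ 3 * Fe ≤ Q * Fe := by gcongr
            have a8 : 0 ≤ Q * Fe := by positivity
            linarith
    rw [abs_mul]
    rw [mul_assoc] at a2
    exact le_of_mul_le_mul_left a2 hs
  have t10 : |θ / 2 * W| ≤ Q * Fe := by
    rw [abs_mul, abs_of_pos (by positivity)]
    calc θ / 2 * |W| ≤ C / 2 * (2 * C ^ 2 * Fe) := by gcongr
      _ = C ^ 3 * Fe := by ring
      _ ≤ _ := by gcongr
  have t11 : θ * α / (2 * C * s) * f x ^ 2 ≤ θ / 2 * (α / ρ) * f x ^ 2 := by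
    refine mul_le_mul_of_nonneg_right ?_ (sq_nonneg _)
    rw [div_mul_div_comm]
    exact div_le_div_of_nonneg_left (by positivity) (by positivity) (by linarith)
  have b6 := neg_le_of_abs_mul_sq_le (c := f x) t6
  have b7 := neg_le_of_abs_mul_sq_le (c := f x) t7
  have b9 := neg_le_of_abs_mul_sq_le (c := f x) t9
  have b10 := neg_le_of_abs_mul_sq_le (c := f x) (by rwa [← abs_neg] at t10)
  have bm := mul_le_mul_of_nonneg_right ((le_abs_self m).trans hm) (sq_nonneg (f x))
  -- Regrouping according to the formula for DZ: its part A/(2s) is paired with the 1 of 1 + θ in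
  -- ρ', and their difference is the term estimated in `t1`.
  have key : commForm A b V s f ρ (α + θ / 4) θ (α / ρ + W) (ρ / s * (1 + θ))
        (ρ / s * (1 + θ) * W - ρ * (potFt A b s x / 2) + m) x
      = (ρ / s * θ - θ / 2) * inner ℝ X p + θ / 2 * (α / ρ) * f x ^ 2
        + ρ / s * (inner ℝ X p - inner ℝ (A x X) p) + ρ * inner ℝ (fderiv ℝ A x Z p) p
        - ρ / s * inner ℝ (fderiv ℝ A x X x) p - 2 * ρ * inner ℝ (fderiv ℝ b x X) p
        - ρ * fderiv ℝ (potF A b s) x X * f x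
        - (ρ / s * (1 + θ) * W - ρ * (potFt A b s x / 2)) * f x ^ 2 - m * f x ^ 2
        - ρ * (fderiv ℝ V x Z - fderiv ℝ (potF A b s) x Z / 2) * f x ^ 2
        + F₁ * (ρ * inner ℝ X p) - F₁ * (α + θ / 4 + ρ * W) * f x ^ 2
        - (-(θ / 2 * W)) * f x ^ 2 := by
    simp only [commForm, ← hp, ← hXdef, ← hZdef, ← hF₁, ← hW]
    rw [(hasFDerivAt_drift (s := s) h.diffA h.diffb).2, inner_add_left, inner_smul_left,
      inner_add_left]
    simp only [conj_trivial]
    field_simp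
    ring
  rw [key]
  have hErr : err α s ‖x‖ (f x) ‖p‖ = errP α s ‖x‖ * ‖p‖ ^ 2 + errC α s ‖x‖ * (|f x| * ‖p‖)
      + Fe * f x ^ 2 := rfl
  rw [hErr]
  have hPe : Q * (P₀ * ‖p‖ ^ 2) ≤ Q * (errP α s ‖x‖ * ‖p‖ ^ 2) := by gcongr
  have n1 : 0 ≤ Q * (P₀ * ‖p‖ ^ 2) := by positivity
  have n2 : 0 ≤ Q * (errC α s ‖x‖ * (|f x| * ‖p‖)) := by
    have : 0 ≤ errC α s ‖x‖ := by unfold errC; positivity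
    positivity
  have n3 : 0 ≤ Q * (Fe * f x ^ 2) := by positivity
  have c1 := (abs_le.1 t1).1
  have c2 := (abs_le.1 t2).1
  have c3 := (abs_le.1 t3).2
  have c4 := (abs_le.1 t4).2
  have c5 := (abs_le.1 t5).2
  have c8 := (abs_le.1 t8).1
  linarith

end ParabolicCarleman

/-! ### The Hessian estimate and the pointwise Carleman inequality. -/

namespace ParabolicCarleman
variable {n : ℕ}
variable {A : E n → E n →L[ℝ] E n} {b : E n → E n} {V : E n → ℝ} {C α s : ℝ} {x : E n}
  {f q : E n → ℝ}

/-- The squared Hilbert-Schmidt norm of the Hessian. -/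
noncomputable def hessSq (f : E n → ℝ) (x : E n) : ℝ :=
  ∑ i, ‖hess f x (EuclideanSpace.single i (1 : ℝ))‖ ^ 2

lemma hessSq_nonneg (f : E n → ℝ) (x : E n) : 0 ≤ hessSq f x :=
  Finset.sum_nonneg fun _ _ => by positivity

lemma norm_hess_apply_sq_le (f : E n → ℝ) (x v : E n) :
    ‖hess f x v‖ ^ 2 ≤ ‖v‖ ^ 2 * hessSq f x := by
  have h : v = ∑ i, v i • EuclideanSpace.single i (1 : ℝ) := by
    ext j
    simp [Finset.sum_apply, Pi.single_apply]
  have h1 : ‖hess f x v‖ ≤ ∑ i, |v i| * ‖hess f x (EuclideanSpace.single i (1 : ℝ))‖ := by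
    conv_lhs => rw [h, map_sum]
    refine (norm_sum_le _ _).trans (le_of_eq ?_)
    refine Finset.sum_congr rfl fun i _ => ?_
    rw [map_smul, norm_smul, Real.norm_eq_abs]
  calc ‖hess f x v‖ ^ 2
      ≤ (∑ i, |v i| * ‖hess f x (EuclideanSpace.single i (1 : ℝ))‖) ^ 2 := by gcongr
    _ ≤ (∑ i, |v i| ^ 2) * ∑ i, ‖hess f x (EuclideanSpace.single i (1 : ℝ))‖ ^ 2 :=
        Finset.sum_mul_sq_le_sq_mul_sq _ _ _
    _ = _ := by rw [EuclideanSpace.norm_sq_eq]; simp [hessSq]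

lemma tr_hess_sq_le (f : E n → ℝ) (x : E n) : tr (hess f x) ^ 2 ≤ n * hessSq f x := by
  calc tr (hess f x) ^ 2
      ≤ Fintype.card (Fin n) * ∑ i, (hess f x (EuclideanSpace.single i (1 : ℝ)) i) ^ 2 := by
        simpa [tr] using sq_sum_le_card_mul_sum_sq (s := (Finset.univ : Finset (Fin n)))
          (f := fun i => hess f x (EuclideanSpace.single i (1 : ℝ)) i)
    _ ≤ _ := by
        rw [Fintype.card_fin]
        unfold hessSq
        refine mul_le_mul_of_nonneg_left (Finset.sum_le_sum fun i _ => ?_) (by positivity)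
        exact sq_le_sq.2 (by rw [abs_of_nonneg (norm_nonneg _)]; exact abs_apply_le_norm _ _)

lemma inner_single_left (v : E n) (i : Fin n) :
    inner ℝ (EuclideanSpace.single i (1 : ℝ)) v = v i := by
  simp [EuclideanSpace.inner_single_left]

/-- In the Rellich identity tr(D²f · D(A∇f)) contains tr(D²f A D²f), which is coercive by
ellipticity. The derivative of A costs a quarter of C⁻¹|D²f|², the product of the Laplacian with
`symPart` another quarter, and the Gaussian term an eighth. There remain 3/8, whence the factor 8C/3
in front of the divergence. -/
lemma PointBounds.hessSq_le (h : PointBounds A b V C α x) (hs : 0 < s) (hf : ContDiff ℝ ∞ f) :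
    hessSq f x ≤ 3 * C ^ 3 * symPart A s f x ^ 2
      + 3 * C ^ 5 * (1 + ‖x‖ ^ 2 / s ^ 2) * ‖gradient f x‖ ^ 2
      - 8 * C / 3 * divG s (rellich A f) x := by
  have hC := h.one_le
  have hC0 : 0 < C := by linarith
  set p := gradient f x with hp
  set X := flux A f x with hXdef
  have hX : ‖X‖ ≤ C * ‖p‖ := h.norm_A_apply p
  obtain ⟨dX, hX'⟩ := hasFDerivAt_flux h.diffA hf
  have hH := hessSq_nonneg f x
  rw [divG_rellich h.diffA hf]
  have t1 : C⁻¹ * (3 / 4 * hessSq f x) - C ^ 4 * ‖p‖ ^ 2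
      ≤ tr ((hess f x).comp (fderiv ℝ (flux A f) x)) := by
    have e1 : ∀ i : Fin n, C⁻¹ * (3 / 4 * ‖hess f x (EuclideanSpace.single i (1 : ℝ))‖ ^ 2)
        - C ^ 3 * ‖p‖ ^ 2
        ≤ (hess f x).comp (fderiv ℝ (flux A f) x) (EuclideanSpace.single i (1 : ℝ)) i := by
      intro i
      rw [← inner_single_left, ContinuousLinearMap.comp_apply, ← hess_symm hf, hX',
        inner_add_right]
      set y := hess f x (EuclideanSpace.single i (1 : ℝ))
      have h1 := h.lower y
      rw [real_inner_comm] at h1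
      have h2 := abs_inner_le y (fderiv ℝ A x (EuclideanSpace.single i (1 : ℝ)) p) le_rfl
        (by simpa using h.norm_A'_apply (EuclideanSpace.single i (1 : ℝ)) p)
      have h3 : ‖y‖ * (C * ‖p‖) ≤ C⁻¹ * (1 / 4 * ‖y‖ ^ 2) + C ^ 3 * ‖p‖ ^ 2 := by
        have : 0 ≤ C⁻¹ * (1 / 2 * ‖y‖ - C ^ 2 * ‖p‖) ^ 2 := by positivity
        have e : C⁻¹ * (1 / 2 * ‖y‖ - C ^ 2 * ‖p‖) ^ 2
          = C⁻¹ * (1 / 4 * ‖y‖ ^ 2) + C ^ 3 * ‖p‖ ^ 2 - ‖y‖ * (C * ‖p‖) := by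
          field_simp; ring
        linarith
      have h4 := (abs_le.1 h2).1
      linarith
    have e2 := Finset.sum_le_sum fun i (_ : i ∈ Finset.univ) => e1 i
    rw [Finset.sum_sub_distrib, ← Finset.mul_sum, ← Finset.mul_sum] at e2
    simp only [Finset.sum_const, Finset.card_univ, Fintype.card_fin, nsmul_eq_mul] at e2
    have e3 : (n : ℝ) * (C ^ 3 * ‖p‖ ^ 2) ≤ C * (C ^ 3 * ‖p‖ ^ 2) := by
      gcongr; exact h.dim_le
    have e4 : C * (C ^ 3 * ‖p‖ ^ 2) = C ^ 4 * ‖p‖ ^ 2 := by ring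
    have e5 : tr ((hess f x).comp (fderiv ℝ (flux A f) x)) = ∑ i, (hess f x).comp
      (fderiv ℝ (flux A f) x) (EuclideanSpace.single i (1 : ℝ)) i := rfl
    rw [e5]
    unfold hessSq
    linarith
  have t2 : tr (hess f x) * symPart A s f x
      ≤ C⁻¹ * (1 / 4 * hessSq f x) + C ^ 2 * symPart A s f x ^ 2 := by
    have h1 : tr (hess f x) ^ 2 ≤ C * hessSq f x :=
      (tr_hess_sq_le f x).trans (by gcongr; exact h.dim_le)
    have h2 : C⁻¹ ^ 2 * (1 / 4 * tr (hess f x) ^ 2) ≤ C⁻¹ ^ 2 * (1 / 4 * (C * hessSq f x)) := by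
      gcongr
    have h3 : C⁻¹ ^ 2 * (1 / 4 * (C * hessSq f x)) = C⁻¹ * (1 / 4 * hessSq f x) := by
      field_simp
    have h4 : 0 ≤ (C⁻¹ * (1 / 2 * tr (hess f x)) - C * symPart A s f x) ^ 2 := sq_nonneg _
    have h5 : (C⁻¹ * (1 / 2 * tr (hess f x)) - C * symPart A s f x) ^ 2
      = C⁻¹ ^ 2 * (1 / 4 * tr (hess f x) ^ 2) + C ^ 2 * symPart A s f x ^ 2
        - tr (hess f x) * symPart A s f x := by
      field_simp; ring
    linarith
  have t3 : inner ℝ x (hess f x X) / (2 * s)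
      ≤ C⁻¹ * (1 / 8 * hessSq f x) + C ^ 3 / 2 * (‖x‖ ^ 2 / s ^ 2) * ‖p‖ ^ 2 := by
    have h1 : ‖hess f x X‖ ≤ C * ‖p‖ * Real.sqrt (hessSq f x) := by
      have := norm_hess_apply_sq_le f x X
      refine le_of_sq_le_sq ?_ (by positivity)
      rw [mul_pow, Real.sq_sqrt hH]
      refine this.trans ?_
      gcongr
    have h2 := (abs_le.1 (abs_inner_le x (hess f x X) le_rfl h1)).2
    set r := Real.sqrt (hessSq f x) with hr
    have hr2 : r ^ 2 = hessSq f x := Real.sq_sqrt hH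
    rw [← hr2]
    calc inner ℝ x (hess f x X) / (2 * s) ≤ ‖x‖ * (C * ‖p‖ * r) / (2 * s) := by gcongr
      _ ≤ _ := by
        have : 0 ≤ C⁻¹ / 8 * (r - 2 * C ^ 2 * (‖x‖ / s) * ‖p‖) ^ 2 := by positivity
        have e : C⁻¹ / 8 * (r - 2 * C ^ 2 * (‖x‖ / s) * ‖p‖) ^ 2
          = C⁻¹ * (1 / 8 * r ^ 2) + C ^ 3 / 2 * (‖x‖ ^ 2 / s ^ 2) * ‖p‖ ^ 2
            - ‖x‖ * (C * ‖p‖ * r) / (2 * s) := by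
          field_simp; ring
        linarith
  have t4 : 8 * C / 3 * (C⁻¹ * (3 / 8 * hessSq f x)) = hessSq f x := by field_simp
  have t5 : C⁻¹ * (3 / 8 * hessSq f x) ≤ C ^ 2 * symPart A s f x ^ 2 + C ^ 4 * ‖p‖ ^ 2
      + C ^ 3 / 2 * (‖x‖ ^ 2 / s ^ 2) * ‖p‖ ^ 2
      - (tr (hess f x) * symPart A s f x - tr ((hess f x).comp (fderiv ℝ (flux A f) x))
        + inner ℝ x (hess f x X) / (2 * s)) := by linarith
  have t6 := mul_le_mul_of_nonneg_left t5 (by positivity : 0 ≤ 8 * C / 3)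
  rw [t4] at t6
  have t7 : 0 ≤ C ^ 3 * symPart A s f x ^ 2 := by positivity
  have t8 : 0 ≤ C ^ 5 * ‖p‖ ^ 2 := by positivity
  have t9 : 0 ≤ C ^ 4 * (‖x‖ ^ 2 / s ^ 2) * ‖p‖ ^ 2 := by positivity
  have t10 : C ^ 4 * (‖x‖ ^ 2 / s ^ 2) * ‖p‖ ^ 2 ≤ C ^ 5 * (‖x‖ ^ 2 / s ^ 2) * ‖p‖ ^ 2 := by
    gcongr
    norm_num
  nlinarith

/-- The zeroth order part is controlled by the error weight. -/
lemma PointBounds.sq_potential_le (h : PointBounds A b V C α x) (hα : 1 ≤ α) (hs : 0 < s)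
    (hαs : α * s ≤ 1) {ρ : ℝ} (hρ : s ≤ ρ) :
    s ^ 2 * (α / ρ + (V x - potF A b s x / 2)) ^ 2 ≤ 402 * C ^ 4 * errF α s ‖x‖ := by
  have hC := h.one_le
  have e0 : 0 ≤ ‖x‖ := norm_nonneg x
  have hρ0 : 0 < ρ := by linarith
  have e4 := h.norm_le
  have h1 : s * (α / ρ) ≤ α := by
    rw [← mul_div_assoc, div_le_iff₀ hρ0]; nlinarith
  have h2 : |s * (V x - potF A b s x / 2)| ≤ C ^ 2 * (α + α * ‖x‖ + ‖x‖ ^ 3 / s) := by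
    have a1 := h.abs_potF hα hs
    have a2 := h.boundV
    rw [abs_mul, abs_of_pos hs]
    have a3 : |V x - potF A b s x / 2| ≤ |V x| + |potF A b s x| := by
      refine (abs_sub _ _).trans ?_
      rw [abs_div, abs_of_pos (by norm_num : (0 : ℝ) < 2)]
      linarith [abs_nonneg (potF A b s x)]
    calc s * |V x - potF A b s x / 2|
        ≤ s * (C * α ^ 2 + C ^ 2 * (α * ‖x‖ / s + ‖x‖ ^ 3 / s ^ 2)) := by
          gcongr; linarith
      _ = C * (α * (α * s)) + C ^ 2 * (α * ‖x‖ + ‖x‖ ^ 3 / s) := by field_simp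
      _ ≤ C ^ 2 * (α * 1) + C ^ 2 * (α * ‖x‖ + ‖x‖ ^ 3 / s) := by
          gcongr; nlinarith
      _ = _ := by ring
  have h3 : (s * (α / ρ)) ^ 2 ≤ α ^ 2 := by gcongr
  have h4 : (s * (V x - potF A b s x / 2)) ^ 2
      ≤ (C ^ 2 * (α + α * ‖x‖ + ‖x‖ ^ 3 / s)) ^ 2 := by
    rw [← sq_abs]; gcongr
  have h5 : (α + α * ‖x‖ + ‖x‖ ^ 3 / s) ^ 2 ≤ 192 * errF α s ‖x‖ := by
    have b1 : α + α * ‖x‖ ≤ 5 * α := by nlinarith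
    have b2 : (‖x‖ ^ 3 / s) ^ 2 ≤ 64 * (‖x‖ ^ 3 / s ^ 2) := by
      have : ‖x‖ ^ 3 ≤ 4 ^ 3 := by gcongr
      calc (‖x‖ ^ 3 / s) ^ 2 = ‖x‖ ^ 3 * (‖x‖ ^ 3 / s ^ 2) := by field_simp
        _ ≤ 4 ^ 3 * (‖x‖ ^ 3 / s ^ 2) := by gcongr
        _ = _ := by norm_num
    have b3 := (errF_pieces hα hs e0).1
    have b4 : ‖x‖ ^ 3 / s ^ 2 ≤ errF α s ‖x‖ - α ^ 2 := by
      unfold errF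
      have : 0 ≤ α * ‖x‖ / s := by positivity
      linarith
    have b5 : 0 ≤ ‖x‖ ^ 3 / s := by positivity
    calc (α + α * ‖x‖ + ‖x‖ ^ 3 / s) ^ 2 ≤ (5 * α + ‖x‖ ^ 3 / s) ^ 2 := by gcongr
      _ ≤ 2 * (5 * α) ^ 2 + 2 * (‖x‖ ^ 3 / s) ^ 2 := by
        nlinarith [sq_nonneg (5 * α - ‖x‖ ^ 3 / s)]
      _ ≤ 192 * errF α s ‖x‖ := by nlinarith
  have h6 : (C ^ 2 * (α + α * ‖x‖ + ‖x‖ ^ 3 / s)) ^ 2 ≤ C ^ 4 * (192 * errF α s ‖x‖) := by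
    calc _ = C ^ 4 * (α + α * ‖x‖ + ‖x‖ ^ 3 / s) ^ 2 := by ring
      _ ≤ _ := by gcongr
  have h7 : α ^ 2 ≤ C ^ 4 * errF α s ‖x‖ := by
    have := (errF_pieces hα hs e0).1
    have h8 : 1 ≤ C ^ 4 := one_le_pow₀ hC
    nlinarith [sq_nonneg α]
  have h8 : s ^ 2 * (α / ρ + (V x - potF A b s x / 2)) ^ 2
      ≤ 2 * (s * (α / ρ)) ^ 2 + 2 * (s * (V x - potF A b s x / 2)) ^ 2 := by
    nlinarith [sq_nonneg (s * (α / ρ) - s * (V x - potF A b s x / 2))]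
  nlinarith

set_option maxHeartbeats 2000000 in
/-- The pointwise Carleman inequality. -/
lemma PointBounds.carleman (h : PointBounds A b V C α x) (hf : ContDiff ℝ ∞ f)
    (hq : ContDiff ℝ ∞ q) (hα : 1 ≤ α) (hs : 0 < s)
    (hs1 : 72 * C ^ 5 * s ≤ 1) (hαs : α * s ≤ 1) {ρ θ m ℒ : ℝ} (hρ : s ≤ ρ) (hρC : ρ ≤ C * s)
    (hθ : 0 < θ) (hθC : θ ≤ C) (hm : |m| ≤ C * (θ / s))
    (hℒ : (ℒ - (antiPart A b s f q x + symPart A s f x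
        + (α / ρ + (V x - potF A b s x / 2)) * f x)) ^ 2
      ≤ C * (s * hessSq f x + (1 + α ^ 2 * s) * ‖gradient f x‖ ^ 2 + α ^ 4 * s * f x ^ 2)) :
    θ / (2 * C) * ‖gradient f x‖ ^ 2 + θ * α / (2 * C * s) * f x ^ 2
      ≤ 6 * C * (s * ℒ ^ 2) + 30000 * C ^ 9 * err α s ‖x‖ (f x) ‖gradient f x‖
        + 2 * C * (θ / s) * f x ^ 2
        - divG s (fun y => multField A b V s f q ρ (α + θ / 4) θ y
          + (64 / 9 * C ^ 2 * (C + 1) * s ^ 2) • rellich A f y) x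
        + densityDeriv A b V s f q ρ (α + θ / 4) (ρ / s * (1 + θ))
          (ρ / s * (1 + θ) * (V x - potF A b s x / 2) - ρ * (potFt A b s x / 2) + m) x := by
  have hC := h.one_le
  have hC0 : 0 < C := by linarith
  have hρ0 : 0 < ρ := by linarith
  have hs1' : s ≤ 1 := by nlinarith [one_le_pow₀ hC (n := 5)]
  have hJ := h.commForm_ge (f := f) hα hs hαs hρ hρC hθ hθC hm
  have hid := commutator_identity hs h.diffA h.symm h.diffb h.diffV hf hq ρ (α + θ / 4) θ
    (α / ρ + (V x - potF A b s x / 2)) (ρ / s * (1 + θ))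
    (ρ / s * (1 + θ) * (V x - potF A b s x / 2) - ρ * (potFt A b s x / 2) + m)
    (by field_simp; ring)
  have hH := h.hessSq_le (s := s) hs hf
  have hU := h.sq_potential_le hα hs hαs hρ
  have hE : divG s (fun y => multField A b V s f q ρ (α + θ / 4) θ y
          + (64 / 9 * C ^ 2 * (C + 1) * s ^ 2) • rellich A f y) x
      = divG s (multField A b V s f q ρ (α + θ / 4) θ) x
        + 64 / 9 * C ^ 2 * (C + 1) * s ^ 2 * divG s (rellich A f) x := by
    have d1 := (hasFDerivAt_flux h.diffA hf).1
    have d2 := (hasFDerivAt_drift (s := s) h.diffA h.diffb).1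
    have d3 := (hasFDerivAt_antiPart (s := s) h.diffA h.diffb hf hq).1
    have d4 := (hasFDerivAt_density (s := s) (ρ := ρ) (k₀ := α + θ / 4) h.diffA h.diffb
      h.diffV hf).1
    have d5 : DifferentiableAt ℝ (multField A b V s f q ρ (α + θ / 4) θ) x :=
      (((d3.const_mul (2 * ρ)).add ((hasFDerivAt_of_contDiff hf x).differentiableAt.const_mul
        (θ / 2))).smul d1).add (d4.neg.smul d2)
    have d6 := differentiableAt_rellich h.diffA hf
    rw [divG_add d5 (d6.fun_const_smul _), divG_smul (differentiableAt_const _) d6]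
    simp
  rw [hE]
  set g := antiPart A b s f q x
  set S := symPart A s f x
  set U := α / ρ + (V x - potF A b s x / 2)
  set D₁ := divG s (multField A b V s f q ρ (α + θ / 4) θ) x
  set D₂ := divG s (rellich A f) x
  set u := ‖gradient f x‖ with hu
  set Er := err α s ‖x‖ (f x) u with hEr
  set L := g + S + U * f x with hL
  have e0 : 0 ≤ ‖x‖ := norm_nonneg x
  have u0 : 0 ≤ u := norm_nonneg _
  have hF0 : 0 ≤ errF α s ‖x‖ := errF_nonneg hα hs e0
  have hErr1 : errP α s ‖x‖ * u ^ 2 + errF α s ‖x‖ * f x ^ 2 ≤ Er := by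
    have : 0 ≤ errC α s ‖x‖ * (|f x| * u) := by
      unfold errC; positivity
    rw [hEr]; unfold err; linarith
  have hP0 : ‖x‖ + Real.sqrt s + α * s = errP α s ‖x‖ := rfl
  have hPnn : 0 ≤ errP α s ‖x‖ := by unfold errP; positivity
  have hss : s ≤ Real.sqrt s := by
    apply Real.le_sqrt_of_sq_le
    rw [sq]; exact mul_le_of_le_one_left hs.le hs1'
  have hαs0 : 0 ≤ α * s := by positivity
  have hfsq := sq_nonneg (f x)
  have husq := sq_nonneg u
  have hErP : errP α s ‖x‖ * u ^ 2 ≤ Er := by linarith [mul_nonneg hF0 hfsq]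
  have hErF : errF α s ‖x‖ * f x ^ 2 ≤ Er := by linarith [mul_nonneg hPnn husq]
  have hEr0 : 0 ≤ Er := le_trans (by positivity) hErF
  -- the perturbation
  have hP : s * (ℒ - L) ^ 2 ≤ C * (s ^ 2 * hessSq f x) + C * Er := by
    have a1 : (s + (α * s) ^ 2) * u ^ 2 ≤ errP α s ‖x‖ * u ^ 2 := by
      gcongr
      have : (α * s) ^ 2 ≤ α * s := by rw [sq]; exact mul_le_of_le_one_left hαs0 hαs
      rw [← hP0]; linarith
    have a2 : (α * s) ^ 2 * α ^ 2 * f x ^ 2 ≤ errF α s ‖x‖ * f x ^ 2 := by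
      gcongr
      refine le_trans ?_ (errF_pieces hα hs e0).1
      exact mul_le_of_le_one_left (sq_nonneg α) (pow_le_one₀ hαs0 hαs)
    calc s * (ℒ - L) ^ 2
        ≤ s * (C * (s * hessSq f x + (1 + α ^ 2 * s) * u ^ 2 + α ^ 4 * s * f x ^ 2)) := by
          gcongr
      _ = C * (s ^ 2 * hessSq f x) + C * ((s + (α * s) ^ 2) * u ^ 2
          + (α * s) ^ 2 * α ^ 2 * f x ^ 2) := by ring
      _ ≤ C * (s ^ 2 * hessSq f x) + C * Er := by
          gcongr; linarith
  have hS : S ^ 2 ≤ 3 * (L ^ 2 + g ^ 2 + (U * f x) ^ 2) := by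
    have : S = L - g - U * f x := by rw [hL]; ring
    have e : 3 * (L ^ 2 + g ^ 2 + (U * f x) ^ 2) - (L - g - U * f x) ^ 2
      = (L + g) ^ 2 + (L + U * f x) ^ 2 + (g - U * f x) ^ 2 := by ring
    rw [this]
    linarith [sq_nonneg (L + g), sq_nonneg (L + U * f x), sq_nonneg (g - U * f x)]
  have hH2 : s ^ 2 * hessSq f x ≤ 9 * C ^ 3 * (s ^ 2 * (L ^ 2 + g ^ 2)) + 4000 * C ^ 7 * Er
      - 8 * C / 3 * s ^ 2 * D₂ := by
    have a1 : s ^ 2 * (U * f x) ^ 2 ≤ 402 * C ^ 4 * Er := by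
      calc s ^ 2 * (U * f x) ^ 2 = s ^ 2 * U ^ 2 * f x ^ 2 := by ring
        _ ≤ 402 * C ^ 4 * errF α s ‖x‖ * f x ^ 2 := by gcongr
        _ = 402 * C ^ 4 * (errF α s ‖x‖ * f x ^ 2) := by ring
        _ ≤ _ := by gcongr
    have a2 : (s ^ 2 + ‖x‖ ^ 2) * u ^ 2 ≤ 4 * Er := by
      have : s ^ 2 + ‖x‖ ^ 2 ≤ 4 * errP α s ‖x‖ := by
        have b1 : s ^ 2 ≤ s := by rw [sq]; exact mul_le_of_le_one_left hs.le hs1'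
        have b2 : ‖x‖ ^ 2 ≤ 4 * ‖x‖ := by
          rw [sq]; exact mul_le_mul_of_nonneg_right h.norm_le e0
        rw [← hP0]; linarith
      calc (s ^ 2 + ‖x‖ ^ 2) * u ^ 2 ≤ 4 * errP α s ‖x‖ * u ^ 2 := by gcongr
        _ = 4 * (errP α s ‖x‖ * u ^ 2) := by ring
        _ ≤ _ := by gcongr
    have a3 : s ^ 2 * ((1 + ‖x‖ ^ 2 / s ^ 2) * u ^ 2) = (s ^ 2 + ‖x‖ ^ 2) * u ^ 2 := by
      field_simp
    have a4 := mul_le_mul_of_nonneg_left hH (sq_nonneg s)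
    have a5 : 3 * C ^ 3 * (s ^ 2 * S ^ 2)
        ≤ 3 * C ^ 3 * (s ^ 2 * (3 * (L ^ 2 + g ^ 2 + (U * f x) ^ 2))) := by gcongr
    have a6 : 9 * C ^ 3 * (s ^ 2 * (U * f x) ^ 2) ≤ 9 * C ^ 3 * (402 * C ^ 4 * Er) := by gcongr
    have a7 : 3 * C ^ 5 * ((s ^ 2 + ‖x‖ ^ 2) * u ^ 2) ≤ 3 * C ^ 5 * (4 * Er) := by gcongr
    have a8 : C ^ 5 * Er ≤ C ^ 7 * Er := by
      gcongr
      norm_num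
    have a9 : 9 * C ^ 3 * (402 * C ^ 4 * Er) = 3618 * (C ^ 7 * Er) := by ring
    have e1 : s ^ 2 * (3 * C ^ 3 * S ^ 2 + 3 * C ^ 5 * (1 + ‖x‖ ^ 2 / s ^ 2) * u ^ 2
        - 8 * C / 3 * D₂) = 3 * C ^ 3 * (s ^ 2 * S ^ 2)
          + 3 * C ^ 5 * (s ^ 2 * ((1 + ‖x‖ ^ 2 / s ^ 2) * u ^ 2)) - 8 * C / 3 * s ^ 2 * D₂ := by
      ring
    have e2 : 3 * C ^ 3 * (s ^ 2 * (3 * (L ^ 2 + g ^ 2 + (U * f x) ^ 2)))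
      = 9 * C ^ 3 * (s ^ 2 * (L ^ 2 + g ^ 2)) + 9 * C ^ 3 * (s ^ 2 * (U * f x) ^ 2) := by ring
    have e3 : 3 * C ^ 5 * (4 * Er) = 12 * (C ^ 5 * Er) := by ring
    rw [e1, a3] at a4
    have a10 : 0 ≤ C ^ 7 * Er := by positivity
    linarith
  -- The Hessian term carries a spare factor s, so `hs1` allows a quarter of sL² to be absorbed on
  -- the left. Multiplication by 4/3 then turns 2, 1/(4C) and 2C·8C/3 into 8/3, 1/(3C) and 64C²/9;
  -- the last is the coefficient of the Rellich field in the statement, up to the factor C + 1.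
  have hsL : s * L ^ 2 ≤ 8 / 3 * (s * ℒ ^ 2) + 1 / (3 * C) * (s * g ^ 2)
      + 10670 * C ^ 8 * Er - 64 / 9 * C ^ 2 * s ^ 2 * D₂ := by
    have a1 : s * L ^ 2 ≤ 2 * (s * ℒ ^ 2) + 2 * (s * (ℒ - L) ^ 2) := by
      have e : 2 * (s * ℒ ^ 2) + 2 * (s * (ℒ - L) ^ 2) - s * L ^ 2 = s * (2 * ℒ - L) ^ 2 := by
        ring
      linarith [mul_nonneg hs.le (sq_nonneg (2 * ℒ - L))]
    have a3 : 18 * C ^ 4 * (s ^ 2 * (L ^ 2 + g ^ 2)) ≤ 1 / (4 * C) * (s * L ^ 2 + s * g ^ 2) := by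
      have a4 : 18 * C ^ 4 * s ≤ 1 / (4 * C) := by
        have e : 18 * C ^ 4 * s * (4 * C) = 72 * C ^ 5 * s := by ring
        rw [le_div_iff₀ (by positivity)]; linarith
      calc 18 * C ^ 4 * (s ^ 2 * (L ^ 2 + g ^ 2))
          = 18 * C ^ 4 * s * (s * L ^ 2 + s * g ^ 2) := by ring
        _ ≤ _ := by gcongr
    have a5 : 1 / (4 * C) * (s * L ^ 2) ≤ 1 / 4 * (s * L ^ 2) := by
      gcongr; linarith
    have a6 : 2 * (C * Er) ≤ 2 * (C ^ 8 * Er) := by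
      have : C ≤ C ^ 8 := le_self_pow₀ hC (by norm_num)
      gcongr
    have a7 := mul_le_mul_of_nonneg_left hH2 (by positivity : 0 ≤ 2 * C)
    have a8 : 0 ≤ C ^ 8 * Er := by positivity
    have a9 : 1 / (3 * C) * (s * g ^ 2) = 4 / 3 * (1 / (4 * C) * (s * g ^ 2)) := by
      field_simp
    rw [a9]
    linarith
  -- Since S + Uf = L − g, the product 2g(L − g) is at most L² − g². The gain −sg² pays, in `hg`,
  -- for the g² left behind by the Hessian estimate.
  have hR : 2 * ρ * g * (S + U * f x) + θ / 2 * f x * (g + S + U * f x)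
      ≤ (C + 1) * (s * L ^ 2) - s * g ^ 2 + C * (θ / s) * f x ^ 2 := by
    have a1 : S + U * f x = L - g := by rw [hL]; ring
    have a2 : 2 * ρ * g * (L - g) ≤ ρ * L ^ 2 - ρ * g ^ 2 := by
      have e : ρ * L ^ 2 - ρ * g ^ 2 - 2 * ρ * g * (L - g) = ρ * (L - g) ^ 2 := by ring
      linarith [mul_nonneg hρ0.le (sq_nonneg (L - g))]
    have a3 : ρ * L ^ 2 ≤ C * (s * L ^ 2) := by rw [← mul_assoc]; gcongr
    have a4 : s * g ^ 2 ≤ ρ * g ^ 2 := by gcongr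
    have a5 : θ / 2 * f x * L ≤ s * L ^ 2 + θ * (θ / s) / 16 * f x ^ 2 := by
      have : 0 ≤ s * (L - θ / (4 * s) * f x) ^ 2 := by positivity
      have e : s * (L - θ / (4 * s) * f x) ^ 2
        = s * L ^ 2 + θ * (θ / s) / 16 * f x ^ 2 - θ / 2 * f x * L := by field_simp; ring
      linarith
    have a6 : θ * (θ / s) / 16 * f x ^ 2 ≤ C * (θ / s) * f x ^ 2 := by
      have b1 : θ * (θ / s) ≤ C * (θ / s) := by gcongr
      have b2 : 0 ≤ C * (θ / s) := by positivity
      exact mul_le_mul_of_nonneg_right (by linarith) hfsq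
    rw [← hL, a1]
    linarith
  have hg : (C + 1) * (1 / (3 * C) * (s * g ^ 2)) ≤ s * g ^ 2 := by
    have : (C + 1) * (1 / (3 * C)) ≤ 1 := by
      rw [mul_one_div, div_le_one (by positivity)]; linarith
    calc (C + 1) * (1 / (3 * C) * (s * g ^ 2)) = (C + 1) * (1 / (3 * C)) * (s * g ^ 2) := by ring
      _ ≤ 1 * (s * g ^ 2) := by gcongr
      _ = _ := one_mul _
  have hfin := mul_le_mul_of_nonneg_left hsL (by positivity : 0 ≤ C + 1)
  have c1 : (C + 1) * (8 / 3 * (s * ℒ ^ 2)) ≤ 6 * C * (s * ℒ ^ 2) := by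
    have : (C + 1) * (8 / 3) ≤ 6 * C := by linarith
    rw [← mul_assoc]
    exact mul_le_mul_of_nonneg_right this (by positivity)
  have c2 : (C + 1) * (10670 * C ^ 8 * Er) ≤ 21340 * (C ^ 9 * Er) := by
    have h1 : (C + 1) * (10670 * C ^ 8 * Er) ≤ 2 * C * (10670 * C ^ 8 * Er) := by
      gcongr; linarith
    have e : 2 * C * (10670 * C ^ 8 * Er) = 21340 * (C ^ 9 * Er) := by ring
    linarith
  have c3 : 200 * C ^ 6 * Er ≤ 200 * (C ^ 9 * Er) := by
    rw [mul_assoc]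
    gcongr
    norm_num
  have c4 : 0 ≤ C ^ 9 * Er := by positivity
  have c5 : (C + 1) * (8 / 3 * (s * ℒ ^ 2) + 1 / (3 * C) * (s * g ^ 2)
      + 10670 * C ^ 8 * Er - 64 / 9 * C ^ 2 * s ^ 2 * D₂)
    = (C + 1) * (8 / 3 * (s * ℒ ^ 2)) + (C + 1) * (1 / (3 * C) * (s * g ^ 2))
      + (C + 1) * (10670 * C ^ 8 * Er) - 64 / 9 * C ^ 2 * (C + 1) * s ^ 2 * D₂ := by ring
  rw [c5] at hfin
  linarith

end ParabolicCarleman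

/-! ### Absorption of the errors: the main region and its complement. -/

namespace ParabolicCarleman
variable {n : ℕ}

/-- The small constant factor in the absorption of the error terms. -/
noncomputable def absorbConst (k : ℝ) : ℝ := 16 * thetaConst + 2 * k + k ^ 3 + k ^ 4 + 8

section Scalars
variable {α δ s e k w u : ℝ}

lemma theta_sq {τ : ℝ} (h : 0 < τ) (h1 : τ ≤ 1 / 2) :
    theta τ ^ 2 = τ * Real.log (1 / τ) ^ 3 := by
  have hl := log_inv_ge h h1
  unfold theta
  rw [mul_pow, ← Real.rpow_natCast (τ ^ (1 / 2 : ℝ)), ← Real.rpow_mul h.le,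
    ← Real.rpow_natCast (Real.log (1 / τ) ^ (3 / 2 : ℝ)), ← Real.rpow_mul (by linarith),
    ← Real.rpow_natCast (Real.log (1 / τ)) 3]
  norm_num

/-- Bounds in the region where the Gaussian weight is not negligible. -/
lemma main_region_bounds (hδ : 0 < δ) (hα : 1 ≤ α) (hs : 0 < s) (hk : 1 ≤ k)
    (hτ : α / δ ^ 2 * s ≤ 1 / 2)
    (hmain : e ^ 2 ≤ k ^ 2 * (α * s) * Real.log (1 / (α / δ ^ 2 * s))) :
    e ≤ 2 * k * δ * theta (α / δ ^ 2 * s) ∧ e ^ 3 ≤ k ^ 3 * (α * s) * δ * theta (α / δ ^ 2 * s) ∧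
      α * s ≤ 16 * δ ^ 2 * theta (α / δ ^ 2 * s) ^ 2 ∧
      Real.sqrt s ≤ 4 * δ * theta (α / δ ^ 2 * s) := by
  set τ := α / δ ^ 2 * s with hτd
  have hτ0 : 0 < τ := by positivity
  have hαs : α * s = δ ^ 2 * τ := by rw [hτd]; field_simp
  set l := Real.log (1 / τ) with hl
  have hl1 : 1 / 2 ≤ l := log_inv_ge hτ0 hτ
  have hθ := theta_pos hτ0 hτ
  have hθ2 := theta_sq hτ0 hτ
  rw [← hl] at hθ2
  have hsq := theta_ge_sqrt hτ0 hτ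
  have h3 : τ ≤ 16 * theta τ ^ 2 := by
    have := Real.sq_sqrt hτ0.le
    nlinarith [Real.sqrt_nonneg τ]
  have hαs2 : α * s ≤ 16 * δ ^ 2 * theta τ ^ 2 := by
    rw [hαs]; nlinarith [sq_nonneg δ]
  refine ⟨?_, ?_, hαs2, ?_⟩
  · refine le_of_sq_le_sq ?_ (by positivity)
    -- The region only offers one power of the logarithm l while θ² carries three; as l ≥ 1/2, the
    -- exchange costs a factor 4.
    have : l ≤ 4 * l ^ 3 := by nlinarith [sq_nonneg l, mul_nonneg (by linarith : 0 ≤ l) (by nlinarith : 0 ≤ 4 * l ^ 2 - 1)]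
    calc e ^ 2 ≤ k ^ 2 * (α * s) * l := hmain
      _ ≤ k ^ 2 * (α * s) * (4 * l ^ 3) := by gcongr
      _ = (2 * k * δ) ^ 2 * (τ * l ^ 3) := by rw [hαs]; ring
      _ = _ := by rw [← hθ2]; ring
  · refine le_of_sq_le_sq ?_ (by positivity)
    calc (e ^ 3) ^ 2 = (e ^ 2) ^ 3 := by ring
      _ ≤ (k ^ 2 * (α * s) * l) ^ 3 := by gcongr
      _ = (k ^ 3 * (α * s)) ^ 2 * ((α * s) * l ^ 3) := by ring
      _ = (k ^ 3 * (α * s)) ^ 2 * (δ ^ 2 * (τ * l ^ 3)) := by rw [hαs]; ring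
      _ = _ := by rw [← hθ2]; ring
  · rw [Real.sqrt_le_left (by positivity)]
    have : s ≤ α * s := by nlinarith
    nlinarith

/-- In this region e is at most of order √(αs l), with l the logarithm, and αs = δ²τ. So e³ is at
most a multiple of αs·δ·τ^{1/2} l^{3/2} = αs·δ·θ, and the other weights are smaller. Each
contributes at least one factor δ; the cross weight has square of order δ²αθ²/s and is split by
Young's inequality. -/
lemma err_le_main (hδ : 0 < δ) (hδ1 : δ ≤ 1) (hα : 1 ≤ α) (hs : 0 < s) (he : 0 ≤ e) (hk : 1 ≤ k)
    (hτ : α / δ ^ 2 * s ≤ 1 / 2)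
    (hmain : e ^ 2 ≤ k ^ 2 * (α * s) * Real.log (1 / (α / δ ^ 2 * s))) :
    err α s e w u ≤ absorbConst k * δ * (theta (α / δ ^ 2 * s) * u ^ 2
      + α * theta (α / δ ^ 2 * s) / s * w ^ 2) := by
  obtain ⟨h1, h2, h3, h4⟩ := main_region_bounds hδ hα hs hk hτ hmain
  set τ := α / δ ^ 2 * s with hτd
  have hτ0 : 0 < τ := by positivity
  have hθ := theta_pos hτ0 hτ
  have hθ1 := theta_le hτ0 (hτ.trans (by norm_num))
  set θ := theta τ with hθd
  have hc := thetaConst_ge_one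
  set c := thetaConst
  have hδ2 : δ ^ 2 ≤ δ := by nlinarith
  have g1 : α * s ≤ 16 * c * δ * θ := by
    calc α * s ≤ 16 * δ ^ 2 * θ ^ 2 := h3
      _ = 16 * δ ^ 2 * (θ * θ) := by ring
      _ ≤ 16 * δ * (c * θ) := by gcongr
      _ = _ := by ring
  have p1 : errP α s e ≤ (2 * k + 4 + 16 * c) * δ * θ := by
    unfold errP; linarith
  have f1 : α ^ 2 ≤ 16 * c * δ * (α * θ / s) := by
    calc α ^ 2 = α / s * (α * s) := by field_simp
      _ ≤ α / s * (16 * c * δ * θ) := by gcongr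
      _ = _ := by ring
  have f2 : α * e / s ≤ 2 * k * δ * (α * θ / s) := by
    calc α * e / s ≤ α * (2 * k * δ * θ) / s := by gcongr
      _ = _ := by ring
  have f3 : e ^ 3 / s ^ 2 ≤ k ^ 3 * δ * (α * θ / s) := by
    calc e ^ 3 / s ^ 2 ≤ k ^ 3 * (α * s) * δ * θ / s ^ 2 := by gcongr
      _ = _ := by field_simp
  have c1 : errC α s e ^ 2 ≤ (32 + 4 * k ^ 4) * δ ^ 2 * (α * θ ^ 2 / s) := by
    have a1 : α ^ 2 ≤ 16 * δ ^ 2 * (α * θ ^ 2 / s) := by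
      calc α ^ 2 = α / s * (α * s) := by field_simp
        _ ≤ α / s * (16 * δ ^ 2 * θ ^ 2) := by gcongr
        _ = _ := by ring
    have a2 : (e ^ 2 / s) ^ 2 ≤ 2 * k ^ 4 * δ ^ 2 * (α * θ ^ 2 / s) := by
      calc (e ^ 2 / s) ^ 2 = e * e ^ 3 / s ^ 2 := by ring
        _ ≤ (2 * k * δ * θ) * (k ^ 3 * (α * s) * δ * θ) / s ^ 2 := by gcongr
        _ = _ := by field_simp
    have a3 : errC α s e ^ 2 ≤ 2 * α ^ 2 + 2 * (e ^ 2 / s) ^ 2 := by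
      unfold errC; nlinarith [sq_nonneg (α - e ^ 2 / s)]
    linarith
  have hcr : errC α s e * (|w| * u) ≤ δ * θ * u ^ 2 + (8 + k ^ 4) * δ * (α * θ / s) * w ^ 2 := by
    have a1 : 0 ≤ δ * θ * (u - errC α s e / (2 * (δ * θ)) * |w|) ^ 2 := by positivity
    have a2 : δ * θ * (u - errC α s e / (2 * (δ * θ)) * |w|) ^ 2
        = δ * θ * u ^ 2 + errC α s e ^ 2 / (4 * (δ * θ)) * |w| ^ 2 - errC α s e * (|w| * u) := by
      field_simp; ring
    have a3 : errC α s e ^ 2 / (4 * (δ * θ)) ≤ (8 + k ^ 4) * δ * (α * θ / s) := by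
      rw [div_le_iff₀ (by positivity)]
      refine c1.trans (le_of_eq ?_)
      ring
    rw [sq_abs] at a2
    have a4 := mul_le_mul_of_nonneg_right a3 (sq_nonneg w)
    linarith
  have q1 : errP α s e * u ^ 2 ≤ (2 * k + 4 + 16 * c) * δ * θ * u ^ 2 := by gcongr
  have q2 : errF α s e * w ^ 2 ≤ (16 * c + 2 * k + k ^ 3) * δ * (α * θ / s) * w ^ 2 := by
    gcongr; unfold errF; linarith
  have r1 : 0 ≤ (k ^ 3 + k ^ 4 + 3) * (δ * (θ * u ^ 2)) := by positivity
  unfold err absorbConst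
  linarith

/-- No smallness is available here; each weight is only compared with α²/s², to be paired with the
Gaussian tail. The cross weight is shared equally, so 80 covers both 6 + 17/2 and 69 + 17/2. -/
lemma err_le_outer (hα : 1 ≤ α) (hs : 0 < s) (hs1 : s ≤ 1) (hαs : α * s ≤ 1) (he : 0 ≤ e)
    (he4 : e ≤ 4) (hu : 0 ≤ u) :
    err α s e w u ≤ 80 * (α ^ 2 / s ^ 2 * (w ^ 2 + u ^ 2)) := by
  have h1 : 1 ≤ α ^ 2 / s ^ 2 := by
    rw [le_div_iff₀ (by positivity)]; nlinarith
  have h2 : α ≤ α ^ 2 / s ^ 2 := by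
    rw [le_div_iff₀ (by positivity)]; nlinarith [sq_nonneg α]
  have hsm : (1 : ℝ) / s ≤ α ^ 2 / s ^ 2 := by
    rw [div_le_div_iff₀ hs (by positivity)]
    have a1 : s * s ≤ 1 * s := by gcongr
    have a2 : 1 * s ≤ α ^ 2 * s := by gcongr; exact one_le_pow₀ hα
    linarith
  have h3 : α ^ 2 ≤ α ^ 2 / s ^ 2 := by
    rw [le_div_iff₀ (by positivity)]
    exact mul_le_of_le_one_right (sq_nonneg α) (pow_le_one₀ hs.le hs1)
  have h4 : α / s ≤ α ^ 2 / s ^ 2 := by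
    rw [div_le_div_iff₀ hs (by positivity)]
    have : s ≤ α := hs1.trans hα
    calc α * s ^ 2 = α * s * s := by ring
      _ ≤ α * s * α := by gcongr
      _ = _ := by ring
  have h5 : 1 / s ^ 2 ≤ α ^ 2 / s ^ 2 := by gcongr; nlinarith
  set B := α ^ 2 / s ^ 2 with hB
  have hP : errP α s e ≤ 6 * B := by
    have : Real.sqrt s ≤ 1 := Real.sqrt_le_one.2 hs1
    unfold errP; linarith
  have hC : errC α s e ≤ 17 * B := by
    have : e ^ 2 / s ≤ 16 * (1 / s) := by
      rw [← mul_div_assoc]; gcongr; nlinarith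
    unfold errC; linarith
  have hF : errF α s e ≤ 69 * B := by
    have a1 : α * e / s ≤ 4 * (α / s) := by
      calc α * e / s ≤ α * 4 / s := by gcongr
        _ = _ := by ring
    have a2 : e ^ 3 / s ^ 2 ≤ 64 * (1 / s ^ 2) := by
      have : e ^ 3 ≤ 4 ^ 3 := by gcongr
      calc e ^ 3 / s ^ 2 ≤ 4 ^ 3 / s ^ 2 := by gcongr
        _ = _ := by ring
    unfold errF; linarith
  have hwu : |w| * u ≤ (w ^ 2 + u ^ 2) / 2 := by
    nlinarith [sq_nonneg (|w| - u), sq_abs w]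
  have hB0 : 0 ≤ B := by positivity
  calc err α s e w u ≤ 6 * B * u ^ 2 + 17 * B * ((w ^ 2 + u ^ 2) / 2) + 69 * B * w ^ 2 := by
        unfold err
        gcongr
    _ ≤ _ := by nlinarith [mul_nonneg hB0 (sq_nonneg w), mul_nonneg hB0 (sq_nonneg u)]

end Scalars

section Pointwise
variable {A : E n → E n →L[ℝ] E n} {b : E n → E n} {V : E n → ℝ} {C α s δ k : ℝ} {x : E n}
  {f q : E n → ℝ}

/-- The total vector field whose divergence appears in the Carleman inequality. -/
noncomputable def carlemanField (A : E n → E n →L[ℝ] E n) (b : E n → E n) (V : E n → ℝ)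
    (C α s : ℝ) (f q : E n → ℝ) (ρ θ : ℝ) (y : E n) : E n :=
  multField A b V s f q ρ (α + θ / 4) θ y + (64 / 9 * C ^ 2 * (C + 1) * s ^ 2) • rellich A f y

/-- The time derivative of the boundary density along the flow, divided by `G`. -/
noncomputable def carlemanDensityDeriv (A : E n → E n →L[ℝ] E n) (b : E n → E n) (V : E n → ℝ)
    (α s : ℝ) (f q : E n → ℝ) (ρ θ m : ℝ) (x : E n) : ℝ :=
  densityDeriv A b V s f q ρ (α + θ / 4) (ρ / s * (1 + θ))
    (ρ / s * (1 + θ) * (V x - potF A b s x / 2) - ρ * (potFt A b s x / 2) + m) x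

set_option maxHeartbeats 1000000 in
/-- The pointwise Carleman inequality after absorption of the error terms. -/
lemma PointBounds.carleman_absorbed (h : PointBounds A b V C α x) (hf : ContDiff ℝ ∞ f)
    (hq : ContDiff ℝ ∞ q) (hs : 0 < s) (hδ : 0 < δ) (hδ1 : δ ≤ 1) (hk : 1 ≤ k)
    (hτ : α / δ ^ 2 * s ≤ 1 / 2) (hα : 16 * C ^ 2 ≤ α) (hCθ : thetaConst ≤ C)
    (hδC : 72 * C ^ 5 * δ ^ 2 ≤ 1) (hδk : 240000 * C ^ 10 * absorbConst k * δ ≤ 1)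
    (hδθ : 16 * thetaConst * δ ≤ 1)
    {ρ m ℒ Bo : ℝ} (hρ : s ≤ ρ) (hρC : ρ ≤ C * s)
    (hm : |m| ≤ C * (theta (α / δ ^ 2 * s) / s))
    (hℒ : (ℒ - (antiPart A b s f q x + symPart A s f x
        + (α / ρ + (V x - potF A b s x / 2)) * f x)) ^ 2
      ≤ C * (s * hessSq f x + (1 + α ^ 2 * s) * ‖gradient f x‖ ^ 2 + α ^ 4 * s * f x ^ 2))
    (hBo0 : 0 ≤ Bo)
    (hBo : k ^ 2 * (α * s) * Real.log (1 / (α / δ ^ 2 * s)) < ‖x‖ ^ 2 →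
      α ^ 2 / s ^ 2 * gaussG x s ≤ Bo) :
    1 / (4 * C) * (gaussG x s * (α * s * ‖gradient f x‖ ^ 2 + α ^ 2 * f x ^ 2))
      ≤ 6 * C * (s * (gaussG x s * ℒ ^ 2)) + 2500000 * C ^ 9 * Bo * (f x ^ 2 + ‖gradient f x‖ ^ 2)
        - gaussG x s * divG s (carlemanField A b V C α s f q ρ (theta (α / δ ^ 2 * s))) x
        + gaussG x s * carlemanDensityDeriv A b V α s f q ρ (theta (α / δ ^ 2 * s)) m x := by
  have hC := h.one_le
  have hC0 : 0 < C := by linarith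
  have hα1 : 1 ≤ α := by nlinarith
  have hα0 : 0 < α := by linarith
  set τ := α / δ ^ 2 * s with hτd
  have hτ0 : 0 < τ := by positivity
  have hαsτ : α * s = δ ^ 2 * τ := by rw [hτd]; field_simp
  have hαsδ : α * s ≤ δ ^ 2 := by rw [hαsτ]; nlinarith [sq_nonneg δ]
  have hδ21 : δ ^ 2 ≤ 1 := by nlinarith
  have hsα : s ≤ α * s := by nlinarith
  have hθ := theta_pos hτ0 hτ
  have hθ1 := theta_le hτ0 (hτ.trans (by norm_num))
  set θ := theta τ with hθd
  have hθC : θ ≤ C := hθ1.trans hCθ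
  have hsC : 72 * C ^ 5 * s ≤ 1 := by
    refine le_trans ?_ hδC
    gcongr; linarith
  have main := h.carleman hf hq hα1 hs hsC (by linarith) hρ hρC hθ hθC hm hℒ
  have hG := gaussG_pos hs x
  set G := gaussG x s with hGd
  set u := ‖gradient f x‖ with hu
  have hu0 : 0 ≤ u := norm_nonneg _
  set F := f x with hF
  -- αs = δ²τ, τ is at most 16θ², and θ is bounded by `thetaConst`; `hδθ` absorbs the product of
  -- constants. This converts the weights θ and αθ/s of the positive part into αs and α².
  have hθs : α * s ≤ θ := by
    have hsq := theta_ge_sqrt hτ0 hτ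
    rw [← hθd] at hsq
    have h3 : τ ≤ 16 * θ ^ 2 := by
      have := Real.sq_sqrt hτ0.le
      nlinarith [Real.sqrt_nonneg τ]
    calc α * s = δ * (δ * τ) := by rw [hαsτ]; ring
      _ ≤ 1 * (δ * (16 * (thetaConst * θ))) := by
          have h4 : θ * θ ≤ thetaConst * θ := by gcongr
          have h5 : τ ≤ 16 * (thetaConst * θ) := by linarith [sq θ]
          gcongr
      _ = 16 * thetaConst * δ * θ := by ring
      _ ≤ 1 * θ := by gcongr
      _ = θ := one_mul θ
  set W := θ * u ^ 2 + α * θ / s * F ^ 2 with hW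
  have hW0 : 0 ≤ W := by positivity
  have hleft : α * s * u ^ 2 + α ^ 2 * F ^ 2 ≤ W := by
    have : α ^ 2 ≤ α * θ / s := by
      rw [le_div_iff₀ hs]
      calc α ^ 2 * s = α * (α * s) := by ring
        _ ≤ α * θ := by gcongr
    rw [hW]; gcongr
  -- This is where α ≥ 16C² is used: the f² term without a factor α becomes a fraction of αθ/s.
  have hlow : 2 * C * (θ / s) * F ^ 2 ≤ 1 / (8 * C) * W := by
    have : 2 * C * (θ / s) ≤ 1 / (8 * C) * (α * θ / s) := by
      calc 2 * C * (θ / s) = 1 / (8 * C) * (16 * C ^ 2 * θ / s) := by field_simp; norm_num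
        _ ≤ _ := by gcongr
    calc 2 * C * (θ / s) * F ^ 2 ≤ 1 / (8 * C) * (α * θ / s) * F ^ 2 := by gcongr
      _ = 1 / (8 * C) * (α * θ / s * F ^ 2) := by ring
      _ ≤ _ := by
          gcongr; rw [hW]; linarith [show 0 ≤ θ * u ^ 2 by positivity]
  have e1 : θ / (2 * C) * u ^ 2 + θ * α / (2 * C * s) * F ^ 2 = 1 / (2 * C) * W := by
    rw [hW]; field_simp
  have e2 : 1 / (2 * C) * W = 2 * (1 / (4 * C) * W) := by field_simp; ring
  have e3 : 1 / (8 * C) * W = 1 / 2 * (1 / (4 * C) * W) := by field_simp; ring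
  have hZ : 0 ≤ F ^ 2 + u ^ 2 := by positivity
  have hdiv : divG s (carlemanField A b V C α s f q ρ θ) x
    = divG s (fun y => multField A b V s f q ρ (α + θ / 4) θ y
          + (64 / 9 * C ^ 2 * (C + 1) * s ^ 2) • rellich A f y) x := rfl
  rw [← hdiv] at main
  have hdens : carlemanDensityDeriv A b V α s f q ρ θ m x = densityDeriv A b V s f q ρ (α + θ / 4)
    (ρ / s * (1 + θ))
    (ρ / s * (1 + θ) * (V x - potF A b s x / 2) - ρ * (potFt A b s x / 2) + m) x := rfl
  rw [← hdens] at main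
  set D := divG s (carlemanField A b V C α s f q ρ θ) x
  set P := carlemanDensityDeriv A b V α s f q ρ θ m x
  -- Half of the positive part is reserved for the errors. In the main region an eighth of W/C goes
  -- to `err` and an eighth to the lower order term. In the outer region `err` is paid by Bo, with
  -- 80·30000 below 2500000.
  have key : 30000 * C ^ 9 * (G * err α s ‖x‖ F u) + G * (2 * C * (θ / s) * F ^ 2)
      ≤ G * (1 / (4 * C) * W) + 2500000 * C ^ 9 * Bo * (F ^ 2 + u ^ 2) := by
    by_cases hmain : ‖x‖ ^ 2 ≤ k ^ 2 * (α * s) * Real.log (1 / τ)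
    · have a1 := err_le_main (w := F) (u := u) hδ hδ1 hα1 hs (norm_nonneg x) hk hτ hmain
      rw [← hτd, ← hθd, ← hW] at a1
      have a2 : 30000 * C ^ 9 * err α s ‖x‖ F u ≤ 1 / (8 * C) * W := by
        calc 30000 * C ^ 9 * err α s ‖x‖ F u
            ≤ 30000 * C ^ 9 * (absorbConst k * δ * W) := by gcongr
          _ = 1 / (8 * C) * (240000 * C ^ 10 * absorbConst k * δ * W) := by field_simp; ring
          _ ≤ 1 / (8 * C) * (1 * W) := by gcongr
          _ = _ := by ring
      have a3 : 0 ≤ 2500000 * C ^ 9 * Bo * (F ^ 2 + u ^ 2) := by positivity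
      have a4 := mul_le_mul_of_nonneg_left (add_le_add a2 hlow) hG.le
      rw [e3] at a4
      linarith
    · push Not at hmain
      have a1 := err_le_outer (w := F) hα1 hs (by linarith) (by linarith) (norm_nonneg x)
        h.norm_le hu0
      have a2 := hBo hmain
      have a3 : G * err α s ‖x‖ F u ≤ 80 * (Bo * (F ^ 2 + u ^ 2)) := by
        calc G * err α s ‖x‖ F u ≤ G * (80 * (α ^ 2 / s ^ 2 * (F ^ 2 + u ^ 2))) := by gcongr
          _ = 80 * ((α ^ 2 / s ^ 2 * G) * (F ^ 2 + u ^ 2)) := by ring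
          _ ≤ _ := by gcongr
      have a4 : 0 ≤ C ^ 9 * (Bo * (F ^ 2 + u ^ 2)) := by positivity
      have a5 : G * (1 / (8 * C) * W) ≤ G * (1 / (4 * C) * W) := by
        have : 0 ≤ 1 / (4 * C) * W := by positivity
        exact mul_le_mul_of_nonneg_left (by rw [e3]; linarith) hG.le
      have a6 := mul_le_mul_of_nonneg_left hlow hG.le
      have a7 := mul_le_mul_of_nonneg_left a3 (by positivity : 0 ≤ 30000 * C ^ 9)
      linarith
  have main2 := mul_le_mul_of_nonneg_left main hG.le
  rw [e1, e2] at main2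
  have hleft2 : 1 / (4 * C) * (G * (α * s * u ^ 2 + α ^ 2 * F ^ 2)) ≤ G * (1 / (4 * C) * W) := by
    calc 1 / (4 * C) * (G * (α * s * u ^ 2 + α ^ 2 * F ^ 2)) ≤ 1 / (4 * C) * (G * W) := by gcongr
      _ = _ := by ring
  linarith

end Pointwise

end ParabolicCarleman

/-! ### Integration in space at a fixed time. -/

namespace ParabolicCarleman
variable {n : ℕ}

section Support
variable {f : E n → ℝ} {x : E n}

lemma gradient_eq_zero_of_notMem (h : x ∉ tsupport f) : gradient f x = 0 := by
  have h1 : f =ᶠ[𝓝 x] fun _ => (0 : ℝ) := notMem_tsupport_iff_eventuallyEq.1 h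
  rw [gradient, h1.fderiv_eq]
  simp

variable {A : E n → E n →L[ℝ] E n} {b : E n → E n} {V : E n → ℝ} {q : E n → ℝ}

lemma carlemanField_eq_zero_of_notMem {C α s ρ θ : ℝ} (h : x ∉ tsupport f) :
    carlemanField A b V C α s f q ρ θ x = 0 := by
  have h1 := gradient_eq_zero_of_notMem h
  have h2 : f x = 0 := image_eq_zero_of_notMem_tsupport h
  simp [carlemanField, multField, rellich, flux, density, h1, h2]

lemma divG_carlemanField_eq_zero {C α s ρ θ : ℝ} (h : x ∉ tsupport f) :
    divG s (carlemanField A b V C α s f q ρ θ) x = 0 := by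
  have h1 : carlemanField A b V C α s f q ρ θ =ᶠ[𝓝 x] fun _ => 0 := by
    filter_upwards [(isClosed_tsupport f).isOpen_compl.mem_nhds h] with y hy
    exact carlemanField_eq_zero_of_notMem hy
  rw [divG, h1.fderiv_eq, h1.eq_of_nhds]
  simp [tr]

lemma carlemanDensityDeriv_eq_zero {α s ρ θ m : ℝ} (h : x ∉ tsupport f) :
    carlemanDensityDeriv A b V α s f q ρ θ m x = 0 := by
  have h1 := gradient_eq_zero_of_notMem h
  have h2 : f x = 0 := image_eq_zero_of_notMem_tsupport h
  simp [carlemanDensityDeriv, densityDeriv, flux, density, h1, h2]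

end Support

section Regularity

lemma locallyLipschitz_of_eq {α β : Type*} [PseudoEMetricSpace α] [PseudoEMetricSpace β]
    {f g : α → β} (h : LocallyLipschitz f) (e : ∀ y, g y = f y) : LocallyLipschitz g :=
  (funext e : g = f) ▸ h

variable {A : E n → E n →L[ℝ] E n} {b : E n → E n} {V : E n → ℝ} {f q : E n → ℝ} {s : ℝ}

lemma locallyLipschitz_flux (hA : LocallyLipschitz A) (hf : ContDiff ℝ ∞ f) :
    LocallyLipschitz (flux A f) :=
  locallyLipschitz_clm_apply hA (contDiff_gradient hf).locallyLipschitz'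

lemma locallyLipschitz_drift (hA : LocallyLipschitz A) (hb : LocallyLipschitz b) :
    LocallyLipschitz (drift A b s) :=
  locallyLipschitz_add (locallyLipschitz_const_smul _
    (locallyLipschitz_clm_apply hA LocallyLipschitz.id)) hb

lemma locallyLipschitz_potP (hA : LocallyLipschitz A) (hb : LocallyLipschitz b) :
    LocallyLipschitz (potP A b) := by
  have h1 : LocallyLipschitz fun y => tr (A y) := (trL n).lipschitz.locallyLipschitz.comp hA
  have h2 : LocallyLipschitz fun y : E n => (inner ℝ (b y) y : ℝ) :=
    locallyLipschitz_inner hb LocallyLipschitz.id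
  have := locallyLipschitz_sub (locallyLipschitz_mul_const
    (locallyLipschitz_sub h1 (LocallyLipschitz.const (n : ℝ))) (1 / 2))
    (locallyLipschitz_mul_const h2 (1 / 2))
  exact locallyLipschitz_of_eq this fun y => by simp [potP]; ring

lemma locallyLipschitz_potQ (hA : LocallyLipschitz A) : LocallyLipschitz (potQ A) := by
  have h1 : LocallyLipschitz fun y : E n => (inner ℝ (A y y - y) y : ℝ) :=
    locallyLipschitz_inner (locallyLipschitz_sub
      (locallyLipschitz_clm_apply hA LocallyLipschitz.id) LocallyLipschitz.id) LocallyLipschitz.id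
  have := locallyLipschitz_mul_const h1 (-1 / 4)
  exact locallyLipschitz_of_eq this fun y => by simp [potQ]; ring

lemma locallyLipschitz_potF (hA : LocallyLipschitz A) (hb : LocallyLipschitz b) :
    LocallyLipschitz (potF A b s) := by
  have := locallyLipschitz_add
    (locallyLipschitz_mul_const (locallyLipschitz_potP hA hb) (1 / s))
    (locallyLipschitz_mul_const (locallyLipschitz_potQ hA) (1 / s ^ 2))
  exact locallyLipschitz_of_eq this fun y => by simp [potF]; ring

lemma locallyLipschitz_antiPart (hA : LocallyLipschitz A) (hb : LocallyLipschitz b)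
    (hf : ContDiff ℝ ∞ f) (hq : ContDiff ℝ ∞ q) : LocallyLipschitz (antiPart A b s f q) := by
  have := locallyLipschitz_add (locallyLipschitz_add hq.locallyLipschitz'
    (locallyLipschitz_inner (locallyLipschitz_drift (s := s) hA hb)
      (contDiff_gradient hf).locallyLipschitz'))
    (locallyLipschitz_mul_const (locallyLipschitz_mul (locallyLipschitz_potF (s := s) hA hb)
      hf.locallyLipschitz') (1 / 2))
  exact locallyLipschitz_of_eq this fun y => by simp [antiPart]; ring

lemma locallyLipschitz_density {ρ k₀ : ℝ} (hA : LocallyLipschitz A) (hb : LocallyLipschitz b)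
    (hV : LocallyLipschitz V) (hf : ContDiff ℝ ∞ f) :
    LocallyLipschitz (density A b V s f ρ k₀) := by
  have h1 := locallyLipschitz_inner (locallyLipschitz_flux hA hf)
    (contDiff_gradient hf).locallyLipschitz'
  have h2 := locallyLipschitz_mul_const (locallyLipschitz_potF (s := s) hA hb) (1 / 2)
  have h3 := locallyLipschitz_add (LocallyLipschitz.const k₀)
    (locallyLipschitz_const_mul ρ (locallyLipschitz_sub hV h2))
  have := locallyLipschitz_sub (locallyLipschitz_const_mul ρ h1)
    (locallyLipschitz_mul h3 (locallyLipschitz_mul hf.locallyLipschitz' hf.locallyLipschitz'))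
  exact locallyLipschitz_of_eq this fun y => by simp [density]; ring

lemma locallyLipschitz_carlemanField {C α ρ θ : ℝ} (hA : LocallyLipschitz A)
    (hb : LocallyLipschitz b) (hV : LocallyLipschitz V) (hf : ContDiff ℝ ∞ f)
    (hq : ContDiff ℝ ∞ q) : LocallyLipschitz (carlemanField A b V C α s f q ρ θ) := by
  have hX := locallyLipschitz_flux hA hf
  have h1 := locallyLipschitz_smul (locallyLipschitz_add
    (locallyLipschitz_const_mul (2 * ρ) (locallyLipschitz_antiPart (s := s) hA hb hf hq))
    (locallyLipschitz_const_mul (θ / 2) hf.locallyLipschitz')) hX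
  have h2 := locallyLipschitz_smul (locallyLipschitz_const_mul (-1)
    (locallyLipschitz_density (s := s) (ρ := ρ) (k₀ := α + θ / 4) hA hb hV hf))
    (locallyLipschitz_drift (s := s) hA hb)
  have hH := (contDiff_hess hf).locallyLipschitz'
  have h3 := locallyLipschitz_sub (locallyLipschitz_smul
    ((trL n).lipschitz.locallyLipschitz.comp hH) hX) (locallyLipschitz_clm_apply hH hX)
  have := locallyLipschitz_add (locallyLipschitz_add h1 h2)
    (locallyLipschitz_const_smul (64 / 9 * C ^ 2 * (C + 1) * s ^ 2) h3)
  exact locallyLipschitz_of_eq this fun y => by simp [carlemanField, multField, rellich, trL_apply]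

lemma continuous_carlemanDensityDeriv {α ρ θ m : ℝ} (hA : LocallyLipschitz A)
    (hb : LocallyLipschitz b) (hV : LocallyLipschitz V) (hf : ContDiff ℝ ∞ f)
    (hq : ContDiff ℝ ∞ q) : Continuous (carlemanDensityDeriv A b V α s f q ρ θ m) := by
  have hX := (locallyLipschitz_flux hA hf).continuous
  have hP := (locallyLipschitz_potP hA hb).continuous
  have hQ := (locallyLipschitz_potQ hA).continuous
  have hF := (locallyLipschitz_potF (s := s) hA hb).continuous
  have hd := (locallyLipschitz_density (s := s) (ρ := ρ) (k₀ := α + θ / 4) hA hb hV hf).continuous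
  have hp := (contDiff_gradient hf).continuous
  have hr := (contDiff_gradient hq).continuous
  have hVc := hV.continuous
  have hfc := hf.continuous
  have hqc := hq.continuous
  unfold carlemanDensityDeriv densityDeriv potFt
  fun_prop

end Regularity

section Slice
variable {A : E n → E n →L[ℝ] E n} {b : E n → E n} {V : E n → ℝ} {f q : E n → ℝ}
  {C α s δ k : ℝ}

/-- The Carleman inequality at a fixed time. -/
lemma slice_carleman (hA : LocallyLipschitz A) (hb : LocallyLipschitz b) (hV : LocallyLipschitz V)
    (hf : ContDiff ℝ ∞ f) (hq : ContDiff ℝ ∞ q) (hfc : HasCompactSupport f)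
    (hPB : ∀ᵐ x, x ∈ tsupport f → PointBounds A b V C α x) (hC : 1 ≤ C)
    (hs : 0 < s) (hδ : 0 < δ) (hδ1 : δ ≤ 1) (hk : 1 ≤ k)
    (hτ : α / δ ^ 2 * s ≤ 1 / 2) (hα : 16 * C ^ 2 ≤ α) (hCθ : thetaConst ≤ C)
    (hδC : 72 * C ^ 5 * δ ^ 2 ≤ 1) (hδk : 240000 * C ^ 10 * absorbConst k * δ ≤ 1)
    (hδθ : 16 * thetaConst * δ ≤ 1)
    {ρ m Bo : ℝ} {ℒ : E n → ℝ} (hρ : s ≤ ρ) (hρC : ρ ≤ C * s)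
    (hm : |m| ≤ C * (theta (α / δ ^ 2 * s) / s))
    (hℒ : ∀ᵐ x, x ∈ tsupport f → (ℒ x - (antiPart A b s f q x + symPart A s f x
        + (α / ρ + (V x - potF A b s x / 2)) * f x)) ^ 2
      ≤ C * (s * hessSq f x + (1 + α ^ 2 * s) * ‖gradient f x‖ ^ 2 + α ^ 4 * s * f x ^ 2))
    (hint : Integrable fun x => gaussG x s * ℒ x ^ 2) (hBo0 : 0 ≤ Bo)
    (hBo : ∀ x : E n, k ^ 2 * (α * s) * Real.log (1 / (α / δ ^ 2 * s)) < ‖x‖ ^ 2 →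
      α ^ 2 / s ^ 2 * gaussG x s ≤ Bo) :
    1 / (4 * C) * ∫ x, gaussG x s * (α * s * ‖gradient f x‖ ^ 2 + α ^ 2 * f x ^ 2)
      ≤ 6 * C * (s * ∫ x, gaussG x s * ℒ x ^ 2)
        + 2500000 * C ^ 9 * Bo * (∫ x, (f x ^ 2 + ‖gradient f x‖ ^ 2))
        + ∫ x, gaussG x s
          * carlemanDensityDeriv A b V α s f q ρ (theta (α / δ ^ 2 * s)) m x := by
  set θ := theta (α / δ ^ 2 * s)
  have hG : Continuous fun x : E n => gaussG x s := (contDiff_gaussG s).continuous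
  have hp := (contDiff_gradient hf).continuous
  have hcomp : ∀ g : E n → ℝ, Continuous g → (∀ x ∉ tsupport f, g x = 0) → Integrable g :=
    fun g hg h0 => hg.integrable_of_hasCompactSupport (HasCompactSupport.intro hfc h0)
  have i1 : Integrable fun x => gaussG x s * (α * s * ‖gradient f x‖ ^ 2 + α ^ 2 * f x ^ 2) := by
    refine hcomp _ ?_ fun x hx => ?_
    · have := hf.continuous; fun_prop
    · simp [gradient_eq_zero_of_notMem hx, image_eq_zero_of_notMem_tsupport hx]
  have i2 : Integrable fun x => f x ^ 2 + ‖gradient f x‖ ^ 2 := by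
    refine hcomp _ ?_ fun x hx => ?_
    · have := hf.continuous; fun_prop
    · simp [gradient_eq_zero_of_notMem hx, image_eq_zero_of_notMem_tsupport hx]
  have i3 : Integrable fun x => gaussG x s * carlemanDensityDeriv A b V α s f q ρ θ m x := by
    refine hcomp _ ?_ fun x hx => ?_
    · exact hG.mul (continuous_carlemanDensityDeriv hA hb hV hf hq)
    · simp [carlemanDensityDeriv_eq_zero hx]
  -- All divergence terms form one compactly supported locally Lipschitz field, so they vanish
  -- together after integration against G.
  have i4 := integral_gaussG_div hs (locallyLipschitz_carlemanField (s := s) (C := C) (α := α)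
    (ρ := ρ) (θ := θ) hA hb hV hf hq)
    (HasCompactSupport.intro hfc fun x hx => carlemanField_eq_zero_of_notMem hx)
  have i4' : Integrable (fun x => gaussG x s * divG s (carlemanField A b V C α s f q ρ θ) x) ∧
    ∫ x, gaussG x s * divG s (carlemanField A b V C α s f q ρ θ) x = 0 := i4
  have hmono : ∫ x, 1 / (4 * C) * (gaussG x s * (α * s * ‖gradient f x‖ ^ 2 + α ^ 2 * f x ^ 2))
      ≤ ∫ x, (6 * C * (s * (gaussG x s * ℒ x ^ 2))
        + 2500000 * C ^ 9 * Bo * (f x ^ 2 + ‖gradient f x‖ ^ 2)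
        - gaussG x s * divG s (carlemanField A b V C α s f q ρ θ) x
        + gaussG x s * carlemanDensityDeriv A b V α s f q ρ θ m x) := by
    refine integral_mono_ae (i1.const_mul _)
      (((((hint.const_mul s).const_mul (6 * C)).add (i2.const_mul _)).sub i4'.1).add i3) ?_
    filter_upwards [hPB, hℒ] with x h1 h2
    by_cases hx : x ∈ tsupport f
    · exact (h1 hx).carleman_absorbed hf hq hs hδ hδ1 hk hτ hα hCθ hδC hδk hδθ hρ hρC hm (h2 hx)
        hBo0 (hBo x)
    · simp only [divG_carlemanField_eq_zero hx, carlemanDensityDeriv_eq_zero hx,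
        gradient_eq_zero_of_notMem hx, image_eq_zero_of_notMem_tsupport hx]
      have := gaussG_pos hs x
      simp
      positivity
  have j1 : Integrable fun x => 6 * C * (s * (gaussG x s * ℒ x ^ 2)) :=
    (hint.const_mul s).const_mul (6 * C)
  have j2 : Integrable fun x => 2500000 * C ^ 9 * Bo * (f x ^ 2 + ‖gradient f x‖ ^ 2) :=
    i2.const_mul _
  have j3 : Integrable fun x => 6 * C * (s * (gaussG x s * ℒ x ^ 2))
      + 2500000 * C ^ 9 * Bo * (f x ^ 2 + ‖gradient f x‖ ^ 2) := j1.add j2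
  have j4 : Integrable fun x => 6 * C * (s * (gaussG x s * ℒ x ^ 2))
      + 2500000 * C ^ 9 * Bo * (f x ^ 2 + ‖gradient f x‖ ^ 2)
      - gaussG x s * divG s (carlemanField A b V C α s f q ρ θ) x := j3.sub i4'.1
  rw [integral_const_mul, integral_add j4 i3, integral_sub j3 i4'.1, integral_add j1 j2, i4'.2,
    integral_const_mul, integral_const_mul, integral_const_mul] at hmono
  linarith

end Slice

end ParabolicCarleman

/-! ### Regularity of the coefficients and their freezing in time. -/

namespace ParabolicCarleman
variable {n : ℕ}

section Matrix

/-- The operator on Euclidean space defined by a matrix. -/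
noncomputable def matOp (B : Matrix (Fin n) (Fin n) ℝ) : E n →L[ℝ] E n :=
  LinearMap.toContinuousLinearMap (Matrix.toEuclideanLin B)

lemma matOp_apply (B : Matrix (Fin n) (Fin n) ℝ) (v : E n) :
    matOp B v = Matrix.toEuclideanLin B v := rfl

lemma matOp_one : matOp (1 : Matrix (Fin n) (Fin n) ℝ) = 1 := by
  ext v i
  simp [matOp_apply]

lemma matOp_sub (B B' : Matrix (Fin n) (Fin n) ℝ) : matOp (B - B') = matOp B - matOp B' := by
  ext v i
  simp [matOp_apply]

lemma norm_le_card_mul {y : E n} {m : ℝ} (h : ∀ i, |y i| ≤ m) : ‖y‖ ≤ n * m := by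
  have h1 : y = ∑ i, y i • EuclideanSpace.single i (1 : ℝ) := by
    ext j; simp [Finset.sum_apply, Pi.single_apply]
  calc ‖y‖ = ‖∑ i, y i • EuclideanSpace.single i (1 : ℝ)‖ := by rw [← h1]
    _ ≤ ∑ i, ‖y i • EuclideanSpace.single i (1 : ℝ)‖ := norm_sum_le _ _
    _ ≤ ∑ _i : Fin n, m := Finset.sum_le_sum fun i _ => by
        rw [norm_smul]; simpa using h i
    _ = n * m := by simp

lemma norm_matOp_le {B : Matrix (Fin n) (Fin n) ℝ} {m : ℝ} (hm : 0 ≤ m) (h : ∀ i j, |B i j| ≤ m) :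
    ‖matOp B‖ ≤ n ^ 2 * m := by
  refine ContinuousLinearMap.opNorm_le_bound _ (by positivity) fun v => ?_
  have h1 : ∀ i, |matOp B v i| ≤ n * m * ‖v‖ := fun i => by
    have e : matOp B v i = ∑ j, B i j * v j := by
      simp [matOp_apply, Matrix.toLpLin_apply, Matrix.mulVec, dotProduct]
    rw [e]
    calc |∑ j, B i j * v j| ≤ ∑ j, |B i j * v j| := Finset.abs_sum_le_sum_abs _ _
      _ ≤ ∑ _j : Fin n, m * ‖v‖ := Finset.sum_le_sum fun j _ => by
          rw [abs_mul]; exact mul_le_mul (h i j) (abs_apply_le_norm v j) (abs_nonneg _) hm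
      _ = n * m * ‖v‖ := by simp; ring
  exact (norm_le_card_mul h1).trans_eq (by ring)

variable {Λ M : ℝ} {A : E n → ℝ → Matrix (Fin n) (Fin n) ℝ}

lemma IsAdmissible.norm_sub_le (hA : IsAdmissible Λ M A) (hM : 0 ≤ M) {x y : E n} {t s : ℝ}
    (ht : 0 ≤ t) (hs : 0 ≤ s) :
    ‖matOp (A x t) - matOp (A y s)‖ ≤ n ^ 2 * M * (‖x - y‖ + |t - s| ^ (1 / 2 : ℝ)) := by
  rw [← matOp_sub, mul_assoc]
  exact norm_matOp_le (by positivity) fun i j => hA.regular x y t s ht hs i j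

lemma IsAdmissible.lipschitz (hA : IsAdmissible Λ M A) (hM : 0 ≤ M) {t : ℝ} (ht : 0 ≤ t) :
    LipschitzWith (n ^ 2 * M).toNNReal fun x => matOp (A x t) :=
  LipschitzWith.of_dist_le_mul fun x y => by
    rw [dist_eq_norm, dist_eq_norm, Real.coe_toNNReal _ (by positivity)]
    simpa using hA.norm_sub_le hM (x := x) (y := y) ht ht

lemma IsAdmissible.norm_fderiv_le (hA : IsAdmissible Λ M A) (hM : 0 ≤ M) {t : ℝ} (ht : 0 ≤ t)
    (x : E n) : ‖fderiv ℝ (fun y => matOp (A y t)) x‖ ≤ n ^ 2 * M := by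
  have := norm_fderiv_le_of_lipschitz ℝ (hA.lipschitz hM ht) (x₀ := x)
  rwa [Real.coe_toNNReal _ (by positivity)] at this

lemma IsAdmissible.norm_sub_one_le (hA : IsAdmissible Λ M A) (hM : 0 ≤ M) (h0 : A 0 0 = 1)
    {x : E n} {t : ℝ} (ht : 0 ≤ t) :
    ‖matOp (A x t) - 1‖ ≤ n ^ 2 * M * (‖x‖ + t ^ (1 / 2 : ℝ)) := by
  have := hA.norm_sub_le hM (x := x) (y := 0) ht le_rfl
  rwa [h0, matOp_one, sub_zero, sub_zero, abs_of_nonneg ht] at this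

lemma IsAdmissible.inner_comm (hA : IsAdmissible Λ M A) {x : E n} {t : ℝ} (ht : 0 ≤ t)
    (u v : E n) : inner ℝ (matOp (A x t) u) v = inner ℝ u (matOp (A x t) v) := by
  have hs := hA.symm x t ht
  have : (Matrix.toEuclideanLin (A x t)).IsSymmetric := by
    rw [Matrix.isSymmetric_toEuclideanLin_iff]
    rwa [Matrix.IsHermitian, Matrix.conjTranspose_eq_transpose_of_trivial]
  exact this u v

end Matrix

section ScalarNorm
variable {f : E n → ℝ → ℝ}

lemma FiniteNorm.abs_sub_le (hf : FiniteNorm f) {x : E n} (hx : x ∈ Metric.ball (0 : E n) 4)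
    {t s : ℝ} (ht : t ∈ Icc (0 : ℝ) 16) (hs : s ∈ Icc (0 : ℝ) 16) :
    |f x t - f x s| ≤ (scalarNorm f).toReal * |t - s| ^ (1 / 2 : ℝ) := by
  rcases eq_or_ne t s with rfl | hne
  · simp
  have h1 : ENNReal.ofReal (|f x t - f x s| / |t - s| ^ (1 / 2 : ℝ)) ≤ scalarNorm f := by
    refine le_trans ?_ le_add_self
    exact le_iSup₂_of_le x hx (le_iSup₂_of_le t ht (le_iSup₂_of_le s hs le_rfl))
  have hpos : 0 < |t - s| ^ (1 / 2 : ℝ) := Real.rpow_pos_of_pos (abs_pos.2 (sub_ne_zero.2 hne)) _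
  have h2 := (ENNReal.ofReal_le_iff_le_toReal hf.2).1 h1
  rwa [div_le_iff₀ hpos] at h2

/-- Fubini, with the time variable taken first. An essential supremum over the cylinder controls
only almost every time slice, so b and V have to be frozen at a generic time and not at t = 0. -/
lemma FiniteNorm.ae_bound (hf : FiniteNorm f) :
    ∀ᵐ t ∂(volume.restrict (Icc (0 : ℝ) 16)), ∀ᵐ x ∂(volume.restrict (Metric.ball (0 : E n) 4)),
      |f x t| ≤ (scalarNorm f).toReal ∧ ‖gradX f x t‖ ≤ (scalarNorm f).toReal := by
  have hle1 : eLpNorm (fun p : E n × ℝ => f p.1 p.2) ⊤ (volume.restrict (Q4 n)) ≤ scalarNorm f :=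
    le_self_add.trans le_self_add
  have hle2 : eLpNorm (fun p : E n × ℝ => gradX f p.1 p.2) ⊤ (volume.restrict (Q4 n))
      ≤ scalarNorm f := le_add_self.trans le_self_add
  have h1 := ae_le_eLpNormEssSup (f := fun p : E n × ℝ => f p.1 p.2) (μ := volume.restrict (Q4 n))
  have h2 := ae_le_eLpNormEssSup (f := fun p : E n × ℝ => gradX f p.1 p.2)
    (μ := volume.restrict (Q4 n))
  rw [← eLpNorm_exponent_top] at h1 h2
  have h3 : ∀ᵐ p ∂((volume.restrict (Metric.ball (0 : E n) 4)).prod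
      (volume.restrict (Icc (0 : ℝ) 16))), |f p.1 p.2| ≤ (scalarNorm f).toReal ∧
        ‖gradX f p.1 p.2‖ ≤ (scalarNorm f).toReal := by
    rw [Measure.prod_restrict]
    change ∀ᵐ p ∂(volume.restrict (Q4 n)), _
    filter_upwards [h1, h2] with p hp1 hp2
    have e1 := ENNReal.toReal_mono hf.2 (hp1.trans hle1)
    have e2 := ENNReal.toReal_mono hf.2 (hp2.trans hle2)
    rw [toReal_enorm] at e1 e2
    exact ⟨e1, e2⟩
  have h4 := (Measure.measurePreserving_swap (μ := volume.restrict (Icc (0 : ℝ) 16))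
    (ν := volume.restrict (Metric.ball (0 : E n) 4))).quasiMeasurePreserving.ae h3
  exact Measure.ae_ae_of_ae_prod h4

/-- At almost every time the slice extends to a Lipschitz function with the expected bounds. -/
lemma FiniteNorm.ae_exists_extension (hf : FiniteNorm f) :
    ∀ᵐ t ∂(volume.restrict (Icc (0 : ℝ) 16)), ∃ g : E n → ℝ, LocallyLipschitz g ∧
      (∀ x ∈ Metric.ball (0 : E n) 4, g x = f x t) ∧
      ∀ᵐ x, x ∈ Metric.ball (0 : E n) 4 → DifferentiableAt ℝ g x ∧
        |g x| ≤ (scalarNorm f).toReal ∧ ‖fderiv ℝ g x‖ ≤ (scalarNorm f).toReal := by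
  filter_upwards [hf.ae_bound, ae_restrict_mem measurableSet_Icc] with t ht ht'
  obtain ⟨K, hK⟩ := hf.1 t ht'
  obtain ⟨g, hg, hgf⟩ := hK.extend_real
  refine ⟨g, hg.locallyLipschitz, fun x hx => (hgf hx).symm, ?_⟩
  rw [ae_restrict_iff' measurableSet_ball] at ht
  filter_upwards [ht, hg.ae_differentiableAt] with x hx hd hxb
  refine ⟨hd, ?_, ?_⟩
  · rw [← hgf hxb]; exact (hx hxb).1
  · have e : (fun y => f y t) =ᶠ[𝓝 x] g := by
      filter_upwards [Metric.isOpen_ball.mem_nhds hxb] with y hy using hgf hy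
    have := (hx hxb).2
    rw [gradX, gradient, e.fderiv_eq] at this
    simpa using this

end ScalarNorm

section Frozen

lemma locallyLipschitz_sum {ι F : Type*} [NormedAddCommGroup F] [NormedSpace ℝ F] (S : Finset ι)
    {g : ι → E n → F} (h : ∀ i, LocallyLipschitz (g i)) :
    LocallyLipschitz fun x => ∑ i ∈ S, g i x := by
  classical
  induction S using Finset.induction_on with
  | empty => simpa using LocallyLipschitz.const (0 : F)
  | insert i S hi ih =>
    simp only [Finset.sum_insert hi]
    exact locallyLipschitz_add (h i) ih

/-- The scalar extensions are assembled component by component; passing from components to norms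
costs the factor n. -/
lemma ae_exists_vector_extension {b : E n → ℝ → E n}
    (hb : ∀ i, FiniteNorm fun x t => b x t i) {β : ℝ}
    (hβ : ∀ i, (scalarNorm fun x t => b x t i).toReal ≤ β) :
    ∀ᵐ t ∂(volume.restrict (Icc (0 : ℝ) 16)), ∃ g : E n → E n, LocallyLipschitz g ∧
      (∀ x ∈ Metric.ball (0 : E n) 4, g x = b x t) ∧
      ∀ᵐ x, x ∈ Metric.ball (0 : E n) 4 → DifferentiableAt ℝ g x ∧
        ‖g x‖ ≤ n * β ∧ ‖fderiv ℝ g x‖ ≤ n * β := by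
  have h := ae_all_iff.2 fun i => (hb i).ae_exists_extension
  filter_upwards [h] with t ht
  choose g hg hgb hgd using ht
  let e : Fin n → E n := fun i => EuclideanSpace.single i (1 : ℝ)
  have hcoord : ∀ x j, (∑ i, g i x • e i) j = g j x := fun x j => by
    simp [e, Finset.sum_apply, Pi.single_apply]
  refine ⟨fun x => ∑ i, g i x • e i, locallyLipschitz_sum _ fun i =>
    locallyLipschitz_smul (hg i) (LocallyLipschitz.const _), fun x hx => ?_, ?_⟩
  · ext j
    rw [hcoord, hgb j x hx]
  · filter_upwards [ae_all_iff.2 hgd] with x hx hxb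
    have hd : HasFDerivAt (fun x => ∑ i, g i x • e i)
        (∑ i, (fderiv ℝ (g i) x).smulRight (e i)) x :=
      HasFDerivAt.fun_sum fun i _ => (hx i hxb).1.hasFDerivAt.smul_const (e i)
    refine ⟨hd.differentiableAt, norm_le_card_mul fun j => ?_, ?_⟩
    · rw [hcoord]; exact (hx j hxb).2.1.trans (hβ j)
    · rw [hd.fderiv]
      calc ‖∑ i, (fderiv ℝ (g i) x).smulRight (e i)‖
          ≤ ∑ i, ‖(fderiv ℝ (g i) x).smulRight (e i)‖ := norm_sum_le _ _
        _ ≤ ∑ _i : Fin n, β := Finset.sum_le_sum fun i _ => by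
            rw [ContinuousLinearMap.norm_smulRight_apply]
            simpa [e] using (hx i hxb).2.2.trans (hβ i)
        _ = n * β := by simp

lemma scalarNorm_toReal_le {b : E n → ℝ → E n} (hb : ∀ i, FiniteNorm fun x t => b x t i)
    (i : Fin n) : (scalarNorm fun x t => b x t i).toReal ≤ (vectorNorm b).toReal := by
  refine ENNReal.toReal_mono ?_ (le_iSup (fun i => scalarNorm fun x t => b x t i) i)
  have : Nonempty (Fin n) := ⟨i⟩
  obtain ⟨j, hj⟩ := exists_eq_ciSup_of_finite (f := fun i => scalarNorm fun x t => b x t i)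
  rw [vectorNorm, ← hj]
  exact (hb j).2

/-- Freezing the coefficients at a generic time in `(0, a)`. -/
lemma exists_frozen {Λ M C α a : ℝ} {A : E n → ℝ → Matrix (Fin n) (Fin n) ℝ}
    {b : E n → ℝ → E n} {V : E n → ℝ → ℝ} (hA : IsAdmissible Λ M A) (hM : 0 ≤ M) (h0 : A 0 0 = 1)
    (hb : ∀ i, FiniteNorm fun x t => b x t i) (hV : FiniteNorm V) (hΛ : 1 ≤ Λ) (hα : 0 ≤ α)
    (hbα : (vectorNorm b).toReal ≤ α) (hVα : (scalarNorm V).toReal ≤ α ^ 2) (hCΛ : Λ ≤ C)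
    (hCn : (n : ℝ) ≤ C) (hCM : 1 + 4 * (n ^ 2 * M) ≤ C) (ha : 0 < a) (ha1 : a ≤ 16) :
    ∃ (b₀ : E n → E n) (V₀ : E n → ℝ), LocallyLipschitz b₀ ∧ LocallyLipschitz V₀ ∧
      (∀ᵐ x, x ∈ Metric.ball (0 : E n) 4 →
        PointBounds (fun y => matOp (A y 0)) b₀ V₀ C α x) ∧
      ∀ x ∈ Metric.ball (0 : E n) 4, ∀ t ∈ Icc (0 : ℝ) 16,
        ‖b x t - b₀ x‖ ≤ n * α * (t + a) ^ (1 / 2 : ℝ) ∧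
        |V x t - V₀ x| ≤ α ^ 2 * (t + a) ^ (1 / 2 : ℝ) := by
  have hC1 : 1 ≤ C := hΛ.trans hCΛ
  have hnM : 0 ≤ n ^ 2 * M := by positivity
  have hgen := (ae_exists_vector_extension hb (scalarNorm_toReal_le hb)).and
    hV.ae_exists_extension
  have hsub : Ioo 0 a ⊆ Icc (0 : ℝ) 16 := fun t ht => ⟨ht.1.le, ht.2.le.trans ha1⟩
  have hgen' := ae_restrict_of_ae_restrict_of_subset hsub hgen
  have : (ae (volume.restrict (Ioo 0 a))).NeBot := by
    rw [ae_restrict_neBot]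
    simp [ha]
  -- The interval (0,a) has positive measure, so it contains a good time. Choosing t₀ < a gives |t −
  -- t₀| ≤ t + a, so the freezing error is of size √s uniformly in t.
  obtain ⟨t₀, ⟨⟨b₀, hb1, hb2, hb3⟩, V₀, hV1, hV2, hV3⟩, ht₀⟩ :=
    (hgen'.and (ae_restrict_mem measurableSet_Ioo)).exists
  refine ⟨b₀, V₀, hb1, hV1, ?_, fun x hx t ht => ?_⟩
  · filter_upwards [hb3, hV3, (hA.lipschitz hM le_rfl).ae_differentiableAt] with x h1 h2 h3 hx
    have hx4 : ‖x‖ ≤ 4 := by simpa using (mem_ball_zero_iff.1 hx).le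
    have hone := hA.norm_sub_one_le hM h0 (x := x) le_rfl
    rw [Real.zero_rpow (by norm_num), add_zero] at hone
    have hnα : n * (vectorNorm b).toReal ≤ C * α :=
      mul_le_mul hCn hbα ENNReal.toReal_nonneg (by linarith)
    have hvα : (scalarNorm V).toReal ≤ C * α ^ 2 :=
      hVα.trans (le_mul_of_one_le_left (by positivity) hC1)
    refine ⟨hC1, hCn, hx4, h3, (h1 hx).1, (h2 hx).1, hA.inner_comm le_rfl, fun v => ?_, ?_, ?_, ?_,
      (h1 hx).2.1.trans hnα, (h1 hx).2.2.trans hnα, (h2 hx).2.1.trans hvα, (h2 hx).2.2.trans hvα⟩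
    · refine le_trans ?_ (hA.lower x 0 le_rfl v)
      have : C⁻¹ ≤ Λ⁻¹ := inv_anti₀ (by linarith) hCΛ
      gcongr
    · calc ‖matOp (A x 0)‖ = ‖1 + (matOp (A x 0) - 1)‖ := by congr 1; abel
        _ ≤ ‖(1 : E n →L[ℝ] E n)‖ + ‖matOp (A x 0) - 1‖ := norm_add_le _ _
        _ ≤ 1 + n ^ 2 * M * 4 := add_le_add ContinuousLinearMap.norm_id_le
            (hone.trans (mul_le_mul_of_nonneg_left hx4 hnM))
        _ ≤ C := by linarith
    · exact hone.trans (mul_le_mul_of_nonneg_right (by linarith) (norm_nonneg _))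
    · exact (hA.norm_fderiv_le hM le_rfl x).trans (by linarith)
  · have hd : |t - t₀| ^ (1 / 2 : ℝ) ≤ (t + a) ^ (1 / 2 : ℝ) := by
      refine Real.rpow_le_rpow (abs_nonneg _) (abs_le.2 ⟨?_, ?_⟩) (by norm_num)
      · linarith [ht.1, ht₀.2]
      · linarith [ht₀.1]
    have hp : 0 ≤ (t + a) ^ (1 / 2 : ℝ) := Real.rpow_nonneg (by linarith [ht.1]) _
    constructor
    · calc ‖b x t - b₀ x‖ ≤ n * (α * (t + a) ^ (1 / 2 : ℝ)) := by
            refine norm_le_card_mul fun i => ?_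
            rw [hb2 x hx]
            refine ((hb i).abs_sub_le hx ht (hsub ht₀)).trans ?_
            exact mul_le_mul ((scalarNorm_toReal_le hb i).trans hbα) hd
              (Real.rpow_nonneg (abs_nonneg _) _) hα
        _ = _ := by ring
    · rw [hV2 x hx]
      refine (hV.abs_sub_le hx ht (hsub ht₀)).trans ?_
      exact mul_le_mul hVα hd (Real.rpow_nonneg (abs_nonneg _) _) (by positivity)

end Frozen

end ParabolicCarleman

/-! ### The error made by freezing the coefficients. -/

namespace ParabolicCarleman
variable {n : ℕ}

section Comparison
variable {A A₁ : E n → E n →L[ℝ] E n} {b : E n → E n} {V : E n → ℝ} {f q : E n → ℝ} {x : E n}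

/-- The halves of F cancel, and by symmetry of A the drift Ax/(2s) undoes the Gaussian term of
`symPart`. So the splitting recombines to the unweighted operator, with zeroth order term k + V. -/
lemma antiPart_add_symPart {s k : ℝ} (hs : 0 < s)
    (hsymm : ∀ u v, inner ℝ (A x u) v = inner ℝ u (A x v)) :
    antiPart A b s f q x + symPart A s f x + (k + (V x - potF A b s x / 2)) * f x
      = q x + k * f x + tr (fderiv ℝ (flux A f) x) + inner ℝ (b x) (gradient f x) + V x * f x := by
  have h : inner ℝ x (flux A f x) = inner ℝ (A x x) (gradient f x) := (hsymm _ _).symm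
  rw [antiPart, symPart, divG, drift, inner_add_left, inner_smul_left, h]
  simp only [conj_trivial]
  field_simp
  ring

lemma norm_hess_single_le (f : E n → ℝ) (x : E n) (i : Fin n) :
    ‖hess f x (EuclideanSpace.single i (1 : ℝ))‖ ≤ Real.sqrt (hessSq f x) := by
  refine Real.le_sqrt_of_sq_le ?_
  simpa using norm_hess_apply_sq_le f x (EuclideanSpace.single i (1 : ℝ))

/-- Where A₁ − A multiplies the Hessian it supplies the small factor r. The derivatives of A₁ and A
are merely bounded and not close to each other, hence 2‖∇f‖ without r. -/
lemma abs_tr_fderiv_flux_sub_le {c r : ℝ} (hf : ContDiff ℝ ∞ f) (hA : DifferentiableAt ℝ A x)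
    (hA₁ : DifferentiableAt ℝ A₁ x) (hd : ‖A₁ x - A x‖ ≤ c * r) (h0 : ‖fderiv ℝ A x‖ ≤ c)
    (h1 : ‖fderiv ℝ A₁ x‖ ≤ c) :
    |tr (fderiv ℝ (flux A₁ f) x) - tr (fderiv ℝ (flux A f) x)|
      ≤ n * c * (2 * ‖gradient f x‖ + r * Real.sqrt (hessSq f x)) := by
  obtain ⟨-, e0⟩ := hasFDerivAt_flux hA hf
  obtain ⟨-, e1⟩ := hasFDerivAt_flux hA₁ hf
  rw [tr, tr, ← Finset.sum_sub_distrib]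
  refine (Finset.abs_sum_le_sum_abs _ _).trans ?_
  have hi : ∀ i ∈ (Finset.univ : Finset (Fin n)),
      |fderiv ℝ (flux A₁ f) x (EuclideanSpace.single i 1) i
        - fderiv ℝ (flux A f) x (EuclideanSpace.single i 1) i|
      ≤ c * (2 * ‖gradient f x‖ + r * Real.sqrt (hessSq f x)) := by
    intro i _
    set e : E n := EuclideanSpace.single i (1 : ℝ) with he
    have hne : ‖e‖ = 1 := by simp [he]
    rw [← PiLp.sub_apply, e0, e1]
    refine (abs_apply_le_norm _ i).trans ?_
    have e2 : fderiv ℝ A₁ x e (gradient f x) + A₁ x (hess f x e)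
        - (fderiv ℝ A x e (gradient f x) + A x (hess f x e))
        = fderiv ℝ A₁ x e (gradient f x) - fderiv ℝ A x e (gradient f x)
          + (A₁ x - A x) (hess f x e) := by
      rw [sub_apply]; abel
    rw [e2]
    have b0 : ‖fderiv ℝ A x e (gradient f x)‖ ≤ c * ‖gradient f x‖ := by
      have := ContinuousLinearMap.le_of_opNorm_le _ (ContinuousLinearMap.le_of_opNorm_le _ h0 e)
        (gradient f x)
      rwa [hne, mul_one] at this
    have b1 : ‖fderiv ℝ A₁ x e (gradient f x)‖ ≤ c * ‖gradient f x‖ := by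
      have := ContinuousLinearMap.le_of_opNorm_le _ (ContinuousLinearMap.le_of_opNorm_le _ h1 e)
        (gradient f x)
      rwa [hne, mul_one] at this
    have b2 : ‖(A₁ x - A x) (hess f x e)‖ ≤ c * r * Real.sqrt (hessSq f x) :=
      (ContinuousLinearMap.le_of_opNorm_le _ hd _).trans
        (mul_le_mul_of_nonneg_left (norm_hess_single_le f x i) ((norm_nonneg _).trans hd))
    calc _ ≤ c * ‖gradient f x‖ + c * ‖gradient f x‖ + c * r * Real.sqrt (hessSq f x) :=
          (norm_add_le _ _).trans (add_le_add ((norm_sub_le _ _).trans (add_le_add b1 b0)) b2)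
      _ = _ := by ring
  refine (Finset.sum_le_sum hi).trans_eq ?_
  simp
  ring

/-- For r = √s this is the perturbation allowed in the pointwise Carleman inequality. The 16 is 4,
from the square of a sum of four terms, times the square of the 2 in 2‖∇f‖. -/
lemma operator_error_sq_le {c r α : ℝ} {b₀ b₁ : E n} {V₀ V₁ : ℝ} (hn : 1 ≤ n) (hα : 0 ≤ α)
    (hr : 0 ≤ r) (hf : ContDiff ℝ ∞ f)
    (hA : DifferentiableAt ℝ A x) (hA₁ : DifferentiableAt ℝ A₁ x) (hd : ‖A₁ x - A x‖ ≤ c * r)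
    (h0 : ‖fderiv ℝ A x‖ ≤ c) (h1 : ‖fderiv ℝ A₁ x‖ ≤ c) (hb : ‖b₁ - b₀‖ ≤ c * α * r)
    (hV : |V₁ - V₀| ≤ c * α ^ 2 * r) :
    ((tr (fderiv ℝ (flux A₁ f) x) - tr (fderiv ℝ (flux A f) x))
        + inner ℝ (b₁ - b₀) (gradient f x) + (V₁ - V₀) * f x) ^ 2
      ≤ 16 * (n * c) ^ 2 * (r ^ 2 * hessSq f x + (1 + α ^ 2 * r ^ 2) * ‖gradient f x‖ ^ 2
        + α ^ 4 * r ^ 2 * f x ^ 2) := by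
  have hc : 0 ≤ c := (norm_nonneg (fderiv ℝ A x)).trans h0
  have t1 := abs_tr_fderiv_flux_sub_le hf hA hA₁ hd h0 h1
  set D := tr (fderiv ℝ (flux A₁ f) x) - tr (fderiv ℝ (flux A f) x)
  set u := ‖gradient f x‖ with hu
  have hu0 : 0 ≤ u := norm_nonneg _
  set h := Real.sqrt (hessSq f x) with hh
  have hh0 : 0 ≤ h := Real.sqrt_nonneg _
  have hh2 : hessSq f x = h ^ 2 := (Real.sq_sqrt (hessSq_nonneg f x)).symm
  have hn1 : (1 : ℝ) ≤ n := by exact_mod_cast hn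
  have hcn : c ≤ n * c := le_mul_of_one_le_left hc hn1
  have t2 : |inner ℝ (b₁ - b₀) (gradient f x)| ≤ n * c * (α * r * u) := by
    refine (abs_inner_le _ _ hb le_rfl).trans ?_
    rw [← hu]
    calc c * α * r * u = c * (α * r * u) := by ring
      _ ≤ _ := by gcongr
  have t3 : |(V₁ - V₀) * f x| ≤ n * c * (α ^ 2 * r * |f x|) := by
    rw [abs_mul]
    calc |V₁ - V₀| * |f x| ≤ c * α ^ 2 * r * |f x| := by gcongr
      _ = c * (α ^ 2 * r * |f x|) := by ring
      _ ≤ _ := by gcongr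
  have t4 : |D + inner ℝ (b₁ - b₀) (gradient f x) + (V₁ - V₀) * f x|
      ≤ n * c * (2 * u + r * h + α * r * u + α ^ 2 * r * |f x|) := by
    refine (abs_add_le _ _).trans ?_
    have := abs_add_le D (inner ℝ (b₁ - b₀) (gradient f x))
    linarith
  have t5 : (2 * u + r * h + α * r * u + α ^ 2 * r * |f x|) ^ 2
      ≤ 16 * (r ^ 2 * h ^ 2 + (1 + α ^ 2 * r ^ 2) * u ^ 2 + α ^ 4 * r ^ 2 * f x ^ 2) := by
    have e : f x ^ 2 = |f x| ^ 2 := (sq_abs _).symm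
    rw [e]
    generalize |f x| = g
    have key : ∀ p q t w : ℝ, (p + q + t + w) ^ 2 ≤ 4 * (p ^ 2 + q ^ 2 + t ^ 2 + w ^ 2) := by
      intro p q t w
      nlinarith [sq_nonneg (p - q), sq_nonneg (p - t), sq_nonneg (p - w), sq_nonneg (q - t),
        sq_nonneg (q - w), sq_nonneg (t - w)]
    have k1 := key (2 * u) (r * h) (α * r * u) (α ^ 2 * r * g)
    have z1 : 0 ≤ (r * h) ^ 2 := by positivity
    have z2 : 0 ≤ (α * r * u) ^ 2 := by positivity
    have z3 : 0 ≤ (α ^ 2 * r * g) ^ 2 := by positivity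
    linarith
  rw [hh2]
  calc _ = |D + inner ℝ (b₁ - b₀) (gradient f x) + (V₁ - V₀) * f x| ^ 2 := (sq_abs _).symm
    _ ≤ (n * c * (2 * u + r * h + α * r * u + α ^ 2 * r * |f x|)) ^ 2 := by gcongr
    _ = (n * c) ^ 2 * (2 * u + r * h + α * r * u + α ^ 2 * r * |f x|) ^ 2 := by ring
    _ ≤ (n * c) ^ 2 * (16 * (r ^ 2 * h ^ 2 + (1 + α ^ 2 * r ^ 2) * u ^ 2
        + α ^ 4 * r ^ 2 * f x ^ 2)) := by gcongr
    _ = _ := by ring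

end Comparison

end ParabolicCarleman

/-! ### Smoothness up to the initial time. -/

namespace ParabolicCarleman
variable {n : ℕ}

section Jets
variable {H : Type*} [NormedAddCommGroup H] [NormedSpace ℝ H]

/-- The closed half space-time `t ≥ 0`. -/
def halfSpace (n : ℕ) : Set (E n × ℝ) := univ ×ˢ Ici (0 : ℝ)

/-- Smoothness up to the initial time. -/
def SmoothHalf (F : E n → ℝ → H) : Prop :=
  ContDiffOn ℝ ∞ (fun p : E n × ℝ => F p.1 p.2) (halfSpace n)

/-- The time derivative, one-sided at the initial time. -/
noncomputable def timeDeriv (F : E n → ℝ → H) (x : E n) (t : ℝ) : H :=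
  fderivWithin ℝ (fun p : E n × ℝ => F p.1 p.2) (halfSpace n) (x, t) (0, 1)

lemma uniqueDiffOn_halfSpace : UniqueDiffOn ℝ (halfSpace n) :=
  uniqueDiffOn_univ.prod (uniqueDiffOn_Ici 0)

variable {F : E n → ℝ → H} {x : E n} {t : ℝ}

lemma SmoothHalf.hasFDerivWithinAt (hF : SmoothHalf F) (ht : 0 ≤ t) :
    HasFDerivWithinAt (fun p : E n × ℝ => F p.1 p.2)
      (fderivWithin ℝ (fun p : E n × ℝ => F p.1 p.2) (halfSpace n) (x, t)) (halfSpace n) (x, t) :=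
  (hF.differentiableOn (by simp) (x, t) ⟨mem_univ _, ht⟩).hasFDerivWithinAt

lemma SmoothHalf.contDiffOn_fderivWithin (hF : SmoothHalf F) :
    ContDiffOn ℝ ∞ (fderivWithin ℝ (fun p : E n × ℝ => F p.1 p.2) (halfSpace n)) (halfSpace n) :=
  hF.fderivWithin uniqueDiffOn_halfSpace (by simp)

lemma SmoothHalf.contDiff_slice (hF : SmoothHalf F) (ht : 0 ≤ t) :
    ContDiff ℝ ∞ fun x => F x t := by
  have h : ContDiff ℝ ∞ fun x : E n => (x, t) := contDiff_id.prodMk contDiff_const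
  exact contDiffOn_univ.1 (ContDiffOn.comp hF h.contDiffOn fun _ _ => ⟨mem_univ _, ht⟩)

lemma HasFDerivWithinAt.slice {D : E n × ℝ → H} {D' : E n × ℝ →L[ℝ] H}
    (hF : HasFDerivWithinAt D D' (halfSpace n) (x, t)) (ht : 0 ≤ t) :
    HasFDerivAt (fun y => D (y, t)) (D'.comp (ContinuousLinearMap.inl ℝ (E n) ℝ)) x :=
  hasFDerivWithinAt_univ.1 (HasFDerivWithinAt.comp (s := univ) (t := halfSpace n) x hF
    (hasFDerivAt_prodMk_left x t).hasFDerivWithinAt fun _ _ => ⟨mem_univ _, ht⟩)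

lemma HasFDerivWithinAt.timeLine {D : E n × ℝ → H} {D' : E n × ℝ →L[ℝ] H}
    (hF : HasFDerivWithinAt D D' (halfSpace n) (x, t)) (ht : 0 < t) :
    HasDerivAt (fun τ => D (x, τ)) (D' (0, 1)) t := by
  have h1 : halfSpace n ∈ 𝓝 (x, t) := prod_mem_nhds Filter.univ_mem (Ici_mem_nhds ht)
  have h2 := (hF.hasFDerivAt h1).comp t (hasFDerivAt_prodMk_right x t)
  have h3 := h2.hasDerivAt
  simp only [ContinuousLinearMap.comp_apply, ContinuousLinearMap.inr_apply] at h3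
  exact h3

lemma SmoothHalf.fderiv_slice_eq (hF : SmoothHalf F) (ht : 0 ≤ t) :
    fderiv ℝ (fun y => F y t) x =
      (fderivWithin ℝ (fun p : E n × ℝ => F p.1 p.2) (halfSpace n) (x, t)).comp
        (ContinuousLinearMap.inl ℝ (E n) ℝ) :=
  (HasFDerivWithinAt.slice (hF.hasFDerivWithinAt ht) ht).fderiv

lemma SmoothHalf.clm {H' : Type*} [NormedAddCommGroup H'] [NormedSpace ℝ H'] (hF : SmoothHalf F)
    (T : H →L[ℝ] H') : SmoothHalf fun x t => T (F x t) :=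
  T.contDiff.comp_contDiffOn hF

lemma SmoothHalf.fderiv_slice (hF : SmoothHalf F) :
    SmoothHalf fun x t => fderiv ℝ (fun y => F y t) x := by
  have h : ContDiffOn ℝ ∞ (fun p =>
      (ContinuousLinearMap.compL ℝ (E n) (E n × ℝ) H).flip (ContinuousLinearMap.inl ℝ (E n) ℝ)
      (fderivWithin ℝ (fun p : E n × ℝ => F p.1 p.2) (halfSpace n) p)) (halfSpace n) :=
    (ContinuousLinearMap.contDiff _).comp_contDiffOn hF.contDiffOn_fderivWithin
  refine h.congr fun p hp => ?_
  exact hF.fderiv_slice_eq hp.2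

lemma SmoothHalf.timeDeriv (hF : SmoothHalf F) : SmoothHalf (timeDeriv F) :=
  (ContinuousLinearMap.apply ℝ H ((0, 1) : E n × ℝ)).contDiff.comp_contDiffOn
    hF.contDiffOn_fderivWithin

lemma SmoothHalf.hasDerivAt (hF : SmoothHalf F) (ht : 0 < t) :
    HasDerivAt (fun τ => F x τ) (ParabolicCarleman.timeDeriv F x t) t :=
  HasFDerivWithinAt.timeLine (hF.hasFDerivWithinAt ht.le) ht

/-- Exchange of the time and space derivatives: the second derivative within the half space is
symmetric because each of its points with t > 0 is interior. -/
lemma SmoothHalf.hasDerivAt_fderiv (hF : SmoothHalf F) (ht : 0 < t) :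
    HasDerivAt (fun τ => fderiv ℝ (fun y => F y τ) x)
      (fderiv ℝ (fun y => ParabolicCarleman.timeDeriv F y t) x) t := by
  have hmem : (x, t) ∈ halfSpace n := ⟨mem_univ _, ht.le⟩
  have h2 := (hF.contDiffOn_fderivWithin.differentiableOn (by simp) _ hmem).hasFDerivWithinAt
  have hint : (x, t) ∈ closure (interior (halfSpace n)) := by
    refine subset_closure (mem_interior_iff_mem_nhds.2 ?_)
    exact prod_mem_nhds Filter.univ_mem (Ici_mem_nhds ht)
  have hsymm := (hF (x, t) hmem).isSymmSndFDerivWithinAt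
    (by rw [minSmoothness_of_isRCLikeNormedField]; exact WithTop.coe_le_coe.2 le_top)
    uniqueDiffOn_halfSpace hint hmem
  set D := fderivWithin ℝ (fun p : E n × ℝ => F p.1 p.2) (halfSpace n)
  set D₂ := fderivWithin ℝ D (halfSpace n) (x, t)
  have h3 := HasFDerivWithinAt.timeLine h2 ht
  have h4 := ((ContinuousLinearMap.compL ℝ (E n) (E n × ℝ) H).flip
    (ContinuousLinearMap.inl ℝ (E n) ℝ)).hasFDerivAt.comp_hasDerivAt t h3
  have h5 := (ContinuousLinearMap.apply ℝ H ((0, 1) : E n × ℝ)).hasFDerivAt.comp x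
    (HasFDerivWithinAt.slice h2 ht.le)
  have h6 : fderiv ℝ (fun y => ParabolicCarleman.timeDeriv F y t) x
      = (D₂ (0, 1)).comp (ContinuousLinearMap.inl ℝ (E n) ℝ) := by
    refine HasFDerivAt.fderiv (h5.congr_fderiv ?_)
    ext v
    exact hsymm (v, 0) (0, 1)
  rw [h6]
  refine h4.congr_of_eventuallyEq ?_
  filter_upwards [lt_mem_nhds ht] with τ hτ
  exact hF.fderiv_slice_eq hτ.le

lemma SmoothHalf.continuousOn (hF : SmoothHalf F) :
    ContinuousOn (fun p : E n × ℝ => F p.1 p.2) (halfSpace n) :=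
  ContDiffOn.continuousOn hF

/-- The Riesz isomorphism from covectors to gradients. -/
noncomputable def rieszL (n : ℕ) : (E n →L[ℝ] ℝ) →L[ℝ] E n :=
  ∑ i, (ContinuousLinearMap.apply ℝ ℝ (EuclideanSpace.single i (1 : ℝ))).smulRight
    (EuclideanSpace.single i (1 : ℝ))

lemma gradient_eq_rieszL (f : E n → ℝ) (x : E n) : gradient f x = rieszL n (fderiv ℝ f x) := by
  ext i
  have h : inner ℝ (gradient f x) (EuclideanSpace.single i (1 : ℝ))
      = fderiv ℝ f x (EuclideanSpace.single i 1) := by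
    simp [gradient]
  rw [real_inner_comm, inner_single_left] at h
  simp [rieszL, h, Finset.sum_apply, Pi.single_apply]

variable {w : E n → ℝ → ℝ}

lemma SmoothHalf.gradX (hw : SmoothHalf w) : SmoothHalf (gradX w) := by
  have := hw.fderiv_slice.clm (rieszL n)
  simp only [← gradient_eq_rieszL] at this
  exact this

lemma SmoothHalf.hasDerivAt_gradX (hw : SmoothHalf w) (ht : 0 < t) :
    HasDerivAt (fun τ => ParabolicCarleman.gradX w x τ)
      (ParabolicCarleman.gradX (ParabolicCarleman.timeDeriv w) x t) t := by
  have := (rieszL n).hasFDerivAt.comp_hasDerivAt t (hw.hasDerivAt_fderiv (x := x) ht)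
  have e : (fun τ => ParabolicCarleman.gradX w x τ)
      = (rieszL n) ∘ fun τ => fderiv ℝ (fun y => w y τ) x := by
    funext τ; exact gradient_eq_rieszL _ _
  rw [e, ParabolicCarleman.gradX, gradient_eq_rieszL]
  exact this

end Jets

end ParabolicCarleman

/-! ### Time derivatives of the weights and of the energy density. -/

namespace ParabolicCarleman
variable {n : ℕ}

section TimeCalculus

/-- The weight `σ / σ'`. -/
noncomputable def rhoFun (lam s : ℝ) : ℝ := s / gam lam s

/-- The derivative of `theta (lam s)` in `s`. -/
noncomputable def thetaRate (lam s : ℝ) : ℝ :=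
  theta (lam * s) / s * (1 / 2 - 3 / (2 * Real.log (1 / (lam * s))))

lemma gam_pos (lam s : ℝ) : 0 < gam lam s := Real.exp_pos _

variable {lam s : ℝ}

/-- The factor γ in the denominator decreases at the logarithmic rate −θ/s. The resulting excess θ
over the homogeneous rate is the only source of positivity in the commutator. -/
lemma hasDerivAt_rhoFun (hl : 0 < lam) (hs : 0 < s) (h : lam * s ≤ 1) :
    HasDerivAt (rhoFun lam) (rhoFun lam s / s * (1 + theta (lam * s))) s := by
  have hg := gam_pos lam s
  refine ((hasDerivAt_id s).div (hasDerivAt_gam hl hs h) hg.ne').congr_deriv ?_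
  simp only [rhoFun, id]
  field_simp
  ring

lemma hasDerivAt_gaussG_time (hs : 0 < s) (x : E n) :
    HasDerivAt (fun τ => gaussG x τ) (gaussG x s * (-n / (2 * s) + ‖x‖ ^ 2 / (4 * s ^ 2))) s := by
  have h1 : HasDerivAt (fun τ : ℝ => τ ^ (-(n : ℝ) / 2)) (-(n : ℝ) / 2 * s ^ (-(n : ℝ) / 2 - 1)) s :=
    Real.hasDerivAt_rpow_const (Or.inl hs.ne')
  have h2 : HasDerivAt (fun τ : ℝ => -‖x‖ ^ 2 / (4 * τ)) (‖x‖ ^ 2 / (4 * s ^ 2)) s := by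
    have h3 : HasDerivAt (fun τ : ℝ => 4 * τ) 4 s := by simpa using (hasDerivAt_id s).const_mul 4
    refine ((hasDerivAt_const s (-‖x‖ ^ 2)).div h3 (by positivity)).congr_deriv ?_
    field_simp
    ring
  have h3 : HasDerivAt (fun τ => gaussG x τ) _ s := h1.mul h2.exp
  refine h3.congr_deriv ?_
  rw [gaussG, Real.rpow_sub hs, Real.rpow_one]
  field_simp

variable {A : E n → E n →L[ℝ] E n} {b : E n → E n} {V : E n → ℝ} {x : E n}

lemma hasDerivAt_potF (hs : 0 < s) :
    HasDerivAt (fun τ => potF A b τ x) (potFt A b s x) s := by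
  have h1 : HasDerivAt (fun τ => potP A b x / τ + potQ A x / τ ^ 2) _ s :=
    ((hasDerivAt_const s (potP A b x)).div (hasDerivAt_id s) hs.ne').add
      ((hasDerivAt_const s (potQ A x)).div (hasDerivAt_pow 2 s) (by positivity))
  refine h1.congr_deriv ?_
  simp only [potFt, id]
  field_simp
  ring

/-- The time derivative of the weighted boundary density. -/
lemma hasDerivAt_density {a t α : ℝ} {φ : ℝ → E n → ℝ} {q : E n → ℝ}
    (hl : 0 < lam) (hs : 0 < t + a) (h : lam * (t + a) ≤ 1 / 2)
    (hsymm : ∀ u v, inner ℝ (A x u) v = inner ℝ u (A x v))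
    (hφ : HasDerivAt (fun τ => φ τ x) (q x) t)
    (hp : HasDerivAt (fun τ => gradient (φ τ) x) (gradient q x) t) :
    HasDerivAt (fun τ => gaussG x (τ + a) * density A b V (τ + a) (φ τ) (rhoFun lam (τ + a))
        (α + theta (lam * (τ + a)) / 4) x)
      (gaussG x (t + a) * carlemanDensityDeriv A b V α (t + a) (φ t) q (rhoFun lam (t + a))
        (theta (lam * (t + a))) (thetaRate lam (t + a) / 4) x) t := by
  have hG := (hasDerivAt_gaussG_time (n := n) hs x).comp_add_const t a
  have hρ := (hasDerivAt_rhoFun hl hs (by linarith)).comp_add_const t a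
  have hθ : HasDerivAt (fun τ => theta (lam * (τ + a))) (thetaRate lam (t + a)) t :=
    (hasDerivAt_theta_mul hl hs h).comp_add_const t a
  have hF := (hasDerivAt_potF (A := A) (b := b) (x := x) hs).comp_add_const t a
  have hX : HasDerivAt (fun τ => A x (gradient (φ τ) x)) (A x (gradient q x)) t :=
    (A x).hasFDerivAt.comp_hasDerivAt t hp
  have h1 := hX.inner ℝ hp
  have h2 := ((hF.mul_const (1 / 2)).const_sub (V x))
  have h3 := (hθ.mul_const (1 / 4)).const_add α
  have h4 : HasDerivAt (fun τ => gaussG x (τ + a) * (rhoFun lam (τ + a)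
      * inner ℝ (A x (gradient (φ τ) x)) (gradient (φ τ) x)
      - (α + theta (lam * (τ + a)) * (1 / 4) + rhoFun lam (τ + a)
        * (V x - potF A b (τ + a) x * (1 / 2))) * (φ τ x * φ τ x))) _ t :=
    hG.mul ((hρ.mul h1).sub ((h3.add (hρ.mul h2)).mul (hφ.mul hφ)))
  have e : (fun τ => gaussG x (τ + a) * density A b V (τ + a) (φ τ) (rhoFun lam (τ + a))
        (α + theta (lam * (τ + a)) / 4) x) = fun τ => gaussG x (τ + a) * (rhoFun lam (τ + a)
      * inner ℝ (A x (gradient (φ τ) x)) (gradient (φ τ) x)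
      - (α + theta (lam * (τ + a)) * (1 / 4) + rhoFun lam (τ + a)
        * (V x - potF A b (τ + a) x * (1 / 2))) * (φ τ x * φ τ x)) := by
    funext τ
    simp only [density, flux]
    ring
  rw [e]
  refine h4.congr_deriv ?_
  have e1 : inner ℝ (A x (gradient q x)) (gradient (φ t) x)
      = inner ℝ (A x (gradient (φ t) x)) (gradient q x) := by
    rw [hsymm, real_inner_comm]
  simp only [carlemanDensityDeriv, densityDeriv, density, flux, e1, Pi.mul_apply, Pi.add_apply]
  ring

end TimeCalculus

end ParabolicCarleman

/-! ### Supports, the conjugated function, and continuity on the time slab. -/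

namespace ParabolicCarleman
variable {n : ℕ}

section Vanishing
variable {H : Type*} [NormedAddCommGroup H] [NormedSpace ℝ H]

/-- A function of space-time that vanishes outside `K` at nonnegative times. -/
def VanishOff (K : Set (E n × ℝ)) (F : E n → ℝ → H) : Prop :=
  ∀ x t, 0 ≤ t → (x, t) ∉ K → F x t = 0

variable {K : Set (E n × ℝ)}

lemma VanishOff.timeDeriv {F : E n → ℝ → H} (hF : VanishOff K F) (hK : IsClosed K) :
    VanishOff K (timeDeriv F) := fun x t ht hx => by
  have h1 : (fun p : E n × ℝ => F p.1 p.2) =ᶠ[𝓝[halfSpace n] (x, t)] fun _ => 0 := by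
    filter_upwards [self_mem_nhdsWithin, mem_nhdsWithin_of_mem_nhds (hK.isOpen_compl.mem_nhds hx)]
      with p hp hp'
    exact hF _ _ hp.2 hp'
  rw [ParabolicCarleman.timeDeriv, h1.fderivWithin_eq (hF x t ht hx)]
  simp

lemma VanishOff.eventuallyEq {H : Type*} [NormedAddCommGroup H] {F : E n → ℝ → H} (hF : VanishOff K F) (hK : IsClosed K) {x : E n}
    {t : ℝ} (ht : 0 ≤ t) (hx : (x, t) ∉ K) : (fun y => F y t) =ᶠ[𝓝 x] fun _ => 0 := by
  have h1 : Continuous fun y : E n => (y, t) := by fun_prop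
  filter_upwards [(hK.isOpen_compl.preimage h1).mem_nhds hx] with y hy
  exact hF y t ht hy

lemma VanishOff.gradX {w : E n → ℝ → ℝ} (hw : VanishOff K w) (hK : IsClosed K) :
    VanishOff K (gradX w) := fun x t ht hx => by
  rw [ParabolicCarleman.gradX, gradient, (hw.eventuallyEq hK ht hx).fderiv_eq]
  simp

lemma VanishOff.fderiv {F : E n → ℝ → H} (hF : VanishOff K F) (hK : IsClosed K) :
    VanishOff K (fun x t => fderiv ℝ (fun y => F y t) x) := fun x t ht hx => by
  simp [(hF.eventuallyEq hK ht hx).fderiv_eq]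

end Vanishing

section Conjugation
variable (lam α a : ℝ) (w : E n → ℝ → ℝ)

/-- The conjugating weight. -/
noncomputable def conjWeight (t : ℝ) : ℝ := sigma lam (t + a) ^ (-α)

/-- The conjugated function. -/
noncomputable def conjFun (t : ℝ) (x : E n) : ℝ := conjWeight lam α a t * w x t

/-- The time derivative of the conjugated function. -/
noncomputable def conjDot (t : ℝ) (x : E n) : ℝ :=
  conjWeight lam α a t * (timeDeriv w x t - α * gam lam (t + a) / (t + a) * w x t)

variable {lam α a w} {t : ℝ}

lemma gradient_const_mul_fun {f : E n → ℝ} {x : E n} (c : ℝ) (hf : DifferentiableAt ℝ f x) :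
    gradient (fun y => c * f y) x = c • gradient f x := by
  rw [gradient_eq_rieszL, gradient_eq_rieszL, (hf.hasFDerivAt.const_mul c).fderiv, map_smul]

lemma gradient_sub_fun {f g : E n → ℝ} {x : E n} (hf : DifferentiableAt ℝ f x)
    (hg : DifferentiableAt ℝ g x) :
    gradient (fun y => f y - g y) x = gradient f x - gradient g x := by
  rw [gradient_eq_rieszL, gradient_eq_rieszL, gradient_eq_rieszL,
    (hf.hasFDerivAt.fun_sub hg.hasFDerivAt).fderiv, map_sub]

lemma gradient_conjFun (hw : SmoothHalf w) (ht : 0 ≤ t) (x : E n) :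
    gradient (conjFun lam α a w t) x = conjWeight lam α a t • gradX w x t :=
  gradient_const_mul_fun _ ((hw.contDiff_slice ht).differentiable (by simp) x)

lemma gradient_conjDot (hw : SmoothHalf w) (ht : 0 ≤ t) (x : E n) :
    gradient (conjDot lam α a w t) x = conjWeight lam α a t • (gradX (timeDeriv w) x t
      - (α * gam lam (t + a) / (t + a)) • gradX w x t) := by
  have h1 := (hw.contDiff_slice ht).differentiable (by simp) x
  have h2 := (hw.timeDeriv.contDiff_slice ht).differentiable (by simp) x
  have h3 := gradient_const_mul_fun (conjWeight lam α a t)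
    (h2.fun_sub (h1.const_mul (α * gam lam (t + a) / (t + a))))
  have h4 := gradient_sub_fun h2 (h1.const_mul (α * gam lam (t + a) / (t + a)))
  rw [gradient_const_mul_fun _ h1] at h4
  rw [h4] at h3
  exact h3

lemma contDiff_conjFun (hw : SmoothHalf w) (ht : 0 ≤ t) :
    ContDiff ℝ ∞ (conjFun lam α a w t) :=
  contDiff_const.mul (hw.contDiff_slice ht)

lemma contDiff_conjDot (hw : SmoothHalf w) (ht : 0 ≤ t) :
    ContDiff ℝ ∞ (conjDot lam α a w t) :=
  contDiff_const.mul ((hw.timeDeriv.contDiff_slice ht).sub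
    (contDiff_const.mul (hw.contDiff_slice ht)))

lemma hasDerivAt_conjWeight (hl : 0 < lam) (hs : 0 < t + a) (h : lam * (t + a) ≤ 1 / 2) :
    HasDerivAt (conjWeight lam α a)
      (-(α * gam lam (t + a) / (t + a)) * conjWeight lam α a t) t := by
  have hσ := sigma_pos (lam := lam) hs
  have h1 := ((hasDerivAt_sigma hl hs (by linarith)).comp_add_const t a).rpow_const (p := -α)
    (Or.inl hσ.ne')
  have h2 : HasDerivAt (conjWeight lam α a) _ t := h1
  refine h2.congr_deriv ?_
  rw [Real.rpow_sub_one hσ.ne', conjWeight]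
  field_simp

lemma hasDerivAt_conjFun (hw : SmoothHalf w) (hl : 0 < lam) (ha : 0 < a) (ht : 0 < t)
    (h : lam * (t + a) ≤ 1 / 2) (x : E n) :
    HasDerivAt (fun τ => conjFun lam α a w τ x) (conjDot lam α a w t x) t := by
  refine ((hasDerivAt_conjWeight hl (by positivity) h).mul (hw.hasDerivAt ht)).congr_deriv ?_
  rw [conjDot]
  ring

lemma hasDerivAt_gradient_conjFun (hw : SmoothHalf w) (hl : 0 < lam) (ha : 0 < a) (ht : 0 < t)
    (h : lam * (t + a) ≤ 1 / 2) (x : E n) :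
    HasDerivAt (fun τ => gradient (conjFun lam α a w τ) x)
      (gradient (conjDot lam α a w t) x) t := by
  have h1 := (hasDerivAt_conjWeight (α := α) hl (by positivity) h).smul
    (hw.hasDerivAt_gradX (x := x) ht)
  rw [gradient_conjDot hw ht.le]
  refine (h1.congr_deriv ?_).congr_of_eventuallyEq ?_
  · rw [smul_sub, smul_smul, neg_mul, neg_smul, mul_comm (conjWeight lam α a t), sub_eq_add_neg]
  · filter_upwards [lt_mem_nhds ht] with τ hτ
    exact gradient_conjFun hw hτ.le x

end Conjugation

section Continuity
variable {lam a T : ℝ}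

/-- The time slab. -/
def slab (n : ℕ) (T : ℝ) : Set (E n × ℝ) := univ ×ˢ Icc (0 : ℝ) T

lemma slab_subset_halfSpace : slab n T ⊆ halfSpace n := fun _ hp => ⟨hp.1, hp.2.1⟩

/-- The shift a > 0 keeps s = t + a away from the singularity at 0 even on the face t = 0, and `hT`
keeps λs in the range where the weights are controlled. -/
lemma continuousOn_slab_of_time {g : ℝ → ℝ} (hl : 0 < lam) (ha : 0 < a)
    (hT : lam * (T + a) ≤ 1 / 2)
    (hg : ∀ s, 0 < s → lam * s ≤ 1 / 2 → ContinuousAt g s) :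
    ContinuousOn (fun p : E n × ℝ => g (p.2 + a)) (slab n T) := fun p hp => by
  have h1 : ContinuousAt (fun p : E n × ℝ => p.2 + a) p := by fun_prop
  have hp2 : 0 ≤ p.2 ∧ p.2 ≤ T := hp.2
  have h3 : lam * (p.2 + a) ≤ 1 / 2 := by
    refine le_trans ?_ hT
    gcongr
    exact hp2.2
  exact (ContinuousAt.comp (g := g) (f := fun p : E n × ℝ => p.2 + a)
    (hg _ (by linarith [hp2.1]) h3) h1).continuousWithinAt

lemma continuousAt_thetaRate (hl : 0 < lam) {s : ℝ} (hs : 0 < s) (h : lam * s ≤ 1 / 2) :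
    ContinuousAt (thetaRate lam) s := by
  have h0 : 0 < lam * s := by positivity
  have h1 := (hasDerivAt_theta_mul hl hs h).continuousAt
  have hlog := log_inv_ge h0 h
  have h2 : ContinuousAt (fun s => Real.log (1 / (lam * s))) s := by
    refine ContinuousAt.log ?_ (by positivity)
    exact continuousAt_const.div (by fun_prop) h0.ne'
  exact (h1.div continuousAt_id hs.ne').mul (continuousAt_const.sub
    (continuousAt_const.div (continuousAt_const.mul h2) (by positivity)))

/-- The formula for the density derivative with every ingredient replaced by an abstract continuous
function, so that the weights need not be unfolded. -/
lemma continuousOn_densityDeriv_formula {U : Set (E n × ℝ)} {A : E n → E n →L[ℝ] E n}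
    {S R Th Mm F Q W Wt k : E n × ℝ → ℝ} {P P' : E n × ℝ → E n} (hA : Continuous A)
    (hS0 : ∀ p ∈ U, 0 < S p) (hS : ContinuousOn S U) (hR : ContinuousOn R U)
    (hTh : ContinuousOn Th U) (hM : ContinuousOn Mm U) (hF : ContinuousOn F U)
    (hQ : ContinuousOn Q U) (hW : ContinuousOn W U) (hWt : ContinuousOn Wt U)
    (hk : ContinuousOn k U) (hP : ContinuousOn P U) (hP' : ContinuousOn P' U) :
    ContinuousOn (fun p => R p / S p * (1 + Th p) * inner ℝ (A p.1 (P p)) (P p)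
      + 2 * R p * inner ℝ (A p.1 (P p)) (P' p)
      - (R p / S p * (1 + Th p) * W p - R p * Wt p + Mm p) * F p ^ 2
      - 2 * (k p + R p * W p) * F p * Q p
      + (R p * inner ℝ (A p.1 (P p)) (P p) - (k p + R p * W p) * F p ^ 2)
        * (-n / (2 * S p) + ‖p.1‖ ^ 2 / (4 * S p ^ 2))) U := by
  have hAP : ContinuousOn (fun p => A p.1 (P p)) U :=
    (hA.comp continuous_fst).continuousOn.clm_apply hP
  have h1 : ContinuousOn (fun p => (inner ℝ (A p.1 (P p)) (P p) : ℝ)) U := hAP.inner hP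
  have h2 : ContinuousOn (fun p => (inner ℝ (A p.1 (P p)) (P' p) : ℝ)) U := hAP.inner hP'
  have h3 : ContinuousOn (fun p => R p / S p) U := hR.div hS fun p hp => (hS0 p hp).ne'
  have h4 : ContinuousOn (fun p : E n × ℝ => -(n : ℝ) / (2 * S p)) U :=
    continuousOn_const.div (continuousOn_const.mul hS) fun p hp => by
      have := hS0 p hp; positivity
  have h5 : ContinuousOn (fun p : E n × ℝ => ‖p.1‖ ^ 2 / (4 * S p ^ 2)) U :=
    ContinuousOn.div (by fun_prop) (continuousOn_const.mul (hS.pow 2)) fun p hp => by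
      have := hS0 p hp; positivity
  fun_prop

end Continuity

end ParabolicCarleman

/-! ### Integration of the energy density in time. -/

namespace ParabolicCarleman
variable {n : ℕ}

section TimeIntegration
variable {lam a T α : ℝ} {w : E n → ℝ → ℝ} {K : Set (E n × ℝ)}
  {A : E n → E n →L[ℝ] E n} {b : E n → E n} {V : E n → ℝ}

/-- The boundary density at time `t`, including the Gaussian weight. -/
noncomputable def boundaryDensity (A : E n → E n →L[ℝ] E n) (b : E n → E n) (V : E n → ℝ)
    (lam α a : ℝ) (w : E n → ℝ → ℝ) (x : E n) (t : ℝ) : ℝ :=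
  gaussG x (t + a) * density A b V (t + a) (conjFun lam α a w t) (rhoFun lam (t + a))
    (α + theta (lam * (t + a)) / 4) x

/-- The time derivative of the boundary density. -/
noncomputable def boundaryDensityDeriv (A : E n → E n →L[ℝ] E n) (b : E n → E n) (V : E n → ℝ)
    (lam α a : ℝ) (w : E n → ℝ → ℝ) (x : E n) (t : ℝ) : ℝ :=
  gaussG x (t + a) * carlemanDensityDeriv A b V α (t + a) (conjFun lam α a w t)
    (conjDot lam α a w t) (rhoFun lam (t + a)) (theta (lam * (t + a)))
    (thetaRate lam (t + a) / 4) x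

lemma continuousOn_slab_gaussG (ha : 0 < a) :
    ContinuousOn (fun p : E n × ℝ => gaussG p.1 (p.2 + a)) (slab n T) := by
  have hpos : ∀ p ∈ slab n T, 0 < p.2 + a := fun p hp => by linarith [hp.2.1]
  refine ContinuousOn.mul ?_ (ContinuousOn.rexp ?_)
  · exact ContinuousOn.rpow_const (by fun_prop) fun p hp => Or.inl (hpos p hp).ne'
  · exact ContinuousOn.div (by fun_prop) (by fun_prop) fun p hp => by
      have := hpos p hp; positivity

lemma continuousOn_slab_conjWeight (hl : 0 < lam) (ha : 0 < a) (hT : lam * (T + a) ≤ 1 / 2) :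
    ContinuousOn (fun p : E n × ℝ => conjWeight lam α a p.2) (slab n T) :=
  continuousOn_slab_of_time (g := fun s => sigma lam s ^ (-α)) hl ha hT fun s hs h =>
    (hasDerivAt_sigma hl hs (by linarith)).continuousAt.rpow_const
      (Or.inl (sigma_pos hs).ne')

lemma continuousOn_slab_rhoFun (hl : 0 < lam) (ha : 0 < a) (hT : lam * (T + a) ≤ 1 / 2) :
    ContinuousOn (fun p : E n × ℝ => rhoFun lam (p.2 + a)) (slab n T) :=
  continuousOn_slab_of_time hl ha hT fun s hs h =>
    (hasDerivAt_rhoFun hl hs (by linarith)).continuousAt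

lemma continuousOn_slab_theta (hl : 0 < lam) (ha : 0 < a) (hT : lam * (T + a) ≤ 1 / 2) :
    ContinuousOn (fun p : E n × ℝ => theta (lam * (p.2 + a))) (slab n T) :=
  continuousOn_slab_of_time (g := fun s => theta (lam * s)) hl ha hT fun _ hs h =>
    (hasDerivAt_theta_mul hl hs h).continuousAt

lemma continuousOn_slab_conjFun (hw : SmoothHalf w) (hl : 0 < lam) (ha : 0 < a)
    (hT : lam * (T + a) ≤ 1 / 2) :
    ContinuousOn (fun p : E n × ℝ => conjFun lam α a w p.2 p.1) (slab n T) :=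
  (continuousOn_slab_conjWeight hl ha hT).mul (hw.continuousOn.mono slab_subset_halfSpace)

lemma continuousOn_slab_gradient_conjFun (hw : SmoothHalf w) (hl : 0 < lam) (ha : 0 < a)
    (hT : lam * (T + a) ≤ 1 / 2) :
    ContinuousOn (fun p : E n × ℝ => gradient (conjFun lam α a w p.2) p.1) (slab n T) :=
  ((continuousOn_slab_conjWeight hl ha hT).smul
    (hw.gradX.continuousOn.mono slab_subset_halfSpace)).congr fun p hp =>
      gradient_conjFun hw hp.2.1 p.1

lemma continuousOn_slab_rate (hl : 0 < lam) (ha : 0 < a) (hT : lam * (T + a) ≤ 1 / 2) :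
    ContinuousOn (fun p : E n × ℝ => α * gam lam (p.2 + a) / (p.2 + a)) (slab n T) :=
  continuousOn_slab_of_time (g := fun s => α * gam lam s / s) hl ha hT fun s hs h =>
    (continuousAt_const.mul (hasDerivAt_gam hl hs (by linarith)).continuousAt).div
      continuousAt_id hs.ne'

lemma continuousOn_slab_conjDot (hw : SmoothHalf w) (hl : 0 < lam) (ha : 0 < a)
    (hT : lam * (T + a) ≤ 1 / 2) :
    ContinuousOn (fun p : E n × ℝ => conjDot lam α a w p.2 p.1) (slab n T) :=
  (continuousOn_slab_conjWeight hl ha hT).mul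
    ((hw.timeDeriv.continuousOn.mono slab_subset_halfSpace).sub
      ((continuousOn_slab_rate hl ha hT).mul (hw.continuousOn.mono slab_subset_halfSpace)))

lemma continuousOn_slab_gradient_conjDot (hw : SmoothHalf w) (hl : 0 < lam) (ha : 0 < a)
    (hT : lam * (T + a) ≤ 1 / 2) :
    ContinuousOn (fun p : E n × ℝ => gradient (conjDot lam α a w p.2) p.1) (slab n T) :=
  ((continuousOn_slab_conjWeight hl ha hT).smul
    ((hw.timeDeriv.gradX.continuousOn.mono slab_subset_halfSpace).sub
      ((continuousOn_slab_rate hl ha hT).smul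
        (hw.gradX.continuousOn.mono slab_subset_halfSpace)))).congr fun p hp =>
      gradient_conjDot hw hp.2.1 p.1

lemma continuousOn_slab_potF (hA : LocallyLipschitz A) (hb : LocallyLipschitz b) (ha : 0 < a) :
    ContinuousOn (fun p : E n × ℝ => potF A b (p.2 + a) p.1) (slab n T) := by
  have hpos : ∀ p ∈ slab n T, 0 < p.2 + a := fun p hp => by linarith [hp.2.1]
  have hP := (locallyLipschitz_potP hA hb).continuous
  have hQ := (locallyLipschitz_potQ hA).continuous
  refine ContinuousOn.add (ContinuousOn.div (by fun_prop) (by fun_prop) fun p hp =>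
    (hpos p hp).ne') (ContinuousOn.div (by fun_prop) (by fun_prop) fun p hp => ?_)
  have := hpos p hp; positivity

lemma continuousOn_slab_potFt (hA : LocallyLipschitz A) (hb : LocallyLipschitz b) (ha : 0 < a) :
    ContinuousOn (fun p : E n × ℝ => potFt A b (p.2 + a) p.1) (slab n T) := by
  have hpos : ∀ p ∈ slab n T, 0 < p.2 + a := fun p hp => by linarith [hp.2.1]
  have hP := (locallyLipschitz_potP hA hb).continuous
  have hQ := (locallyLipschitz_potQ hA).continuous
  refine ContinuousOn.sub (ContinuousOn.div (by fun_prop) (by fun_prop) fun p hp => ?_)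
    (ContinuousOn.div (by fun_prop) (by fun_prop) fun p hp => ?_)
  all_goals have := hpos p hp; positivity

lemma continuousOn_slab_boundaryDensityDeriv (hw : SmoothHalf w) (hA : LocallyLipschitz A)
    (hb : LocallyLipschitz b) (hV : LocallyLipschitz V) (hl : 0 < lam) (ha : 0 < a)
    (hT : lam * (T + a) ≤ 1 / 2) :
    ContinuousOn (fun p : E n × ℝ => boundaryDensityDeriv A b V lam α a w p.1 p.2)
      (slab n T) := by
  have hTh := continuousOn_slab_theta (n := n) hl ha hT
  have hR := continuousOn_slab_rhoFun (n := n) hl ha hT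
  have hVc : ContinuousOn (fun p : E n × ℝ => V p.1) (slab n T) :=
    (hV.continuous.comp continuous_fst).continuousOn
  have hM : ContinuousOn (fun p : E n × ℝ => thetaRate lam (p.2 + a) / 4) (slab n T) :=
    (continuousOn_slab_of_time hl ha hT fun s hs h => continuousAt_thetaRate hl hs h).div_const 4
  exact (continuousOn_slab_gaussG ha).mul (continuousOn_densityDeriv_formula hA.continuous
    (fun p hp => by linarith [hp.2.1]) (by fun_prop) hR hTh hM
    (continuousOn_slab_conjFun hw hl ha hT) (continuousOn_slab_conjDot hw hl ha hT)
    (hVc.sub ((continuousOn_slab_potF hA hb ha).div_const 2))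
    ((continuousOn_slab_potFt hA hb ha).div_const 2) (continuousOn_const.add (hTh.div_const 4))
    (continuousOn_slab_gradient_conjFun hw hl ha hT)
    (continuousOn_slab_gradient_conjDot hw hl ha hT))

lemma continuousOn_slab_boundaryDensity (hw : SmoothHalf w) (hA : LocallyLipschitz A)
    (hb : LocallyLipschitz b) (hV : LocallyLipschitz V) (hl : 0 < lam) (ha : 0 < a)
    (hT : lam * (T + a) ≤ 1 / 2) :
    ContinuousOn (fun p : E n × ℝ => boundaryDensity A b V lam α a w p.1 p.2) (slab n T) := by
  have hTh := continuousOn_slab_theta (n := n) hl ha hT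
  have hR := continuousOn_slab_rhoFun (n := n) hl ha hT
  have hVc : ContinuousOn (fun p : E n × ℝ => V p.1) (slab n T) :=
    (hV.continuous.comp continuous_fst).continuousOn
  have hP := continuousOn_slab_gradient_conjFun (α := α) hw hl ha hT
  have hX := (hA.continuous.comp continuous_fst).continuousOn.clm_apply hP
  exact (continuousOn_slab_gaussG ha).mul ((hR.mul (hX.inner hP)).sub
    (((continuousOn_const.add (hTh.div_const 4)).add (hR.mul
      (hVc.sub ((continuousOn_slab_potF hA hb ha).div_const 2)))).mul
        ((continuousOn_slab_conjFun hw hl ha hT).pow 2)))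

lemma conjFun_vanish (hv : VanishOff K w) {x : E n} {t : ℝ} (ht : 0 ≤ t) (hx : (x, t) ∉ K) :
    conjFun lam α a w t x = 0 := by
  rw [conjFun, hv x t ht hx, mul_zero]

lemma gradient_conjFun_vanish (hw : SmoothHalf w) (hv : VanishOff K w) (hK : IsClosed K) {x : E n}
    {t : ℝ} (ht : 0 ≤ t) (hx : (x, t) ∉ K) : gradient (conjFun lam α a w t) x = 0 := by
  rw [gradient_conjFun hw ht, hv.gradX hK x t ht hx, smul_zero]

lemma boundaryDensityDeriv_vanish (hw : SmoothHalf w) (hv : VanishOff K w) (hK : IsClosed K)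
    {x : E n} {t : ℝ} (ht : 0 ≤ t) (hx : (x, t) ∉ K) :
    boundaryDensityDeriv A b V lam α a w x t = 0 := by
  simp [boundaryDensityDeriv, carlemanDensityDeriv, densityDeriv, density, flux,
    conjFun_vanish hv ht hx, gradient_conjFun_vanish hw hv hK ht hx]

lemma boundaryDensity_vanish (hw : SmoothHalf w) (hv : VanishOff K w) (hK : IsClosed K)
    {x : E n} {t : ℝ} (ht : 0 ≤ t) (hx : (x, t) ∉ K) :
    boundaryDensity A b V lam α a w x t = 0 := by
  simp [boundaryDensity, density, flux, conjFun_vanish hv ht hx,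
    gradient_conjFun_vanish hw hv hK ht hx]

lemma integrable_slab {F : E n × ℝ → ℝ} (hK : IsCompact K) (hF : ContinuousOn F (slab n T))
    (h0 : ∀ p ∈ slab n T, p ∉ K → F p = 0) :
    Integrable F ((volume : Measure (E n)).prod (volume.restrict (Ioc 0 T))) := by
  have hcl : IsClosed (slab n T) := isClosed_univ.prod isClosed_Icc
  have h1 : IntegrableOn F (K ∩ slab n T) :=
    (hF.mono inter_subset_right).integrableOn_compact (hK.inter_right hcl)
  have h2 : IntegrableOn F (slab n T) :=
    h1.of_forall_sdiff_eq_zero hcl.measurableSet fun p hp => h0 p hp.1 fun h => hp.2 ⟨h, hp.1⟩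
  have h3 : IntegrableOn F (univ ×ˢ Ioc 0 T) := h2.mono_set (prod_mono_right Ioc_subset_Icc_self)
  rwa [IntegrableOn, Measure.volume_eq_prod, ← Measure.prod_restrict, Measure.restrict_univ] at h3

lemma integrable_boundaryDensityDeriv (hw : SmoothHalf w) (hv : VanishOff K w) (hK : IsCompact K)
    (hA : LocallyLipschitz A) (hb : LocallyLipschitz b) (hV : LocallyLipschitz V) (hl : 0 < lam)
    (ha : 0 < a) (hT : lam * (T + a) ≤ 1 / 2) :
    Integrable (fun p : E n × ℝ => boundaryDensityDeriv A b V lam α a w p.1 p.2)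
      ((volume : Measure (E n)).prod (volume.restrict (Ioc 0 T))) :=
  integrable_slab hK (continuousOn_slab_boundaryDensityDeriv hw hA hb hV hl ha hT) fun _ hp hpK =>
    boundaryDensityDeriv_vanish hw hv hK.isClosed hp.2.1 hpK

/-- Integration in time of the boundary density. -/
lemma integral_boundaryDensityDeriv (hw : SmoothHalf w) (hv : VanishOff K w) (hK : IsCompact K)
    (hA : LocallyLipschitz A) (hb : LocallyLipschitz b) (hV : LocallyLipschitz V)
    (hsymm : ∀ x u v, inner ℝ (A x u) v = inner ℝ u (A x v)) (hl : 0 < lam) (ha : 0 < a)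
    (hT0 : 0 ≤ T) (hT : lam * (T + a) ≤ 1 / 2) (hKT : ∀ x, (x, T) ∉ K) :
    ∫ t in Ioc 0 T, ∫ x, boundaryDensityDeriv A b V lam α a w x t
      = -∫ x, boundaryDensity A b V lam α a w x 0 := by
  rw [← integral_integral_swap (integrable_boundaryDensityDeriv hw hv hK hA hb hV hl ha hT),
    ← integral_neg]
  refine integral_congr_ae (Filter.Eventually.of_forall fun x => ?_)
  have hline : ContinuousOn (fun t : ℝ => ((x, t) : E n × ℝ)) (Icc 0 T) := by fun_prop
  have hmaps : MapsTo (fun t : ℝ => ((x, t) : E n × ℝ)) (Icc 0 T) (slab n T) :=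
    fun t ht => ⟨mem_univ _, ht⟩
  have c1 : ContinuousOn (fun t => boundaryDensity A b V lam α a w x t) (Icc 0 T) :=
    (continuousOn_slab_boundaryDensity hw hA hb hV hl ha hT).comp hline hmaps
  have c2 : ContinuousOn (fun t => boundaryDensityDeriv A b V lam α a w x t) (Icc 0 T) :=
    (continuousOn_slab_boundaryDensityDeriv hw hA hb hV hl ha hT).comp hline hmaps
  -- Differentiability is claimed only at interior times, w being smooth at t = 0 from one side;
  -- continuity up to the endpoints suffices for the fundamental theorem.
  have hd : ∀ t ∈ Ioo 0 T, HasDerivAt (fun t => boundaryDensity A b V lam α a w x t)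
      (boundaryDensityDeriv A b V lam α a w x t) t := fun t ht => by
    have ht' : lam * (t + a) ≤ 1 / 2 := le_trans (by gcongr; exact ht.2.le) hT
    exact hasDerivAt_density hl (by linarith [ht.1]) ht' (hsymm x)
      (hasDerivAt_conjFun hw hl ha ht.1 ht' x) (hasDerivAt_gradient_conjFun hw hl ha ht.1 ht' x)
  have h := intervalIntegral.integral_eq_sub_of_hasDerivAt_of_le hT0 c1 hd
    (c2.intervalIntegrable_of_Icc hT0)
  rw [intervalIntegral.integral_of_le hT0,
    boundaryDensity_vanish hw hv hK.isClosed hT0 (hKT x), zero_sub] at h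
  exact h

end TimeIntegration

end ParabolicCarleman

/-! ### Measurability and square integrability of Lw. -/

namespace ParabolicCarleman
variable {n : ℕ}

section Operator
variable {Λ M T : ℝ} {w : E n → ℝ → ℝ} {K : Set (E n × ℝ)}
  {A : E n → ℝ → Matrix (Fin n) (Fin n) ℝ} {b : E n → ℝ → E n} {V : E n → ℝ → ℝ}

/-- Only for t > 0: at t = 0 the two-sided derivative in `opL` would see the irrelevant values of w
at negative times. That slice is null for the space-time integrals. -/
lemma opL_eq (hw : SmoothHalf w) {x : E n} {t : ℝ} (ht : 0 < t) :
    opL A b V w x t = timeDeriv w x t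
      + tr (fderiv ℝ (flux (fun y => matOp (A y t)) (fun y => w y t)) x)
      + inner ℝ (b x t) (gradX w x t) + V x t * w x t := by
  rw [opL, (hw.hasDerivAt ht).deriv]
  rfl

lemma flux_vanish (hv : VanishOff K w) (hK : IsClosed K) :
    VanishOff K fun x t => flux (fun y => matOp (A y t)) (fun y => w y t) x := fun x t ht hx => by
  have := hv.gradX hK x t ht hx
  rw [gradX] at this
  simp [flux, this]

lemma opL_vanish (hw : SmoothHalf w) (hv : VanishOff K w) (hK : IsClosed K) {x : E n} {t : ℝ}
    (ht : 0 < t) (hx : (x, t) ∉ K) : opL A b V w x t = 0 := by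
  have h1 := (flux_vanish (A := A) hv hK).fderiv hK x t ht.le hx
  have h1' : fderiv ℝ (flux (fun y => matOp (A y t)) (fun y => w y t)) x = 0 := h1
  rw [opL_eq hw ht, hv.timeDeriv hK x t ht.le hx, hv.gradX hK x t ht.le hx, hv x t ht.le hx, h1']
  simp [tr]

lemma exists_bound_slab {H : Type*} [NormedAddCommGroup H] {F : E n → ℝ → H} (hK : IsCompact K)
    (hF : ContinuousOn (fun p : E n × ℝ => F p.1 p.2) (slab n T)) (hv : VanishOff K F) :
    ∃ B, 0 ≤ B ∧ ∀ x, ∀ t ∈ Icc 0 T, ‖F x t‖ ≤ B := by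
  have hcl : IsClosed (slab n T) := isClosed_univ.prod isClosed_Icc
  obtain ⟨B, hB⟩ := (hK.inter_right hcl).exists_bound_of_continuousOn (hF.mono inter_subset_right)
  refine ⟨max B 0, le_max_right _ _, fun x t ht => ?_⟩
  by_cases hx : (x, t) ∈ K
  · exact (hB (x, t) ⟨hx, mem_univ _, ht⟩).trans (le_max_left _ _)
  · rw [hv x t ht.1 hx, norm_zero]; exact le_max_right _ _

/-- The flux need not be differentiable everywhere, so its derivative is bounded through increments
based at x. Writing the increment as (A(y) − A(x))∇w(y) + A(x)(∇w(y) − ∇w(x)) requires a bound on A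
only at x in the ball. -/
lemma exists_bound_fderiv_flux (hA : IsAdmissible Λ M A) (hM : 0 ≤ M) (h0 : A 0 0 = 1)
    (hw : SmoothHalf w) (hv : VanishOff K w) (hK : IsCompact K) :
    ∃ B, 0 ≤ B ∧ ∀ x ∈ Metric.ball (0 : E n) 4, ∀ t ∈ Icc 0 T,
      ‖fderiv ℝ (flux (fun y => matOp (A y t)) (fun y => w y t)) x‖ ≤ B := by
  obtain ⟨B₁, hB₁, h1⟩ := exists_bound_slab hK (hw.gradX.continuousOn.mono
    (slab_subset_halfSpace (T := T))) (hv.gradX hK.isClosed)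
  obtain ⟨B₂, hB₂, h2⟩ := exists_bound_slab hK (hw.gradX.fderiv_slice.continuousOn.mono
    (slab_subset_halfSpace (T := T))) ((hv.gradX hK.isClosed).fderiv hK.isClosed)
  have hnM : 0 ≤ n ^ 2 * M := by positivity
  have hTp : 0 ≤ max T 0 ^ (1 / 2 : ℝ) := by positivity
  refine ⟨n ^ 2 * M * B₁ + (1 + n ^ 2 * M * (4 + max T 0 ^ (1 / 2 : ℝ))) * B₂, by positivity,
    fun x hx t ht => norm_fderiv_le_of_lip' ℝ (by positivity) (Filter.Eventually.of_forall
      fun y => ?_)⟩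
  have e : flux (fun y => matOp (A y t)) (fun y => w y t) y
      - flux (fun y => matOp (A y t)) (fun y => w y t) x
      = (matOp (A y t) - matOp (A x t)) (gradX w y t)
        + matOp (A x t) (gradX w y t - gradX w x t) := by
    rw [map_sub, sub_apply]
    simp only [flux, gradX]
    abel
  have hd : ‖matOp (A y t) - matOp (A x t)‖ ≤ n ^ 2 * M * ‖y - x‖ := by
    have := hA.norm_sub_le hM (x := y) (y := x) ht.1 ht.1
    simpa using this
  have hx4 : ‖x‖ ≤ 4 := (mem_ball_zero_iff.1 hx).le
  have hAx : ‖matOp (A x t)‖ ≤ 1 + n ^ 2 * M * (4 + max T 0 ^ (1 / 2 : ℝ)) := by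
    have h3 := hA.norm_sub_one_le hM h0 (x := x) ht.1
    calc ‖matOp (A x t)‖ = ‖1 + (matOp (A x t) - 1)‖ := by congr 1; abel
      _ ≤ ‖(1 : E n →L[ℝ] E n)‖ + ‖matOp (A x t) - 1‖ := norm_add_le _ _
      _ ≤ 1 + n ^ 2 * M * (4 + max T 0 ^ (1 / 2 : ℝ)) := by
          refine add_le_add ContinuousLinearMap.norm_id_le (h3.trans ?_)
          have : t ^ (1 / 2 : ℝ) ≤ max T 0 ^ (1 / 2 : ℝ) :=
            Real.rpow_le_rpow ht.1 (ht.2.trans (le_max_left _ _)) (by norm_num)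
          gcongr
  have hP : ‖gradX w y t - gradX w x t‖ ≤ B₂ * ‖y - x‖ :=
    convex_univ.norm_image_sub_le_of_norm_fderiv_le (𝕜 := ℝ) (f := fun y => gradX w y t)
      (fun z _ => (hw.gradX.contDiff_slice ht.1).differentiable (by simp) z)
      (fun z _ => h2 z t ht) (mem_univ x) (mem_univ y)
  rw [e]
  calc _ ≤ ‖matOp (A y t) - matOp (A x t)‖ * ‖gradX w y t‖
        + ‖matOp (A x t)‖ * ‖gradX w y t - gradX w x t‖ :=
      (norm_add_le _ _).trans (add_le_add (ContinuousLinearMap.le_opNorm _ _)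
        (ContinuousLinearMap.le_opNorm _ _))
    _ ≤ n ^ 2 * M * ‖y - x‖ * B₁
        + (1 + n ^ 2 * M * (4 + max T 0 ^ (1 / 2 : ℝ))) * (B₂ * ‖y - x‖) := by
      gcongr
      exact h1 y t ht
    _ = _ := by ring

/-- Replacing t by max t 0 gives a flux continuous on the whole space-time, to which measurability
of a derivative depending on a parameter applies. -/
lemma measurable_tr_fderiv_flux (hA : IsAdmissible Λ M A) (hM : 0 ≤ M) (hw : SmoothHalf w) :
    Measurable fun p : E n × ℝ => tr (fderiv ℝ (flux (fun y => matOp (A y (max p.2 0)))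
      (fun y => w y (max p.2 0))) p.1) := by
  have c1 : Continuous fun p : ℝ × E n => matOp (A p.2 (max p.1 0)) := by
    rw [continuous_iff_continuousAt]
    intro p₀
    rw [ContinuousAt, tendsto_iff_norm_sub_tendsto_zero]
    have hb : ∀ p : ℝ × E n, ‖matOp (A p.2 (max p.1 0)) - matOp (A p₀.2 (max p₀.1 0))‖
        ≤ n ^ 2 * M * (‖p.2 - p₀.2‖ + |max p.1 0 - max p₀.1 0| ^ (1 / 2 : ℝ)) := fun p =>
      hA.norm_sub_le hM (le_max_right _ _) (le_max_right _ _)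
    have hc : Continuous fun p : ℝ × E n =>
        n ^ 2 * M * (‖p.2 - p₀.2‖ + |max p.1 0 - max p₀.1 0| ^ (1 / 2 : ℝ)) := by
      refine continuous_const.mul (Continuous.add (by fun_prop) ?_)
      exact Continuous.rpow_const (by fun_prop) fun _ => Or.inr (by norm_num)
    have hl := hc.tendsto p₀
    simp only [sub_self, norm_zero, abs_zero] at hl
    rw [Real.zero_rpow (by norm_num), add_zero, mul_zero] at hl
    exact squeeze_zero (fun _ => norm_nonneg _) hb hl
  have c2 : Continuous fun p : ℝ × E n => gradX w p.2 (max p.1 0) :=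
    hw.gradX.continuousOn.comp_continuous (f := fun p : ℝ × E n => (p.2, max p.1 0))
      (by fun_prop) fun p => ⟨mem_univ _, mem_Ici.2 (le_max_right _ _)⟩
  have c3 : Continuous (Function.uncurry fun (t : ℝ) (y : E n) =>
      flux (fun y => matOp (A y (max t 0))) (fun y => w y (max t 0)) y) := c1.clm_apply c2
  have h := measurable_fderiv_with_param ℝ c3
  have h2 := ((trL n).continuous.measurable.comp h).comp (measurable_swap (α := E n) (β := ℝ))
  exact h2

/-- The comparison passes through (x, t₀): the Hölder bound in time is uniform in x, so only the
Lipschitz constant at the fixed time t₀ is needed. -/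
lemma FiniteNorm.continuousOn {f : E n → ℝ → ℝ} (hf : FiniteNorm f) :
    ContinuousOn (fun p : E n × ℝ => f p.1 p.2) (Q4 n) := by
  intro p₀ hp₀
  obtain ⟨L, hL⟩ := hf.1 p₀.2 hp₀.2
  rw [ContinuousWithinAt, tendsto_iff_norm_sub_tendsto_zero]
  have hb : ∀ p ∈ Q4 n, ‖f p.1 p.2 - f p₀.1 p₀.2‖
      ≤ (scalarNorm f).toReal * |p.2 - p₀.2| ^ (1 / 2 : ℝ) + L * ‖p.1 - p₀.1‖ := fun p hp => by
    calc ‖f p.1 p.2 - f p₀.1 p₀.2‖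
        = ‖(f p.1 p.2 - f p.1 p₀.2) + (f p.1 p₀.2 - f p₀.1 p₀.2)‖ := by congr 1; ring
      _ ≤ _ := (norm_add_le _ _).trans (add_le_add (hf.abs_sub_le hp.1 hp.2 hp₀.2) (by
          have := hL.dist_le_mul p.1 hp.1 p₀.1 hp₀.1
          rwa [dist_eq_norm, dist_eq_norm] at this))
  have hc : Continuous fun p : E n × ℝ =>
      (scalarNorm f).toReal * |p.2 - p₀.2| ^ (1 / 2 : ℝ) + L * ‖p.1 - p₀.1‖ := by
    refine Continuous.add (continuous_const.mul ?_) (by fun_prop)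
    exact Continuous.rpow_const (by fun_prop) fun _ => Or.inr (by norm_num)
  have hl := (hc.tendsto p₀).mono_left (nhdsWithin_le_nhds (s := Q4 n))
  simp only [sub_self, norm_zero, abs_zero, mul_zero] at hl
  rw [Real.zero_rpow (by norm_num), mul_zero, add_zero] at hl
  refine squeeze_zero' (Filter.Eventually.of_forall fun _ => norm_nonneg _) ?_ hl
  filter_upwards [self_mem_nhdsWithin] with p hp using hb p hp

lemma continuousOn_vector (hb : ∀ i, FiniteNorm fun x t => b x t i) :
    ContinuousOn (fun p : E n × ℝ => b p.1 p.2) (Q4 n) := by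
  have h : ContinuousOn (fun p : E n × ℝ => WithLp.toLp 2 fun i => b p.1 p.2 i) (Q4 n) :=
    (PiLp.continuous_toLp 2 _).comp_continuousOn (continuousOn_pi.2 fun i => (hb i).continuousOn)
  exact h

/-- Square integrability of `L w` with a continuous weight. -/
lemma integrable_mul_opL_sq {W : E n × ℝ → ℝ} (hA : IsAdmissible Λ M A) (hM : 0 ≤ M)
    (h0 : A 0 0 = 1) (hb : ∀ i, FiniteNorm fun x t => b x t i) (hV : FiniteNorm V)
    (hw : SmoothHalf w) (hv : VanishOff K w) (hK : IsCompact K)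
    (hKs : K ⊆ Metric.ball (0 : E n) 4 ×ˢ Ico (0 : ℝ) T) (hT : T ≤ 16)
    (hW : ContinuousOn W (slab n T)) :
    Integrable (fun p : E n × ℝ => W p * opL A b V w p.1 p.2 ^ 2)
      ((volume : Measure (E n)).prod (volume.restrict (Ioc 0 T))) := by
  set S : Set (E n × ℝ) := univ ×ˢ Ioc (0 : ℝ) T with hS
  have hSm : MeasurableSet S := MeasurableSet.univ.prod measurableSet_Ioc
  have hSs : S ⊆ slab n T := prod_mono_right Ioc_subset_Icc_self
  have hKS : K ∩ S ⊆ Q4 n := fun p hp =>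
    ⟨(hKs hp.1).1, hp.2.2.1.le, hp.2.2.2.trans hT⟩
  have hKQ : K ⊆ Q4 n := fun p hp =>
    ⟨(hKs hp).1, (hKs hp).2.1, (hKs hp).2.2.le.trans hT⟩
  have hmeas : MeasurableSet (K ∩ S) := hK.isClosed.measurableSet.inter hSm
  have hKsl : K ⊆ slab n T := fun p hp => ⟨mem_univ _, (hKs hp).2.1, (hKs hp).2.2.le⟩
  have cW := hW.mono hKsl
  have c1 := hw.timeDeriv.continuousOn.mono (hKsl.trans slab_subset_halfSpace)
  have c2 := ((continuousOn_vector hb).mono hKQ).inner (𝕜 := ℝ)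
    (hw.gradX.continuousOn.mono (hKsl.trans slab_subset_halfSpace))
  have c3 := (hV.continuousOn.mono hKQ).mul
    (hw.continuousOn.mono (hKsl.trans slab_subset_halfSpace))
  have c4 := (c1.add c2).add c3
  set R : E n × ℝ → ℝ := fun p => timeDeriv w p.1 p.2 + inner ℝ (b p.1 p.2) (gradX w p.1 p.2)
    + V p.1 p.2 * w p.1 p.2 with hR
  have c4' : ContinuousOn R K := c4
  set D : E n × ℝ → ℝ := fun p => tr (fderiv ℝ (flux (fun y => matOp (A y (max p.2 0)))
      (fun y => w y (max p.2 0))) p.1) with hD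
  have mD : Measurable D := measurable_tr_fderiv_flux hA hM hw
  have heq : ∀ p ∈ S, opL A b V w p.1 p.2 = R p + D p := fun p hp => by
    rw [opL_eq hw hp.2.1, hR, hD]
    simp only [max_eq_left hp.2.1.le]
    ring
  obtain ⟨BW, hBW⟩ := hK.exists_bound_of_continuousOn cW
  obtain ⟨BR, hBR⟩ := hK.exists_bound_of_continuousOn c4'
  obtain ⟨BD, hBD, hBD'⟩ := exists_bound_fderiv_flux (T := T) hA hM h0 hw hv hK
  have hfin : IsFiniteMeasure (volume.restrict (K ∩ S)) :=
    ⟨by rw [Measure.restrict_apply_univ]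
        exact (measure_mono inter_subset_left).trans_lt hK.measure_lt_top⟩
  have hI : IntegrableOn (fun p => W p * (R p + D p) ^ 2) (K ∩ S) := by
    have mW : AEStronglyMeasurable W (volume.restrict (K ∩ S)) :=
      (cW.mono inter_subset_left).aestronglyMeasurable hmeas
    have mR : AEStronglyMeasurable R (volume.restrict (K ∩ S)) :=
      (c4'.mono inter_subset_left).aestronglyMeasurable hmeas
    refine Integrable.of_bound (mW.mul ((mR.add mD.aestronglyMeasurable).pow 2))
      (BW * (BR + n * BD) ^ 2) ?_
    filter_upwards [ae_restrict_mem hmeas] with p hp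
    have e1 : |D p| ≤ n * BD := by
      refine (abs_tr_le _).trans (mul_le_mul_of_nonneg_left ?_ (Nat.cast_nonneg n))
      rw [max_eq_left hp.2.2.1.le]
      exact hBD' p.1 (hKs hp.1).1 p.2 ⟨hp.2.2.1.le, hp.2.2.2⟩
    have e2 : |R p + D p| ≤ BR + n * BD :=
      (abs_add_le _ _).trans (add_le_add (hBR p hp.1) e1)
    have e3 : (R p + D p) ^ 2 ≤ (BR + n * BD) ^ 2 := by
      rw [← sq_abs]; gcongr
    rw [Real.norm_eq_abs, abs_mul, abs_of_nonneg (sq_nonneg (R p + D p))]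
    exact mul_le_mul (hBW p hp.1) e3 (sq_nonneg _) ((norm_nonneg _).trans (hBW p hp.1))
  have hI2 : IntegrableOn (fun p : E n × ℝ => W p * opL A b V w p.1 p.2 ^ 2) (K ∩ S) :=
    hI.congr_fun (fun p hp => by simp only [heq p hp.2]) hmeas
  have hI3 : IntegrableOn (fun p : E n × ℝ => W p * opL A b V w p.1 p.2 ^ 2) S :=
    hI2.of_forall_sdiff_eq_zero hSm fun p hp => by
      rw [opL_vanish hw hv hK.isClosed hp.1.2.1 fun h => hp.2 ⟨h, hp.1⟩]; simp
  rwa [IntegrableOn, Measure.volume_eq_prod, hS, ← Measure.prod_restrict,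
    Measure.restrict_univ] at hI3

end Operator

end ParabolicCarleman

/-! ### The outer region, and the fixed time inequality for the conjugated function. -/

namespace ParabolicCarleman
variable {n : ℕ}

section Outer

/-- The bound for the Gaussian weight away from the main region. -/
noncomputable def outerBound (n : ℕ) (lam α s : ℝ) : ℝ :=
  α ^ 2 / s ^ 2 * (s ^ (-(n : ℝ) / 2) * (lam * s) ^ ((4 + (n : ℝ) / 2) * α))

/-- The base of the exponential growth of the error terms. -/
noncomputable def outerBase (n : ℕ) (δ : ℝ) : ℝ :=
  Real.exp (16 * thetaConst + 2 + n / 4 + (4 + n / 2) * (-Real.log δ))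

variable {lam α s δ : ℝ}

lemma outerBound_nonneg (hl : 0 < lam) (hs : 0 < s) : 0 ≤ outerBound n lam α s := by
  have : 0 < lam * s := by positivity
  unfold outerBound
  positivity

/-- Dividing `hx` by 4s turns the Gaussian exponent into (4 + n/2) α log(λs). This is the origin of
16 + 2n, the square of the parameter k. -/
lemma gaussG_le_outerBound (hl : 0 < lam) (hs : 0 < s) {x : E n}
    (hx : (16 + 2 * (n : ℝ)) * (α * s) * Real.log (1 / (lam * s)) < ‖x‖ ^ 2) :
    α ^ 2 / s ^ 2 * gaussG x s ≤ outerBound n lam α s := by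
  have h0 : 0 < lam * s := by positivity
  unfold outerBound gaussG
  gcongr
  rw [Real.rpow_def_of_pos h0]
  apply Real.exp_le_exp.2
  rw [one_div, Real.log_inv] at hx
  rw [div_le_iff₀ (by positivity)]
  nlinarith

/-- After logarithms everything is linear in log(λs) ≤ 0, log α and −log δ. The exponent (4 + n/2)α
covers the total power 2 + n/2 + 2α of 1/s, as α ≥ 1. Passing from s to λs costs powers of α and
1/δ: 2α log α accounts for α^{2α}, the remaining multiple of log α is bounded by the same multiple
of α, and the powers of 1/δ go into the exponential base. -/
lemma outerBound_mul_sigma_le (hα : 1 ≤ α) (hδ : 0 < δ) (hδ1 : δ ≤ 1) (hs : 0 < s)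
    (hτ : α / δ ^ 2 * s ≤ 1 / 2) :
    outerBound n (α / δ ^ 2) α s * sigma (α / δ ^ 2) s ^ (-2 * α)
      ≤ outerBase n δ ^ (2 * α) * α ^ (2 * α) := by
  have hα0 : 0 < α := by linarith
  have hl : 0 < α / δ ^ 2 := by positivity
  have h0 : 0 < α / δ ^ 2 * s := by positivity
  have hσ : sigma (α / δ ^ 2) s ^ (-2 * α)
      ≤ (s * Real.exp (-(16 * thetaConst))) ^ (-2 * α) :=
    Real.rpow_le_rpow_of_nonpos (by positivity) (sigma_bounds hl hs (by linarith)).1 (by linarith)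
  have hla : 0 ≤ Real.log α := Real.log_nonneg hα
  have hla' : Real.log α ≤ α := (Real.log_le_sub_one_of_pos hα0).trans (by linarith)
  have hld : 0 ≤ -Real.log δ := by linarith [Real.log_nonpos hδ.le hδ1]
  have hlt : Real.log (α / δ ^ 2 * s) = Real.log α - 2 * Real.log δ + Real.log s := by
    rw [Real.log_mul hl.ne' hs.ne', Real.log_div hα0.ne' (by positivity), Real.log_pow]
    norm_num
  have hlt0 : Real.log (α / δ ^ 2 * s) ≤ 0 := Real.log_nonpos h0.le (by linarith)
  have e1 : outerBound n (α / δ ^ 2) α s * (s * Real.exp (-(16 * thetaConst))) ^ (-2 * α)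
      = Real.exp (2 * Real.log α - 2 * Real.log s + (Real.log s * (-n / 2)
        + Real.log (α / δ ^ 2 * s) * ((4 + n / 2) * α))
        + (Real.log s - 16 * thetaConst) * (-2 * α)) := by
    have a1 : α ^ 2 = Real.exp (2 * Real.log α) := by
      rw [two_mul, Real.exp_add, Real.exp_log hα0]; ring
    have a2 : s ^ 2 = Real.exp (2 * Real.log s) := by
      rw [two_mul, Real.exp_add, Real.exp_log hs]; ring
    rw [outerBound, Real.exp_add, Real.exp_add, Real.exp_add, Real.exp_sub, ← a1, ← a2,
      Real.rpow_def_of_pos hs, Real.rpow_def_of_pos h0, Real.rpow_def_of_pos (by positivity),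
      Real.log_mul hs.ne' (Real.exp_pos _).ne', Real.log_exp, ← sub_eq_add_neg]
  have e2 : outerBase n δ ^ (2 * α) * α ^ (2 * α)
      = Real.exp ((16 * thetaConst + 2 + n / 4 + (4 + n / 2) * (-Real.log δ)) * (2 * α)
        + Real.log α * (2 * α)) := by
    rw [outerBase, ← Real.exp_mul, Real.exp_add, Real.rpow_def_of_pos hα0]
  refine (mul_le_mul_of_nonneg_left hσ (outerBound_nonneg hl hs)).trans ?_
  rw [e1, e2]
  apply Real.exp_le_exp.2
  have hn : (0 : ℝ) ≤ n := Nat.cast_nonneg n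
  have hls : Real.log s = Real.log (α / δ ^ 2 * s) - Real.log α - 2 * (-Real.log δ) := by
    rw [hlt]; ring
  generalize Real.log (α / δ ^ 2 * s) = lt at *
  rw [hls]
  generalize -Real.log δ = ld at *
  generalize Real.log α = la at *
  have b1 : ((4 + n / 2) * α - (2 + n / 2 + 2 * α)) * lt ≤ 0 :=
    mul_nonpos_of_nonneg_of_nonpos (by nlinarith) hlt0
  have b2 : (4 + n / 2) * la ≤ (4 + n / 2) * α := by gcongr
  have b3 : 0 ≤ (4 + n) * ((α - 1) * ld) := by
    have : 0 ≤ α - 1 := by linarith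
    positivity
  nlinarith

end Outer

section SliceConj
variable {Λ M T C c α δ a t : ℝ} {w : E n → ℝ → ℝ} {K : Set (E n × ℝ)}
  {A : E n → ℝ → Matrix (Fin n) (Fin n) ℝ} {b : E n → ℝ → E n} {V : E n → ℝ → ℝ}
  {b₀ : E n → E n} {V₀ : E n → ℝ} {lam : ℝ}

/-- The conjugated equation at a fixed time. -/
lemma conj_opL_sub_eq (hA : IsAdmissible Λ M A) (hw : SmoothHalf w) (ha : 0 < a) (ht : 0 < t)
    {x : E n} (hd : DifferentiableAt ℝ (fun y => matOp (A y t)) x) :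
    conjWeight lam α a t * opL A b V w x t
      - (antiPart (fun y => matOp (A y 0)) b₀ (t + a) (conjFun lam α a w t) (conjDot lam α a w t) x
        + symPart (fun y => matOp (A y 0)) (t + a) (conjFun lam α a w t) x
        + (α / rhoFun lam (t + a) + (V₀ x - potF (fun y => matOp (A y 0)) b₀ (t + a) x / 2))
          * conjFun lam α a w t x)
    = (tr (fderiv ℝ (flux (fun y => matOp (A y t)) (conjFun lam α a w t)) x)
        - tr (fderiv ℝ (flux (fun y => matOp (A y 0)) (conjFun lam α a w t)) x))
      + inner ℝ (b x t - b₀ x) (gradient (conjFun lam α a w t) x)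
      + (V x t - V₀ x) * conjFun lam α a w t x := by
  have hs : 0 < t + a := by positivity
  have e0 := antiPart_add_symPart (A := fun y => matOp (A y 0)) (b := b₀) (V := V₀)
    (f := conjFun lam α a w t) (q := conjDot lam α a w t) (x := x) (k := α / rhoFun lam (t + a)) hs
    (hA.inner_comm le_rfl)
  rw [e0, opL_eq hw ht]
  have e1 : flux (fun y => matOp (A y t)) (conjFun lam α a w t)
      = fun y => conjWeight lam α a t • flux (fun y => matOp (A y t)) (fun y => w y t) y := by
    funext y
    rw [flux, gradient_conjFun hw ht.le, map_smul]
    rfl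
  have e2 : fderiv ℝ (flux (fun y => matOp (A y t)) (conjFun lam α a w t)) x
      = conjWeight lam α a t • fderiv ℝ (flux (fun y => matOp (A y t)) (fun y => w y t)) x := by
    rw [e1]
    exact fderiv_fun_const_smul (hasFDerivAt_flux hd (hw.contDiff_slice ht.le)).1 _
  have e3 := gradient_conjFun (lam := lam) (α := α) (a := a) hw ht.le x
  have e4 : ∀ (u v p : E n) (κ : ℝ), inner ℝ (u - v) (κ • p) = κ * inner ℝ u p - κ * inner ℝ v p :=
    fun u v p κ => by rw [inner_sub_left, inner_smul_right, inner_smul_right]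
  have e5 : ∀ (v p : E n) (κ : ℝ), inner ℝ v (κ • p) = κ * inner ℝ v p :=
    fun v p κ => inner_smul_right _ _ _
  have e6 : conjFun lam α a w t x = conjWeight lam α a t * w x t := rfl
  have e7 : conjDot lam α a w t x
      = conjWeight lam α a t * (timeDeriv w x t - α * gam lam (t + a) / (t + a) * w x t) := rfl
  have hρ : α / rhoFun lam (t + a) = α * gam lam (t + a) / (t + a) := by
    rw [rhoFun, div_div_eq_mul_div]
  rw [e2, tr_smul, e3, e4, e5, e6, e7, hρ]
  ring

lemma conjFun_eq_zero (hv : VanishOff K w) (ht : 0 ≤ t) {x : E n} (hx : x ∉ Prod.fst '' K) :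
    conjFun lam α a w t x = 0 :=
  conjFun_vanish hv ht fun h => hx ⟨_, h, rfl⟩

lemma hasCompactSupport_conjFun (hv : VanishOff K w) (hK : IsCompact K) (ht : 0 ≤ t) :
    HasCompactSupport (conjFun lam α a w t) :=
  HasCompactSupport.intro (hK.image continuous_fst) fun _ hx => conjFun_eq_zero hv ht hx

lemma tsupport_conjFun_subset (hv : VanishOff K w) (hK : IsCompact K)
    (hKs : K ⊆ Metric.ball (0 : E n) 4 ×ˢ Ico (0 : ℝ) T) (ht : 0 ≤ t) :
    tsupport (conjFun lam α a w t) ⊆ Metric.ball (0 : E n) 4 := by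
  refine (closure_minimal (fun x hx => ?_) (hK.image continuous_fst).isClosed).trans ?_
  · by_contra h
    exact hx (conjFun_eq_zero hv ht h)
  · rintro _ ⟨p, hp, rfl⟩
    exact (hKs hp).1

lemma integral_conj_eq (hw : SmoothHalf w) (ht : 0 ≤ t) :
    ∫ x, (conjFun lam α a w t x ^ 2 + ‖gradient (conjFun lam α a w t) x‖ ^ 2)
      = conjWeight lam α a t ^ 2 * ∫ x, (w x t ^ 2 + ‖gradX w x t‖ ^ 2) := by
  rw [← integral_const_mul]
  refine integral_congr_ae (Filter.Eventually.of_forall fun x => ?_)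
  simp only [gradient_conjFun hw ht, norm_smul, mul_pow, conjFun, Real.norm_eq_abs, sq_abs]
  ring

lemma conjWeight_sq (hs : 0 < t + a) :
    conjWeight lam α a t ^ 2 = sigma lam (t + a) ^ (-2 * α) := by
  rw [conjWeight, ← Real.rpow_natCast, ← Real.rpow_mul (sigma_pos hs).le]
  norm_num
  ring_nf

/-- The fixed time inequality for the conjugated function, with the error made explicit. -/
lemma slice_carleman_conj (hn : 1 ≤ n) (hA : IsAdmissible Λ M A) (hM : 0 ≤ M)
    (hw : SmoothHalf w) (hv : VanishOff K w)
    (hK : IsCompact K) (hKs : K ⊆ Metric.ball (0 : E n) 4 ×ˢ Ico (0 : ℝ) T) (hT16 : T ≤ 16)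
    (hb₀ : LocallyLipschitz b₀) (hV₀ : LocallyLipschitz V₀)
    (hPB : ∀ᵐ x, x ∈ Metric.ball (0 : E n) 4 →
      PointBounds (fun y => matOp (A y 0)) b₀ V₀ C α x)
    (hdiff : ∀ x ∈ Metric.ball (0 : E n) 4, ∀ t ∈ Icc (0 : ℝ) 16,
      ‖b x t - b₀ x‖ ≤ n * α * (t + a) ^ (1 / 2 : ℝ) ∧
        |V x t - V₀ x| ≤ α ^ 2 * (t + a) ^ (1 / 2 : ℝ))
    (hC : 1 ≤ C) (hc : n ≤ c) (hcM : n ^ 2 * M ≤ c) (hcC : 16 * (n * c) ^ 2 ≤ C)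
    (hCexp : Real.exp (4 * thetaConst) ≤ C) (hCθ : thetaConst ≤ C)
    (hδ : 0 < δ) (hδ1 : δ ≤ 1) (hα : 16 * C ^ 2 ≤ α)
    (hδC : 72 * C ^ 5 * δ ^ 2 ≤ 1)
    (hδk : 240000 * C ^ 10 * absorbConst (Real.sqrt (16 + 2 * n)) * δ ≤ 1)
    (hδθ : 16 * thetaConst * δ ≤ 1) (hlam : lam = α / δ ^ 2)
    (ha : 0 < a) (ht : 0 < t) (htT : t ≤ T) (hτ : lam * (t + a) ≤ 1 / 2)
    (hint : Integrable fun x => gaussG x (t + a) * (conjWeight lam α a t * opL A b V w x t) ^ 2) :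
    1 / (4 * C) * ∫ x, gaussG x (t + a) * (α * (t + a) * ‖gradient (conjFun lam α a w t) x‖ ^ 2
        + α ^ 2 * conjFun lam α a w t x ^ 2)
      ≤ 6 * C * ((t + a) * ∫ x, gaussG x (t + a) * (conjWeight lam α a t * opL A b V w x t) ^ 2)
        + 2500000 * C ^ 9 * (outerBase n δ ^ (2 * α) * α ^ (2 * α))
          * (∫ x, (w x t ^ 2 + ‖gradX w x t‖ ^ 2))
        + ∫ x, boundaryDensityDeriv (fun y => matOp (A y 0)) b₀ V₀ lam α a w x t := by
  have hs : 0 < t + a := by positivity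
  have hα1 : 1 ≤ α := by nlinarith
  have hα0 : 0 < α := by linarith
  have hl : 0 < lam := by rw [hlam]; positivity
  have h0τ : 0 < lam * (t + a) := by positivity
  have hk2 : Real.sqrt (16 + 2 * n) ^ 2 = 16 + 2 * (n : ℝ) := Real.sq_sqrt (by positivity)
  have hk1 : 1 ≤ Real.sqrt (16 + 2 * (n : ℝ)) := Real.one_le_sqrt.2 (by
    have : (0 : ℝ) ≤ n := Nat.cast_nonneg n
    linarith)
  have hγ := gam_bounds hl hs (by linarith)
  have hγ0 := gam_pos lam (t + a)
  have hρ : t + a ≤ rhoFun lam (t + a) := by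
    rw [rhoFun, le_div_iff₀ hγ0]; nlinarith
  have hρC : rhoFun lam (t + a) ≤ C * (t + a) := by
    rw [rhoFun, div_le_iff₀ hγ0]
    have : 1 ≤ C * gam lam (t + a) := by
      calc (1 : ℝ) = Real.exp (4 * thetaConst) * Real.exp (-(4 * thetaConst)) := by
            rw [← Real.exp_add]; simp
        _ ≤ C * gam lam (t + a) := by gcongr; exact hγ.1
    nlinarith
  have hθ := theta_pos h0τ hτ
  have hm : |thetaRate lam (t + a) / 4| ≤ C * (theta (lam * (t + a)) / (t + a)) := by
    rw [abs_div, abs_of_pos (by norm_num : (0 : ℝ) < 4), div_le_iff₀ (by norm_num)]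
    have h1 := abs_theta_deriv_le hl hs hτ
    have h2 : theta (lam * (t + a)) / (t + a) ≤ C * (theta (lam * (t + a)) / (t + a)) :=
      le_mul_of_one_le_left (by positivity) hC
    rw [thetaRate]
    linarith
  have hball := tsupport_conjFun_subset (lam := lam) (α := α) (a := a) hv hK hKs ht.le
  have htI : t ∈ Icc (0 : ℝ) 16 := ⟨ht.le, htT.trans hT16⟩
  have hr2 : ((t + a) ^ (1 / 2 : ℝ)) ^ 2 = t + a := by
    rw [← Real.sqrt_eq_rpow, Real.sq_sqrt hs.le]
  have hℒ : ∀ᵐ x, x ∈ tsupport (conjFun lam α a w t) →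
      (conjWeight lam α a t * opL A b V w x t
      - (antiPart (fun y => matOp (A y 0)) b₀ (t + a) (conjFun lam α a w t) (conjDot lam α a w t) x
        + symPart (fun y => matOp (A y 0)) (t + a) (conjFun lam α a w t) x
        + (α / rhoFun lam (t + a) + (V₀ x - potF (fun y => matOp (A y 0)) b₀ (t + a) x / 2))
          * conjFun lam α a w t x)) ^ 2
      ≤ C * ((t + a) * hessSq (conjFun lam α a w t) x
        + (1 + α ^ 2 * (t + a)) * ‖gradient (conjFun lam α a w t) x‖ ^ 2
        + α ^ 4 * (t + a) * conjFun lam α a w t x ^ 2) := by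
    filter_upwards [(hA.lipschitz hM le_rfl).ae_differentiableAt,
      (hA.lipschitz hM ht.le).ae_differentiableAt] with x hd0 hd1 hx
    have hxb := hball hx
    rw [conj_opL_sub_eq hA hw ha ht hd1]
    have hr : 0 ≤ (t + a) ^ (1 / 2 : ℝ) := by positivity
    have hAd : ‖matOp (A x t) - matOp (A x 0)‖ ≤ c * (t + a) ^ (1 / 2 : ℝ) := by
      have h1 := hA.norm_sub_le hM (x := x) (y := x) ht.le le_rfl
      rw [sub_self, norm_zero, zero_add, sub_zero, abs_of_pos ht] at h1
      have h2 : t ^ (1 / 2 : ℝ) ≤ (t + a) ^ (1 / 2 : ℝ) :=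
        Real.rpow_le_rpow ht.le (by linarith) (by norm_num)
      have h3 : 0 ≤ t ^ (1 / 2 : ℝ) := by positivity
      exact h1.trans (mul_le_mul hcM h2 h3 ((Nat.cast_nonneg n).trans hc))
    have hc1 : 1 ≤ c := le_trans (by exact_mod_cast hn) hc
    have h4 := operator_error_sq_le hn hα0.le hr (contDiff_conjFun (lam := lam) (α := α) (a := a)
      hw ht.le) hd0 hd1 hAd ((hA.norm_fderiv_le hM le_rfl x).trans hcM)
      ((hA.norm_fderiv_le hM ht.le x).trans hcM)
      ((hdiff x hxb t htI).1.trans (by gcongr))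
      ((hdiff x hxb t htI).2.trans (by
        have : α ^ 2 ≤ c * α ^ 2 := le_mul_of_one_le_left (by positivity) hc1
        gcongr))
    rw [hr2] at h4
    refine h4.trans ?_
    have := hessSq_nonneg (conjFun lam α a w t) x
    gcongr
  have main := slice_carleman (A := fun y => matOp (A y 0)) (b := b₀) (V := V₀) (C := C) (α := α)
    (δ := δ) (k := Real.sqrt (16 + 2 * n)) (s := t + a) (f := conjFun lam α a w t)
    (q := conjDot lam α a w t) (hA.lipschitz hM le_rfl).locallyLipschitz hb₀ hV₀
    (contDiff_conjFun hw ht.le) (contDiff_conjDot hw ht.le) (hasCompactSupport_conjFun hv hK ht.le)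
    (hPB.mono fun x hx hxs => hx (hball hxs)) hC hs hδ hδ1 hk1 (by rwa [← hlam]) hα hCθ hδC hδk
    hδθ hρ hρC (by rwa [← hlam]) hℒ hint (outerBound_nonneg (n := n) (α := α) hl hs)
    (fun x hx => gaussG_le_outerBound hl hs (by rwa [← hlam, hk2] at hx))
  rw [← hlam, integral_conj_eq hw ht.le] at main
  have hI : 0 ≤ ∫ x, (w x t ^ 2 + ‖gradX w x t‖ ^ 2) := integral_nonneg fun x => by positivity
  have hO := outerBound_mul_sigma_le (n := n) hα1 hδ hδ1 hs (by rwa [← hlam])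
  rw [← hlam, ← conjWeight_sq hs] at hO
  have h5 : 2500000 * C ^ 9 * outerBound n lam α (t + a) * (conjWeight lam α a t ^ 2
      * ∫ x, (w x t ^ 2 + ‖gradX w x t‖ ^ 2))
      ≤ 2500000 * C ^ 9 * (outerBase n δ ^ (2 * α) * α ^ (2 * α))
          * (∫ x, (w x t ^ 2 + ‖gradX w x t‖ ^ 2)) := by
    calc _ = 2500000 * C ^ 9 * (outerBound n lam α (t + a) * conjWeight lam α a t ^ 2)
        * ∫ x, (w x t ^ 2 + ‖gradX w x t‖ ^ 2) := by ring
      _ ≤ _ := by gcongr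
  unfold boundaryDensityDeriv
  linarith

end SliceConj

end ParabolicCarleman

/-! ### The boundary density at the initial time, and passage to space-time integrals. -/

namespace ParabolicCarleman
variable {n : ℕ}

section Boundary
variable {A : E n → E n →L[ℝ] E n} {b : E n → E n} {V : E n → ℝ} {C α s δ k : ℝ} {x : E n}
  {f : E n → ℝ}

/-- A lower bound for the boundary density. -/
lemma PointBounds.neg_density_le (h : PointBounds A b V C α x) (hs : 0 < s) (hδ : 0 < δ)
    (hδ1 : δ ≤ 1) (hk : 1 ≤ k) (hτ : α / δ ^ 2 * s ≤ 1 / 2) (hα : 16 * C ^ 2 ≤ α)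
    (hCθ : thetaConst ≤ C) (hδk : k ^ 3 * δ ≤ 1) {ρ Bo : ℝ} (hρ : s ≤ ρ) (hρC : ρ ≤ C * s)
    (hBo0 : 0 ≤ Bo)
    (hBo : k ^ 2 * (α * s) * Real.log (1 / (α / δ ^ 2 * s)) < ‖x‖ ^ 2 →
      α ^ 2 / s ^ 2 * gaussG x s ≤ Bo) :
    -(gaussG x s * density A b V s f ρ (α + theta (α / δ ^ 2 * s) / 4) x)
      ≤ -(s / C) * (‖gradient f x‖ ^ 2 * gaussG x s)
        + 22 * C ^ 4 * α * (f x ^ 2 * gaussG x s) + 128 * C ^ 3 * Bo * f x ^ 2 := by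
  have hC := h.one_le
  have hC0 : 0 < C := by linarith
  have hα1 : 1 ≤ α := by nlinarith
  have hα0 : 0 < α := by linarith
  have hCα : C ≤ α := by nlinarith
  set τ := α / δ ^ 2 * s with hτd
  have hτ0 : 0 < τ := by positivity
  have hθ0 := theta_pos hτ0 hτ
  have hθC : theta τ ≤ C := (theta_le hτ0 (hτ.trans (by norm_num))).trans hCθ
  have hαs : α * s ≤ 1 := by
    have e : α * s = δ ^ 2 * τ := by rw [hτd]; field_simp
    have : δ ^ 2 ≤ 1 := pow_le_one₀ hδ.le hδ1
    nlinarith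
  have hs1 : s ≤ 1 := le_trans (le_mul_of_one_le_left hs.le hα1) hαs
  have he := norm_nonneg x
  have he4 := h.norm_le
  have hG := gaussG_pos hs x
  set G := gaussG x s
  set e := ‖x‖
  set u := ‖gradient f x‖
  have hX : s / C * u ^ 2 ≤ ρ * inner ℝ (flux A f x) (gradient f x) := by
    have h1 := h.lower (gradient f x)
    have h2 : 0 ≤ C⁻¹ * u ^ 2 := by positivity
    calc s / C * u ^ 2 = s * (C⁻¹ * u ^ 2) := by ring
      _ ≤ ρ * inner ℝ (flux A f x) (gradient f x) :=
        mul_le_mul hρ h1 h2 (by linarith)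
  have herr : s * errF α s e ≤ 5 * α + e ^ 3 / s := by
    have e1 : s * errF α s e = α * (α * s) + α * e + e ^ 3 / s := by
      unfold errF; field_simp
    have e2 : α * (α * s) ≤ α * 1 := by gcongr
    have e3 : α * e ≤ α * 4 := by gcongr
    linarith
  have hk0 : ρ * (V x - potF A b s x / 2) ≤ 2 * C ^ 3 * (5 * α + e ^ 3 / s) := by
    have h1 := h.abs_potV_le hα1 hs
    have h2 : 0 ≤ |V x - potF A b s x / 2| := abs_nonneg _
    calc ρ * (V x - potF A b s x / 2) ≤ ρ * |V x - potF A b s x / 2| := by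
          gcongr
          · linarith
          · exact le_abs_self _
      _ ≤ C * s * (2 * C ^ 2 * errF α s e) := mul_le_mul hρC h1 h2 (by positivity)
      _ = 2 * C ^ 3 * (s * errF α s e) := by ring
      _ ≤ _ := by gcongr
  have hcoef : α + theta τ / 4 + ρ * (V x - potF A b s x / 2)
      ≤ 12 * C ^ 3 * α + 2 * C ^ 3 * (e ^ 3 / s) := by
    have h1 : 1 ≤ C ^ 3 := one_le_pow₀ hC
    have h2 : α ≤ C ^ 3 * α := le_mul_of_one_le_left hα0.le h1
    linarith
  have hmain : G * ((α + theta τ / 4 + ρ * (V x - potF A b s x / 2)) * f x ^ 2)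
      ≤ 22 * C ^ 4 * α * (f x ^ 2 * G) + 128 * C ^ 3 * Bo * f x ^ 2 := by
    have h34 : C ^ 3 ≤ C ^ 4 := pow_le_pow_right₀ hC (by norm_num)
    have hP : 0 ≤ f x ^ 2 * G := by positivity
    -- Only e³/s may exceed a multiple of α. In the main region k³δ ≤ 1 brings it down to Cα;
    -- outside, it is at most 64α²/s², which the Gaussian tail pays for.
    by_cases hm : e ^ 2 ≤ k ^ 2 * (α * s) * Real.log (1 / τ)
    · obtain ⟨-, h2, -, -⟩ := main_region_bounds hδ hα1 hs hk hτ hm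
      rw [← hτd] at h2
      have h3 : e ^ 3 / s ≤ C * α := by
        rw [div_le_iff₀ hs]
        calc e ^ 3 ≤ k ^ 3 * (α * s) * δ * theta τ := h2
          _ = (k ^ 3 * δ) * (α * s * theta τ) := by ring
          _ ≤ 1 * (α * s * C) := by gcongr
          _ = _ := by ring
      have h4 : α + theta τ / 4 + ρ * (V x - potF A b s x / 2) ≤ 22 * C ^ 4 * α := by
        calc _ ≤ 12 * C ^ 3 * α + 2 * C ^ 3 * (C * α) := hcoef.trans (by gcongr)
          _ ≤ 12 * C ^ 4 * α + 2 * C ^ 4 * α := by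
              have : 12 * C ^ 3 * α ≤ 12 * C ^ 4 * α := by gcongr
              linarith
          _ ≤ _ := by
              have : 0 ≤ C ^ 4 * α := by positivity
              linarith
      have h5 : 0 ≤ 128 * C ^ 3 * Bo * f x ^ 2 := by positivity
      calc _ = (α + theta τ / 4 + ρ * (V x - potF A b s x / 2)) * (f x ^ 2 * G) := by ring
        _ ≤ 22 * C ^ 4 * α * (f x ^ 2 * G) := by gcongr
        _ ≤ _ := by linarith
    · push Not at hm
      have h2 := hBo hm
      have h3 : e ^ 3 / s ≤ 64 * (α ^ 2 / s ^ 2) := by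
        have a1 : e ^ 3 ≤ 4 ^ 3 := by gcongr
        have a2 : 1 / s ≤ α ^ 2 / s ^ 2 := by
          rw [div_le_div_iff₀ hs (by positivity)]
          have : s * s ≤ α ^ 2 * s := by
            gcongr
            exact hs1.trans (one_le_pow₀ hα1)
          linarith
        calc e ^ 3 / s ≤ 4 ^ 3 / s := by gcongr
          _ = 64 * (1 / s) := by ring
          _ ≤ _ := by gcongr
      calc _ = (α + theta τ / 4 + ρ * (V x - potF A b s x / 2)) * (f x ^ 2 * G) := by ring
        _ ≤ (12 * C ^ 3 * α + 2 * C ^ 3 * (64 * (α ^ 2 / s ^ 2))) * (f x ^ 2 * G) := by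
            refine mul_le_mul_of_nonneg_right (hcoef.trans ?_) hP
            gcongr
        _ = 12 * C ^ 3 * α * (f x ^ 2 * G) + 128 * C ^ 3 * (α ^ 2 / s ^ 2 * G) * f x ^ 2 := by ring
        _ ≤ 22 * C ^ 4 * α * (f x ^ 2 * G) + 128 * C ^ 3 * Bo * f x ^ 2 := by
            gcongr
            norm_num
  have hfin := mul_le_mul_of_nonneg_left hX hG.le
  have e1 : G * density A b V s f ρ (α + theta τ / 4) x
      = G * (ρ * inner ℝ (flux A f x) (gradient f x))
        - G * ((α + theta τ / 4 + ρ * (V x - potF A b s x / 2)) * f x ^ 2) := by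
    rw [density]; ring
  rw [e1]
  linarith

end Boundary

section SpaceTime
variable {T : ℝ} {w : E n → ℝ → ℝ} {K : Set (E n × ℝ)}

/-- The two time intervals differ by endpoints, which are null, and the integrand vanishes at
positive times outside the cylinder. -/
lemma setIntegral_cylinder_eq {F : E n × ℝ → ℝ}
    (hKs : K ⊆ Metric.ball (0 : E n) 4 ×ˢ Ico (0 : ℝ) T)
    (hF : ∀ x t, 0 < t → (x, t) ∉ K → F (x, t) = 0) :
    ∫ p in Metric.ball (0 : E n) 4 ×ˢ Ico (0 : ℝ) T, F p
      = ∫ p, F p ∂((volume : Measure (E n)).prod (volume.restrict (Ioc 0 T))) := by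
  have e1 : (volume : Measure (E n × ℝ)).restrict (Metric.ball (0 : E n) 4 ×ˢ Ico (0 : ℝ) T)
      = volume.restrict (Metric.ball (0 : E n) 4 ×ˢ Ioc (0 : ℝ) T) := by
    rw [Measure.volume_eq_prod, ← Measure.prod_restrict, ← Measure.prod_restrict,
      restrict_Ico_eq_restrict_Ioc]
  have e2 : (volume : Measure (E n)).prod (volume.restrict (Ioc 0 T))
      = volume.restrict ((univ : Set (E n)) ×ˢ Ioc (0 : ℝ) T) := by
    rw [Measure.volume_eq_prod, ← Measure.prod_restrict, Measure.restrict_univ]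
  rw [e1, e2]
  refine (setIntegral_eq_of_subset_of_forall_sdiff_eq_zero
    (MeasurableSet.univ.prod measurableSet_Ioc) (prod_mono_left (subset_univ _)) ?_).symm
  rintro ⟨x, t⟩ ⟨hp, hp'⟩
  refine hF x t hp.2.1 fun h => hp' ⟨(hKs h).1, hp.2⟩

/-- Needed because a real supremum over an unbounded family takes the default value 0, and would
then bound nothing. -/
lemma bddAbove_energy (hw : SmoothHalf w) (hv : VanishOff K w) (hK : IsCompact K)
    (hKs : K ⊆ Metric.ball (0 : E n) 4 ×ˢ Ico (0 : ℝ) T) :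
    BddAbove (range fun t : Ici (0 : ℝ) => ∫ x : E n, (w x t ^ 2 + ‖gradX w x t‖ ^ 2)) := by
  obtain ⟨B₁, hB₁, h1⟩ := exists_bound_slab hK (hw.continuousOn.mono
    (slab_subset_halfSpace (T := T))) hv
  obtain ⟨B₂, hB₂, h2⟩ := exists_bound_slab hK (hw.gradX.continuousOn.mono
    (slab_subset_halfSpace (T := T))) (hv.gradX hK.isClosed)
  have hK1 : IsCompact (Prod.fst '' K) := hK.image continuous_fst
  refine ⟨(B₁ ^ 2 + B₂ ^ 2) * volume.real (Prod.fst '' K), ?_⟩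
  rintro _ ⟨⟨t, ht⟩, rfl⟩
  have ht0 : 0 ≤ t := ht
  have hz : ∀ x, (x, t) ∉ K → w x t ^ 2 + ‖gradX w x t‖ ^ 2 = 0 := fun x hx => by
    rw [hv x t ht0 hx, hv.gradX hK.isClosed x t ht0 hx]; simp
  have e : ∫ x : E n, (w x t ^ 2 + ‖gradX w x t‖ ^ 2)
      = ∫ x in Prod.fst '' K, (w x t ^ 2 + ‖gradX w x t‖ ^ 2) :=
    (setIntegral_eq_integral_of_forall_compl_eq_zero fun x hx =>
      hz x fun h => hx (mem_image_of_mem Prod.fst h)).symm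
  change ∫ x : E n, (w x t ^ 2 + ‖gradX w x t‖ ^ 2) ≤ _
  rw [e]
  refine (Real.le_norm_self _).trans (norm_setIntegral_le_of_norm_le_const hK1.measure_lt_top
    fun x _ => ?_)
  by_cases hx : (x, t) ∈ K
  · have htI : t ∈ Icc 0 T := ⟨ht0, (hKs hx).2.2.le⟩
    have a1 := h1 x t htI
    have a2 := h2 x t htI
    rw [Real.norm_of_nonneg (by positivity)]
    rw [Real.norm_eq_abs] at a1
    rw [← sq_abs (w x t)]
    gcongr
  · rw [hz x hx, norm_zero]; positivity

lemma integrable_slice {F : E n → ℝ} (hF : Continuous F) (hK : IsCompact K) {t : ℝ}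
    (h0 : ∀ x, (x, t) ∉ K → F x = 0) : Integrable F :=
  hF.integrable_of_hasCompactSupport (HasCompactSupport.intro (hK.image continuous_fst)
    fun x hx => h0 x fun h => hx (mem_image_of_mem Prod.fst h))

end SpaceTime

end ParabolicCarleman

/-! ### The space-time inequality for the conjugated function. -/

namespace ParabolicCarleman
variable {n : ℕ}

section Integrated
variable {Λ M T C c α δ a lam : ℝ} {w : E n → ℝ → ℝ} {K : Set (E n × ℝ)}
  {A : E n → ℝ → Matrix (Fin n) (Fin n) ℝ} {b : E n → ℝ → E n} {V : E n → ℝ → ℝ}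
  {b₀ : E n → E n} {V₀ : E n → ℝ}

/-- The Carleman inequality for the conjugated function, integrated in space-time. -/
lemma carleman_conj (hn : 1 ≤ n) (hA : IsAdmissible Λ M A) (hM : 0 ≤ M) (h0 : A 0 0 = 1)
    (hb : ∀ i, FiniteNorm fun x t => b x t i) (hV : FiniteNorm V)
    (hw : SmoothHalf w) (hv : VanishOff K w)
    (hK : IsCompact K) (hKs : K ⊆ Metric.ball (0 : E n) 4 ×ˢ Ico (0 : ℝ) T) (hT0 : 0 ≤ T)
    (hT1 : T ≤ 1)
    (hb₀ : LocallyLipschitz b₀) (hV₀ : LocallyLipschitz V₀)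
    (hPB : ∀ᵐ x, x ∈ Metric.ball (0 : E n) 4 →
      PointBounds (fun y => matOp (A y 0)) b₀ V₀ C α x)
    (hdiff : ∀ x ∈ Metric.ball (0 : E n) 4, ∀ t ∈ Icc (0 : ℝ) 16,
      ‖b x t - b₀ x‖ ≤ n * α * (t + a) ^ (1 / 2 : ℝ) ∧
        |V x t - V₀ x| ≤ α ^ 2 * (t + a) ^ (1 / 2 : ℝ))
    (hC : 1 ≤ C) (hc : n ≤ c) (hcM : n ^ 2 * M ≤ c) (hcC : 16 * (n * c) ^ 2 ≤ C)
    (hCexp : Real.exp (4 * thetaConst) ≤ C) (hCθ : thetaConst ≤ C)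
    (hδ : 0 < δ) (hδ1 : δ ≤ 1) (hα : 16 * C ^ 2 ≤ α)
    (hδC : 72 * C ^ 5 * δ ^ 2 ≤ 1)
    (hδk : 240000 * C ^ 10 * absorbConst (Real.sqrt (16 + 2 * n)) * δ ≤ 1)
    (hδθ : 16 * thetaConst * δ ≤ 1) (hlam : lam = α / δ ^ 2)
    (ha : 0 < a) (hτ : lam * (T + a) ≤ 1 / 2) {S : ℝ}
    (hS : ∀ t, 0 ≤ t → ∫ x, (w x t ^ 2 + ‖gradX w x t‖ ^ 2) ≤ S) :
    1 / (4 * C) * ∫ p, gaussG p.1 (p.2 + a)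
          * (α * (p.2 + a) * ‖gradient (conjFun lam α a w p.2) p.1‖ ^ 2
            + α ^ 2 * conjFun lam α a w p.2 p.1 ^ 2)
          ∂((volume : Measure (E n)).prod (volume.restrict (Ioc 0 T)))
      ≤ 6 * C * (∫ p, (p.2 + a) * gaussG p.1 (p.2 + a) * conjWeight lam α a p.2 ^ 2
            * opL A b V w p.1 p.2 ^ 2
          ∂((volume : Measure (E n)).prod (volume.restrict (Ioc 0 T))))
        + 2500000 * C ^ 9 * (outerBase n δ ^ (2 * α) * α ^ (2 * α)) * S
        - ∫ x, boundaryDensity (fun y => matOp (A y 0)) b₀ V₀ lam α a w x 0 := by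
  have hα0 : 0 < α := by nlinarith
  have hl : 0 < lam := by rw [hlam]; positivity
  have hS0 : 0 ≤ S := le_trans (integral_nonneg fun x => by positivity) (hS 0 le_rfl)
  have hKcl := hK.isClosed
  have hA0 := (hA.lipschitz hM le_rfl).locallyLipschitz
  have cG := continuousOn_slab_gaussG (n := n) (T := T) ha
  have cs : ContinuousOn (fun p : E n × ℝ => p.2 + a) (slab n T) := by fun_prop
  have cκ := continuousOn_slab_conjWeight (n := n) (α := α) hl ha hτ
  have i1 : Integrable (fun p : E n × ℝ => gaussG p.1 (p.2 + a)
          * (α * (p.2 + a) * ‖gradient (conjFun lam α a w p.2) p.1‖ ^ 2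
            + α ^ 2 * conjFun lam α a w p.2 p.1 ^ 2))
          ((volume : Measure (E n)).prod (volume.restrict (Ioc 0 T))) := by
    refine integrable_slab hK (cG.mul (((continuousOn_const.mul cs).mul
      ((continuousOn_slab_gradient_conjFun hw hl ha hτ).norm.pow 2)).add
      (continuousOn_const.mul ((continuousOn_slab_conjFun hw hl ha hτ).pow 2))))
      fun p hp hpK => ?_
    have hz1 := conjFun_vanish (lam := lam) (α := α) (a := a) hv hp.2.1 hpK
    have hz2 := gradient_conjFun_vanish (lam := lam) (α := α) (a := a) hw hv hKcl hp.2.1 hpK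
    simp [hz1, hz2]
  have i2 := integrable_mul_opL_sq (W := fun p : E n × ℝ => (p.2 + a) * gaussG p.1 (p.2 + a)
    * conjWeight lam α a p.2 ^ 2) hA hM h0 hb hV hw hv hK hKs (by linarith)
    ((cs.mul cG).mul (cκ.pow 2))
  have i2' := integrable_mul_opL_sq (W := fun p : E n × ℝ => gaussG p.1 (p.2 + a)
    * conjWeight lam α a p.2 ^ 2) hA hM h0 hb hV hw hv hK hKs (by linarith)
    (cG.mul (cκ.pow 2))
  have i3 := integrable_boundaryDensityDeriv (α := α) hw hv hK hA0 hb₀ hV₀ hl ha hτ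
  have e3 := integral_boundaryDensityDeriv (α := α) hw hv hK hA0 hb₀ hV₀
    (fun x => hA.inner_comm le_rfl) hl ha hT0 hτ fun x hx => lt_irrefl _ (hKs hx).2.2
  set X := 2500000 * C ^ 9 * (outerBase n δ ^ (2 * α) * α ^ (2 * α)) with hX
  have hX0 : 0 ≤ X := by
    have : 0 < outerBase n δ := Real.exp_pos _
    positivity
  have hle : ∫ t in Ioc 0 T, (1 / (4 * C) * ∫ x, gaussG x (t + a)
        * (α * (t + a) * ‖gradient (conjFun lam α a w t) x‖ ^ 2
            + α ^ 2 * conjFun lam α a w t x ^ 2))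
      ≤ ∫ t in Ioc 0 T, (6 * C * (∫ x, (t + a) * gaussG x (t + a) * conjWeight lam α a t ^ 2
          * opL A b V w x t ^ 2) + X * S
        + ∫ x, boundaryDensityDeriv (fun y => matOp (A y 0)) b₀ V₀ lam α a w x t) := by
    refine integral_mono_ae (i1.integral_prod_right.const_mul _)
      (((i2.integral_prod_right.const_mul _).add (integrable_const _)).add
        i3.integral_prod_right) ?_
    filter_upwards [i2'.prod_left_ae, ae_restrict_mem measurableSet_Ioc] with t ht htI
    have hint : Integrable fun x => gaussG x (t + a)
        * (conjWeight lam α a t * opL A b V w x t) ^ 2 := by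
      refine ht.congr (Filter.Eventually.of_forall fun x => ?_)
      simp only
      ring
    have hτt : lam * (t + a) ≤ 1 / 2 := le_trans (by gcongr; exact htI.2) hτ
    have h1 := slice_carleman_conj hn hA hM hw hv hK hKs (by linarith) hb₀ hV₀ hPB hdiff hC hc hcM
      hcC hCexp hCθ hδ hδ1 hα hδC hδk hδθ hlam ha htI.1 htI.2 hτt hint
    have h2 : (t + a) * ∫ x, gaussG x (t + a) * (conjWeight lam α a t * opL A b V w x t) ^ 2
        = ∫ x, (t + a) * gaussG x (t + a) * conjWeight lam α a t ^ 2 * opL A b V w x t ^ 2 := by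
      rw [← integral_const_mul]
      refine integral_congr_ae (Filter.Eventually.of_forall fun x => ?_)
      simp only
      ring
    rw [h2] at h1
    refine h1.trans ?_
    have h3 := mul_le_mul_of_nonneg_left (hS t htI.1.le) hX0
    linarith
  have j1 : Integrable (fun t => 6 * C * ∫ x, (t + a) * gaussG x (t + a)
      * conjWeight lam α a t ^ 2 * opL A b V w x t ^ 2) (volume.restrict (Ioc 0 T)) :=
    i2.integral_prod_right.const_mul (6 * C)
  have j2 : Integrable (fun _ : ℝ => X * S) (volume.restrict (Ioc 0 T)) := integrable_const _
  have j12 : Integrable (fun t => 6 * C * (∫ x, (t + a) * gaussG x (t + a)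
      * conjWeight lam α a t ^ 2 * opL A b V w x t ^ 2) + X * S) (volume.restrict (Ioc 0 T)) :=
    j1.add j2
  have j3 : Integrable (fun t => ∫ x, boundaryDensityDeriv (fun y => matOp (A y 0)) b₀ V₀ lam α a
      w x t) (volume.restrict (Ioc 0 T)) := i3.integral_prod_right
  rw [integral_const_mul, integral_add j12 j3, e3, integral_add j1 j2, integral_const_mul] at hle
  rw [integral_prod_symm _ i1, integral_prod_symm _ i2]
  -- The outer error is bounded uniformly in t, so T ≤ 1 makes its time integral harmless.
  have hT : ∫ _t in Ioc 0 T, X * S ≤ X * S := by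
    rw [setIntegral_const]
    simp only [Real.volume_real_Ioc_of_le hT0, sub_zero, smul_eq_mul]
    exact mul_le_of_le_one_left (by positivity) hT1
  linarith

/-- The boundary terms at the initial time. -/
lemma neg_integral_boundaryDensity_le (hA : IsAdmissible Λ M A) (hM : 0 ≤ M)
    (hw : SmoothHalf w) (hv : VanishOff K w)
    (hK : IsCompact K) (hKs : K ⊆ Metric.ball (0 : E n) 4 ×ˢ Ico (0 : ℝ) T)
    (hb₀ : LocallyLipschitz b₀) (hV₀ : LocallyLipschitz V₀)
    (hPB : ∀ᵐ x, x ∈ Metric.ball (0 : E n) 4 →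
      PointBounds (fun y => matOp (A y 0)) b₀ V₀ C α x)
    (hC : 1 ≤ C) (hCexp : Real.exp (4 * thetaConst) ≤ C) (hCθ : thetaConst ≤ C)
    (hδ : 0 < δ) (hδ1 : δ ≤ 1) (hα : 16 * C ^ 2 ≤ α)
    (hδk : Real.sqrt (16 + 2 * n) ^ 3 * δ ≤ 1) (hlam : lam = α / δ ^ 2)
    (ha : 0 < a) (hτ : lam * a ≤ 1 / 2) {S : ℝ}
    (hS : ∫ x, (w x 0 ^ 2 + ‖gradX w x 0‖ ^ 2) ≤ S) :
    -∫ x, boundaryDensity (fun y => matOp (A y 0)) b₀ V₀ lam α a w x 0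
      ≤ sigma lam a ^ (-2 * α) * (-(a / C) * (∫ x, ‖gradX w x 0‖ ^ 2 * gaussG x a)
          + 22 * C ^ 4 * α * ∫ x, w x 0 ^ 2 * gaussG x a)
        + 128 * C ^ 3 * (outerBase n δ ^ (2 * α) * α ^ (2 * α)) * S := by
  have hα1 : 1 ≤ α := by nlinarith
  have hα0 : 0 < α := by linarith
  have hl : 0 < lam := by rw [hlam]; positivity
  have h0τ : 0 < lam * a := by positivity
  have hKcl := hK.isClosed
  have hk2 : Real.sqrt (16 + 2 * n) ^ 2 = 16 + 2 * (n : ℝ) := Real.sq_sqrt (by positivity)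
  have hk1 : 1 ≤ Real.sqrt (16 + 2 * (n : ℝ)) := Real.one_le_sqrt.2 (by
    have : (0 : ℝ) ≤ n := Nat.cast_nonneg n
    linarith)
  have hγ := gam_bounds hl ha (by linarith)
  have hγ0 := gam_pos lam a
  have hρ : a ≤ rhoFun lam a := by
    rw [rhoFun, le_div_iff₀ hγ0]; nlinarith
  have hρC : rhoFun lam a ≤ C * a := by
    rw [rhoFun, div_le_iff₀ hγ0]
    have : 1 ≤ C * gam lam a := by
      calc (1 : ℝ) = Real.exp (4 * thetaConst) * Real.exp (-(4 * thetaConst)) := by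
            rw [← Real.exp_add]; simp
        _ ≤ C * gam lam a := by gcongr; exact hγ.1
    nlinarith
  have hcp : Continuous fun x : E n => gradX w x 0 := (hw.gradX.contDiff_slice le_rfl).continuous
  have hcw : Continuous fun x : E n => w x 0 := (hw.contDiff_slice le_rfl).continuous
  have hcG : Continuous fun x : E n => gaussG x a := (contDiff_gaussG a).continuous
  have hzw : ∀ x, (x, 0) ∉ K → w x 0 = 0 := fun x hx => hv x 0 le_rfl hx
  have hzp : ∀ x, (x, 0) ∉ K → gradX w x 0 = 0 := fun x hx => hv.gradX hKcl x 0 le_rfl hx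
  have i1 : Integrable fun x : E n => ‖gradX w x 0‖ ^ 2 * gaussG x a :=
    integrable_slice (by fun_prop) hK fun x hx => by rw [hzp x hx]; simp
  have i2 : Integrable fun x : E n => w x 0 ^ 2 * gaussG x a :=
    integrable_slice (by fun_prop) hK fun x hx => by rw [hzw x hx]; simp
  have i3 : Integrable fun x : E n => w x 0 ^ 2 :=
    integrable_slice (by fun_prop) hK fun x hx => by rw [hzw x hx]; simp
  have i4 : Integrable fun x : E n => w x 0 ^ 2 + ‖gradX w x 0‖ ^ 2 :=
    integrable_slice (by fun_prop) hK fun x hx => by rw [hzw x hx, hzp x hx]; simp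
  have hτ' : lam * (0 + a) ≤ 1 / 2 := by rwa [zero_add]
  have i5 : Integrable fun x : E n =>
      boundaryDensity (fun y => matOp (A y 0)) b₀ V₀ lam α a w x 0 := by
    refine integrable_slice ?_ hK fun x hx => boundaryDensity_vanish hw hv hKcl le_rfl hx
    exact (continuousOn_slab_boundaryDensity (T := 0) hw (hA.lipschitz hM le_rfl).locallyLipschitz
      hb₀ hV₀ hl ha hτ').comp_continuous (f := fun x : E n => (x, (0 : ℝ))) (by fun_prop)
      fun x => ⟨mem_univ _, mem_Icc.2 ⟨le_rfl, le_rfl⟩⟩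
  set κ := sigma lam a ^ (-2 * α) with hκ
  have hκ2 : conjWeight lam α a 0 ^ 2 = κ := by rw [conjWeight_sq (by linarith), zero_add]
  have hκ0 : 0 ≤ κ := by rw [← hκ2]; positivity
  set Bo := outerBound n lam α a
  have hBo0 : 0 ≤ Bo := outerBound_nonneg hl ha
  have hBoκ : Bo * κ ≤ outerBase n δ ^ (2 * α) * α ^ (2 * α) := by
    have := outerBound_mul_sigma_le (n := n) hα1 hδ hδ1 ha (by rwa [← hlam])
    rwa [← hlam] at this
  have hpt : ∀ᵐ x : E n, -boundaryDensity (fun y => matOp (A y 0)) b₀ V₀ lam α a w x 0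
      ≤ κ * (-(a / C)) * (‖gradX w x 0‖ ^ 2 * gaussG x a)
        + κ * (22 * C ^ 4 * α) * (w x 0 ^ 2 * gaussG x a)
        + 128 * C ^ 3 * (Bo * κ) * w x 0 ^ 2 := by
    filter_upwards [hPB] with x hx
    by_cases hxb : x ∈ Metric.ball (0 : E n) 4
    · have h1 := (hx hxb).neg_density_le (f := conjFun lam α a w 0) ha hδ hδ1 hk1
        (by rwa [← hlam]) hα hCθ hδk hρ hρC hBo0
        (fun h => gaussG_le_outerBound hl ha (by rwa [← hlam, hk2] at h))
      rw [← hlam, gradient_conjFun hw le_rfl, norm_smul, mul_pow, Real.norm_eq_abs, sq_abs, hκ2]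
        at h1
      have e : conjFun lam α a w 0 x ^ 2 = κ * w x 0 ^ 2 := by rw [conjFun, mul_pow, hκ2]
      rw [e] at h1
      rw [boundaryDensity, zero_add]
      refine h1.trans (le_of_eq ?_)
      ring
    · have hxK : (x, (0 : ℝ)) ∉ K := fun h => hxb (hKs h).1
      rw [boundaryDensity_vanish hw hv hKcl le_rfl hxK, hzw x hxK, hzp x hxK]
      simp
  have hI := integral_mono_ae i5.neg (((i1.const_mul (κ * (-(a / C)))).add
    (i2.const_mul (κ * (22 * C ^ 4 * α)))).add (i3.const_mul (128 * C ^ 3 * (Bo * κ)))) hpt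
  rw [integral_neg', integral_add' ((i1.const_mul _).add (i2.const_mul _)) (i3.const_mul _),
    integral_add' (i1.const_mul _) (i2.const_mul _), integral_const_mul, integral_const_mul,
    integral_const_mul] at hI
  -- At t = 0 the outer error involves w only, because the gradient term has the favourable sign
  -- throughout.
  have hw2 : ∫ x, w x 0 ^ 2 ≤ S := le_trans (integral_mono i3 i4 fun x => by
    simp only; have := sq_nonneg ‖gradX w x 0‖; linarith) hS
  have hw0 : 0 ≤ ∫ x, w x 0 ^ 2 := integral_nonneg fun x => sq_nonneg _
  have h5 : 128 * C ^ 3 * (Bo * κ) * ∫ x, w x 0 ^ 2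
      ≤ 128 * C ^ 3 * (outerBase n δ ^ (2 * α) * α ^ (2 * α)) * S := by
    have : 0 ≤ Bo * κ := by positivity
    have : 0 ≤ outerBase n δ ^ (2 * α) * α ^ (2 * α) := this.trans hBoκ
    gcongr
  linarith

end Integrated

end ParabolicCarleman

/-! ### Return to w, and the choice of the small parameter. -/

namespace ParabolicCarleman
variable {n : ℕ}

section Comparison
variable {Λ M T C α a lam : ℝ} {w : E n → ℝ → ℝ} {K : Set (E n × ℝ)}
  {A : E n → ℝ → Matrix (Fin n) (Fin n) ℝ} {b : E n → ℝ → E n} {V : E n → ℝ → ℝ}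

lemma sigma_rpow_eq {s : ℝ} (hs : 0 < s) :
    sigma lam s ^ (1 - 2 * α) = sigma lam s * sigma lam s ^ (-2 * α) := by
  rw [sub_eq_add_neg, Real.rpow_add (sigma_pos hs), Real.rpow_one, neg_mul]

lemma continuousOn_slab_sigma_rpow (hl : 0 < lam) (ha : 0 < a) (hT : lam * (T + a) ≤ 1 / 2)
    (r : ℝ) : ContinuousOn (fun p : E n × ℝ => sigma lam (p.2 + a) ^ r) (slab n T) :=
  continuousOn_slab_of_time (g := fun s => sigma lam s ^ r) hl ha hT fun s hs h =>
    (hasDerivAt_sigma hl hs (by linarith)).continuousAt.rpow_const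
      (Or.inl (sigma_pos hs).ne')

lemma ae_mem_prod_Ioc (T : ℝ) :
    ∀ᵐ p : E n × ℝ ∂((volume : Measure (E n)).prod (volume.restrict (Ioc 0 T))),
      p ∈ (univ : Set (E n)) ×ˢ Ioc (0 : ℝ) T := by
  have e : (volume : Measure (E n)).prod (volume.restrict (Ioc 0 T))
      = volume.restrict ((univ : Set (E n)) ×ˢ Ioc (0 : ℝ) T) := by
    rw [Measure.volume_eq_prod, ← Measure.prod_restrict, Measure.restrict_univ]
  rw [e]
  exact ae_restrict_mem (MeasurableSet.univ.prod measurableSet_Ioc)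

/-- The left hand side in terms of the conjugated function. -/
lemma weighted_energy_le (hw : SmoothHalf w) (hv : VanishOff K w) (hK : IsCompact K)
    (hKs : K ⊆ Metric.ball (0 : E n) 4 ×ˢ Ico (0 : ℝ) T) (hα : 0 < α) (hl : 0 < lam) (ha : 0 < a)
    (hτ : lam * (T + a) ≤ 1 / 2) :
    α ^ 2 * (∫ p in Metric.ball (0 : E n) 4 ×ˢ Ico (0 : ℝ) T,
        sigma lam (p.2 + a) ^ (-2 * α) * w p.1 p.2 ^ 2 * gaussG p.1 (p.2 + a))
      + α * (∫ p in Metric.ball (0 : E n) 4 ×ˢ Ico (0 : ℝ) T,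
        sigma lam (p.2 + a) ^ (1 - 2 * α) * ‖gradX w p.1 p.2‖ ^ 2 * gaussG p.1 (p.2 + a))
    ≤ ∫ p, gaussG p.1 (p.2 + a)
          * (α * (p.2 + a) * ‖gradient (conjFun lam α a w p.2) p.1‖ ^ 2
            + α ^ 2 * conjFun lam α a w p.2 p.1 ^ 2)
          ∂((volume : Measure (E n)).prod (volume.restrict (Ioc 0 T))) := by
  have hKcl := hK.isClosed
  have cG := continuousOn_slab_gaussG (n := n) (T := T) ha
  have cs : ContinuousOn (fun p : E n × ℝ => p.2 + a) (slab n T) := by fun_prop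
  have cw := hw.continuousOn.mono (slab_subset_halfSpace (T := T))
  have cp := hw.gradX.continuousOn.mono (slab_subset_halfSpace (T := T))
  have zw : ∀ x t, 0 ≤ t → (x, t) ∉ K → w x t = 0 := hv
  have zp : ∀ x t, 0 ≤ t → (x, t) ∉ K → gradX w x t = 0 := hv.gradX hKcl
  rw [setIntegral_cylinder_eq hKs fun x t ht hx => by simp [zw x t ht.le hx],
    setIntegral_cylinder_eq hKs fun x t ht hx => by simp [zp x t ht.le hx]]
  have i1 : Integrable (fun p : E n × ℝ => sigma lam (p.2 + a) ^ (-2 * α) * w p.1 p.2 ^ 2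
      * gaussG p.1 (p.2 + a)) ((volume : Measure (E n)).prod (volume.restrict (Ioc 0 T))) :=
    integrable_slab hK (((continuousOn_slab_sigma_rpow hl ha hτ _).mul (cw.pow 2)).mul cG)
      fun p hp hpK => by simp [zw p.1 p.2 hp.2.1 hpK]
  have i2 : Integrable (fun p : E n × ℝ => sigma lam (p.2 + a) ^ (1 - 2 * α)
      * ‖gradX w p.1 p.2‖ ^ 2 * gaussG p.1 (p.2 + a))
      ((volume : Measure (E n)).prod (volume.restrict (Ioc 0 T))) :=
    integrable_slab hK (((continuousOn_slab_sigma_rpow hl ha hτ _).mul (cp.norm.pow 2)).mul cG)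
      fun p hp hpK => by simp [zp p.1 p.2 hp.2.1 hpK]
  have i3 : Integrable (fun p : E n × ℝ => gaussG p.1 (p.2 + a)
          * (α * (p.2 + a) * ‖gradient (conjFun lam α a w p.2) p.1‖ ^ 2
            + α ^ 2 * conjFun lam α a w p.2 p.1 ^ 2))
          ((volume : Measure (E n)).prod (volume.restrict (Ioc 0 T))) :=
    integrable_slab hK (cG.mul (((continuousOn_const.mul cs).mul
      ((continuousOn_slab_gradient_conjFun hw hl ha hτ).norm.pow 2)).add
      (continuousOn_const.mul ((continuousOn_slab_conjFun hw hl ha hτ).pow 2))))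
      fun p hp hpK => by
        simp [conjFun_vanish (lam := lam) (α := α) (a := a) hv hp.2.1 hpK,
          gradient_conjFun_vanish (lam := lam) (α := α) (a := a) hw hv hKcl hp.2.1 hpK]
  rw [← integral_const_mul, ← integral_const_mul, ← integral_add (i1.const_mul _) (i2.const_mul _)]
  refine integral_mono_ae ((i1.const_mul _).add (i2.const_mul _)) i3 ?_
  filter_upwards [ae_mem_prod_Ioc (n := n) T] with p hp
  have ht : 0 < p.2 := hp.2.1
  have hs : 0 < p.2 + a := by positivity
  have hτt : lam * (p.2 + a) ≤ 1 / 2 := le_trans (by gcongr; exact hp.2.2) hτ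
  -- On the left σ is enlarged to s; for the term with Lw the opposite comparison s ≤ Cσ is needed,
  -- and that is where exp(16 `thetaConst`) enters C.
  have hσ := (sigma_bounds hl hs (by linarith)).2
  have hG := gaussG_pos hs p.1
  rw [gradient_conjFun hw ht.le, norm_smul, mul_pow, Real.norm_eq_abs, sq_abs,
    sigma_rpow_eq hs, ← conjWeight_sq hs, conjFun]
  have : α * (sigma lam (p.2 + a) * conjWeight lam α a p.2 ^ 2 * ‖gradX w p.1 p.2‖ ^ 2
      * gaussG p.1 (p.2 + a)) ≤ α * ((p.2 + a) * conjWeight lam α a p.2 ^ 2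
      * ‖gradX w p.1 p.2‖ ^ 2 * gaussG p.1 (p.2 + a)) := by gcongr
  linarith

/-- The right hand side in terms of the conjugated operator. -/
lemma conj_opL_sq_le (hA : IsAdmissible Λ M A) (hM : 0 ≤ M) (h0 : A 0 0 = 1)
    (hb : ∀ i, FiniteNorm fun x t => b x t i) (hV : FiniteNorm V)
    (hw : SmoothHalf w) (hv : VanishOff K w) (hK : IsCompact K)
    (hKs : K ⊆ Metric.ball (0 : E n) 4 ×ˢ Ico (0 : ℝ) T) (hT16 : T ≤ 16) (hl : 0 < lam)
    (ha : 0 < a) (hτ : lam * (T + a) ≤ 1 / 2) (hC : Real.exp (16 * thetaConst) ≤ C) :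
    ∫ p, (p.2 + a) * gaussG p.1 (p.2 + a) * conjWeight lam α a p.2 ^ 2
            * opL A b V w p.1 p.2 ^ 2
          ∂((volume : Measure (E n)).prod (volume.restrict (Ioc 0 T)))
      ≤ C * ∫ p in Metric.ball (0 : E n) 4 ×ˢ Ico (0 : ℝ) T,
        sigma lam (p.2 + a) ^ (1 - 2 * α) * opL A b V w p.1 p.2 ^ 2 * gaussG p.1 (p.2 + a) := by
  have cG := continuousOn_slab_gaussG (n := n) (T := T) ha
  have cs : ContinuousOn (fun p : E n × ℝ => p.2 + a) (slab n T) := by fun_prop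
  have i1 := integrable_mul_opL_sq (W := fun p : E n × ℝ => (p.2 + a) * gaussG p.1 (p.2 + a)
    * conjWeight lam α a p.2 ^ 2) hA hM h0 hb hV hw hv hK hKs hT16
    ((cs.mul cG).mul ((continuousOn_slab_conjWeight hl ha hτ).pow 2))
  have i2 := integrable_mul_opL_sq (W := fun p : E n × ℝ => sigma lam (p.2 + a) ^ (1 - 2 * α)
    * gaussG p.1 (p.2 + a)) hA hM h0 hb hV hw hv hK hKs hT16
    ((continuousOn_slab_sigma_rpow hl ha hτ _).mul cG)
  have i2' : Integrable (fun p : E n × ℝ => sigma lam (p.2 + a) ^ (1 - 2 * α)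
      * opL A b V w p.1 p.2 ^ 2 * gaussG p.1 (p.2 + a))
      ((volume : Measure (E n)).prod (volume.restrict (Ioc 0 T))) :=
    i2.congr (Filter.Eventually.of_forall fun p => by simp only; ring)
  rw [setIntegral_cylinder_eq hKs fun x t ht hx => by
    simp [opL_vanish (A := A) (b := b) (V := V) hw hv hK.isClosed ht hx], ← integral_const_mul]
  refine integral_mono_ae i1 (i2'.const_mul C) ?_
  filter_upwards [ae_mem_prod_Ioc (n := n) T] with p hp
  have hs : 0 < p.2 + a := by linarith [hp.2.1]
  have hτt : lam * (p.2 + a) ≤ 1 / 2 := le_trans (by gcongr; exact hp.2.2) hτ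
  have hσ := (sigma_bounds hl hs (by linarith)).1
  have hC0 : 0 ≤ C := (Real.exp_pos _).le.trans hC
  have hσC : p.2 + a ≤ C * sigma lam (p.2 + a) := by
    calc p.2 + a = Real.exp (16 * thetaConst) * ((p.2 + a) * Real.exp (-(16 * thetaConst))) := by
          rw [mul_left_comm, ← Real.exp_add]; simp
      _ ≤ C * sigma lam (p.2 + a) := by gcongr
  have hG := gaussG_pos hs p.1
  rw [sigma_rpow_eq hs, ← conjWeight_sq hs]
  calc (p.2 + a) * gaussG p.1 (p.2 + a) * conjWeight lam α a p.2 ^ 2 * opL A b V w p.1 p.2 ^ 2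
      ≤ (C * sigma lam (p.2 + a)) * gaussG p.1 (p.2 + a) * conjWeight lam α a p.2 ^ 2
        * opL A b V w p.1 p.2 ^ 2 := by gcongr
    _ = _ := by ring

end Comparison

section Constants

lemma outerBase_ge_one {δ : ℝ} (hδ : 0 < δ) (hδ1 : δ ≤ 1) : 1 ≤ outerBase n δ := by
  have h1 := Real.log_nonpos hδ.le hδ1
  have h2 := thetaConst_ge_one
  refine Real.one_le_exp ?_
  have h3 : 0 ≤ (4 + (n : ℝ) / 2) * (-Real.log δ) := mul_nonneg (by positivity) (by linarith)
  have h4 : (0 : ℝ) ≤ n / 4 := by positivity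
  linarith

/-- The choice of the small parameter. -/
lemma exists_small_parameter {C k : ℝ} (hC : 1 ≤ C) (hk : 1 ≤ k) :
    ∃ δ : ℝ, 0 < δ ∧ δ < 1 ∧ 72 * C ^ 5 * δ ^ 2 ≤ 1 ∧ 240000 * C ^ 10 * absorbConst k * δ ≤ 1 ∧
      16 * thetaConst * δ ≤ 1 ∧ k ^ 3 * δ ≤ 1 := by
  have hθ := thetaConst_ge_one
  have hC0 : 0 < C := by linarith
  have hk0 : 0 < k := by linarith
  have hab : 0 < absorbConst k := by unfold absorbConst; positivity
  -- The sum of all factors that δ has to beat, so that δ = 1/D meets every condition; the 2 forces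
  -- δ < 1, and then δ² ≤ δ.
  set D := 72 * C ^ 5 + 240000 * C ^ 10 * absorbConst k + 16 * thetaConst + k ^ 3 + 2 with hD
  have h1 : 0 < 72 * C ^ 5 := by positivity
  have h2 : 0 < 240000 * C ^ 10 * absorbConst k := by positivity
  have h3 : 0 < k ^ 3 := by positivity
  have hD2 : 2 ≤ D := by linarith
  have hD0 : 0 < D := by linarith
  have key : ∀ y, y ≤ D → y * (1 / D) ≤ 1 := fun y hy => by
    rw [mul_one_div, div_le_one hD0]; exact hy
  refine ⟨1 / D, by positivity, by rw [div_lt_one hD0]; linarith, ?_, key _ (by linarith),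
    key _ (by linarith), key _ (by linarith)⟩
  have h4 : (1 / D) ^ 2 ≤ 1 / D := by
    rw [sq]
    exact mul_le_of_le_one_left (by positivity) (by rw [div_le_one hD0]; linarith)
  calc 72 * C ^ 5 * (1 / D) ^ 2 ≤ 72 * C ^ 5 * (1 / D) := by gcongr
    _ ≤ 1 := key _ (by linarith)

end Constants

end ParabolicCarleman

/-! ### Assembly and choice of the constants. -/

namespace ParabolicCarleman
variable {n : ℕ}

/-- Bookkeeping of the constants in the final estimate. -/
lemma final_absorption {C N Y α a κ P R Rt D J₁ J₂ S X Z : ℝ} (hC : 1 ≤ C) (ha : 0 < a)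
    (hα : 0 ≤ α) (hκ : 0 ≤ κ) (hRt : 0 ≤ Rt) (hJ₁ : 0 ≤ J₁) (hJ₂ : 0 ≤ J₂) (hS : 0 ≤ S)
    (hY : Y = 10000000 * C ^ 10 + 512 * C ^ 4) (hX : Y * X ≤ Z) (hN1 : 24 * C ^ 3 ≤ N)
    (hN2 : 88 * C ^ 5 ≤ N) (hN3 : 1 ≤ N)
    (h1 : 1 / (4 * C) * P ≤ 6 * C * R + 2500000 * C ^ 9 * X * S - D)
    (h2 : -D ≤ κ * (-(a / C) * J₁ + 22 * C ^ 4 * α * J₂) + 128 * C ^ 3 * X * S)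
    (h4 : R ≤ C * Rt) :
    P ≤ N * Rt + Z * S + κ * (-(a / N) * J₁ + N * α * J₂) := by
  have hC0 : 0 < C := by linarith
  have hN0 : 0 < N := by linarith
  have g1 : 24 * C ^ 3 * Rt ≤ N * Rt := by gcongr
  have g2 : Y * X * S ≤ Z * S := by gcongr
  have g3 : κ * (-(4 * a) * J₁ + 88 * C ^ 5 * α * J₂) ≤ κ * (-(a / N) * J₁ + N * α * J₂) := by
    have k1 : a / N ≤ 4 * a := by
      rw [div_le_iff₀ hN0]
      nlinarith
    have k2 : a / N * J₁ ≤ 4 * a * J₁ := by gcongr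
    have k3 : 88 * C ^ 5 * α * J₂ ≤ N * α * J₂ := by gcongr
    refine mul_le_mul_of_nonneg_left ?_ hκ
    linarith
  have m1 : 6 * C * R ≤ 6 * C * (C * Rt) := by gcongr
  have m2 : 1 / (4 * C) * P ≤ 6 * C * (C * Rt) + 2500000 * C ^ 9 * X * S
      + (κ * (-(a / C) * J₁ + 22 * C ^ 4 * α * J₂) + 128 * C ^ 3 * X * S) := by linarith
  -- Multiplication by 4C isolates P. It turns a/C into 4a, which exceeds a/N, and the two outer
  -- error constants into the summands of Y.
  have m3 := mul_le_mul_of_nonneg_left m2 (by positivity : 0 ≤ 4 * C)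
  have m4 : 4 * C * (1 / (4 * C) * P) = P := by field_simp
  have m5 : 4 * C * (κ * (-(a / C) * J₁ + 22 * C ^ 4 * α * J₂))
      = κ * (-(4 * a) * J₁ + 88 * C ^ 5 * α * J₂) := by
    field_simp
    ring
  rw [m4, mul_add, mul_add, mul_add, m5] at m3
  have m6 : 4 * C * (6 * C * (C * Rt)) = 24 * C ^ 3 * Rt := by ring
  have m7 : 4 * C * (2500000 * C ^ 9 * X * S) + 4 * C * (128 * C ^ 3 * X * S) = Y * X * S := by
    rw [hY]; ring
  linarith

/-- The Carleman inequality for admissible choices of the constants. -/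
lemma carleman_of_constants {Λ M C c N Y δ : ℝ} (hn : 1 ≤ n) (hΛ : 1 ≤ Λ) (hM : 0 ≤ M)
    (hC : 1 ≤ C) (hc : n ≤ c) (hcM : n ^ 2 * M ≤ c) (hcC : 16 * (n * c) ^ 2 ≤ C)
    (hCexp : Real.exp (4 * thetaConst) ≤ C) (hCexp' : Real.exp (16 * thetaConst) ≤ C)
    (hCθ : thetaConst ≤ C) (hCΛ : Λ ≤ C) (hCn : (n : ℝ) ≤ C) (hCM : 1 + 4 * (n ^ 2 * M) ≤ C)
    (hδ : 0 < δ) (hδ1 : δ ≤ 1) (hδC : 72 * C ^ 5 * δ ^ 2 ≤ 1)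
    (hδk : 240000 * C ^ 10 * absorbConst (Real.sqrt (16 + 2 * n)) * δ ≤ 1)
    (hδθ : 16 * thetaConst * δ ≤ 1) (hδ3 : Real.sqrt (16 + 2 * n) ^ 3 * δ ≤ 1)
    (hY : Y = 10000000 * C ^ 10 + 512 * C ^ 4) (hY1 : 1 ≤ Y) (hYN : Y * outerBase n δ ≤ N)
    (hN1 : 24 * C ^ 3 ≤ N) (hN2 : 88 * C ^ 5 ≤ N) (hN3 : 16 * C ^ 2 ≤ N) (hN4 : 1 ≤ N)
    {A : E n → ℝ → Matrix (Fin n) (Fin n) ℝ} {b : E n → ℝ → E n} {V : E n → ℝ → ℝ}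
    (hA : IsAdmissible Λ M A) (h0 : A 0 0 = 1) (hb : ∀ i, FiniteNorm fun x t => b x t i)
    (hV : FiniteNorm V) {α lam : ℝ}
    (hα : N * (1 + (vectorNorm b).toReal + (scalarNorm V).toReal ^ (1 / 2 : ℝ)) ≤ α)
    (hlam : lam = α / δ ^ 2) {w : E n → ℝ → ℝ} (hw : SmoothHalf w) {T : ℝ}
    (hT : T = 1 / (4 * lam)) {K : Set (E n × ℝ)} (hK : IsCompact K)
    (hKs : K ⊆ Metric.ball (0 : E n) 4 ×ˢ Ico (0 : ℝ) T) (hvan : VanishOff K w) {a : ℝ}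
    (ha : 0 < a) (haT : a ≤ T) :
    α ^ 2 * (∫ p in Metric.ball (0 : E n) 4 ×ˢ
          Ico (0 : ℝ) (T),
        sigma lam (p.2 + a) ^ (-2 * α) * w p.1 p.2 ^ 2
          * gaussG p.1 (p.2 + a))
      + α * (∫ p in Metric.ball (0 : E n) 4 ×ˢ
          Ico (0 : ℝ) (T),
        sigma lam (p.2 + a) ^ (1 - 2 * α)
          * ‖gradX w p.1 p.2‖ ^ 2
          * gaussG p.1 (p.2 + a))
    ≤ N * (∫ p in Metric.ball (0 : E n) 4 ×ˢ
          Ico (0 : ℝ) (T),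
        sigma lam (p.2 + a) ^ (1 - 2 * α)
          * opL A b V w p.1 p.2 ^ 2
          * gaussG p.1 (p.2 + a))
      + N ^ (2 * α) * α ^ (2 * α)
        * (⨆ t : Ici (0 : ℝ), ∫ x : E n,
            (w x t ^ 2 + ‖gradX w x t‖ ^ 2))
      + sigma lam a ^ (-2 * α)
        * (-(a / N) * (∫ x : E n,
              ‖gradX w x 0‖ ^ 2 * gaussG x a)
          + N * α * (∫ x : E n,
              w x 0 ^ 2 * gaussG x a)) := by
  have hβ0 : 0 ≤ (vectorNorm b).toReal := ENNReal.toReal_nonneg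
  have hv0 : 0 ≤ (scalarNorm V).toReal := ENNReal.toReal_nonneg
  have hr0 : 0 ≤ (scalarNorm V).toReal ^ (1 / 2 : ℝ) := Real.rpow_nonneg hv0 _
  have hsum : 1 + (vectorNorm b).toReal + (scalarNorm V).toReal ^ (1 / 2 : ℝ) ≤ α :=
    (le_mul_of_one_le_left (by positivity) (by linarith)).trans hα
  have hNα : N ≤ α :=
    (le_mul_of_one_le_right (by linarith) (by linarith)).trans hα
  have hα1 : 1 ≤ α := by linarith
  have hα0 : 0 < α := by linarith
  have hVα : (scalarNorm V).toReal ≤ α ^ 2 := by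
    have h1 : (scalarNorm V).toReal = ((scalarNorm V).toReal ^ (1 / 2 : ℝ)) ^ 2 := by
      rw [← Real.sqrt_eq_rpow, Real.sq_sqrt hv0]
    rw [h1]
    exact pow_le_pow_left₀ hr0 (by linarith) 2
  have hl : 0 < lam := by rw [hlam]; positivity
  have hl1 : 1 ≤ lam := by
    rw [hlam, le_div_iff₀ (by positivity), one_mul]
    exact (pow_le_one₀ hδ.le hδ1).trans hα1
  have hT0 : 0 < T := by rw [hT]; positivity
  have hT1 : T ≤ 1 := by rw [hT, div_le_one (by positivity)]; linarith
  have hlT : lam * T = 1 / 4 := by rw [hT]; field_simp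
  have hla : lam * a ≤ 1 / 4 := by rw [← hlT]; gcongr
  -- T = 1/(4λ) and a ≤ T place λ(t + a) in [0,1/2], the range where θ and σ are controlled.
  have hτ : lam * (T + a) ≤ 1 / 2 := by linarith
  have hCα : 16 * C ^ 2 ≤ α := by linarith
  obtain ⟨b₀, V₀, hb₀, hV₀, hPB, hdiff⟩ := exists_frozen (C := C) (α := α) (a := a) hA hM h0 hb hV
    hΛ hα0.le (by linarith) hVα (by linarith) (by linarith) (by linarith) ha (by linarith)
  obtain ⟨S, hS⟩ : ∃ S : ℝ, S = ⨆ t : Ici (0 : ℝ), ∫ x : E n,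
    (w x t ^ 2 + ‖gradX w x t‖ ^ 2) := ⟨_, rfl⟩
  have hbdd := bddAbove_energy hw hvan hK hKs
  have hSt : ∀ t, 0 ≤ t → ∫ x, (w x t ^ 2 + ‖gradX w x t‖ ^ 2) ≤ S := fun t ht =>
    (le_ciSup hbdd (⟨t, ht⟩ : Ici (0 : ℝ))).trans hS.ge
  have hS0 : 0 ≤ S := le_trans (integral_nonneg fun x => by positivity) (hSt 0 le_rfl)
  have h1 := carleman_conj (c := c) hn hA hM h0 hb hV hw hvan hK hKs hT0.le hT1 hb₀ hV₀ hPB hdiff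
    hC (by linarith) (by linarith) (by linarith) (by linarith) (by linarith) hδ hδ1 hCα hδC hδk
    hδθ hlam ha hτ hSt
  have h2 := neg_integral_boundaryDensity_le hA hM hw hvan hK hKs hb₀ hV₀ hPB hC (by linarith)
    (by linarith) hδ hδ1 hCα hδ3 hlam ha (by linarith) (hSt 0 le_rfl)
  have h3 := weighted_energy_le (α := α) hw hvan hK hKs hα0 hl ha hτ
  have h4 := conj_opL_sq_le (C := C) (α := α) hA hM h0 hb hV hw hvan hK hKs (by linarith) hl ha hτ
    (by linarith)
  refine h3.trans ?_
  have hR0 : 0 ≤ ∫ p in Metric.ball (0 : E n) 4 ×ˢ Ico (0 : ℝ) T,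
      sigma lam (p.2 + a) ^ (1 - 2 * α) * opL A b V w p.1 p.2 ^ 2 * gaussG p.1 (p.2 + a) := by
    refine setIntegral_nonneg (measurableSet_ball.prod measurableSet_Ico) fun p hp => ?_
    have hs : 0 < p.2 + a := by linarith [hp.2.1]
    have := gaussG_pos hs p.1
    have := sigma_pos (lam := lam) hs
    positivity
  have hJ1 : 0 ≤ ∫ x : E n, ‖gradX w x 0‖ ^ 2 * gaussG x a :=
    integral_nonneg fun x => mul_nonneg (sq_nonneg _) (gaussG_pos ha x).le
  have hJ2 : 0 ≤ ∫ x : E n, w x 0 ^ 2 * gaussG x a :=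
    integral_nonneg fun x => mul_nonneg (sq_nonneg _) (gaussG_pos ha x).le
  have hσ0 : 0 ≤ sigma lam a ^ (-2 * α) := Real.rpow_nonneg (sigma_pos ha).le _
  have hb1 : 0 < outerBase n δ := Real.exp_pos _
  -- Since Y ≥ 1 and 2α ≥ 1, Y is at most Y^{2α}, so it can be moved into the base of the
  -- exponential.
  have hYN' : Y * (outerBase n δ ^ (2 * α) * α ^ (2 * α)) ≤ N ^ (2 * α) * α ^ (2 * α) := by
    rw [← mul_assoc]
    gcongr
    calc Y * outerBase n δ ^ (2 * α) ≤ Y ^ (2 * α) * outerBase n δ ^ (2 * α) := by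
          gcongr
          exact Real.self_le_rpow_of_one_le hY1 (by linarith)
      _ = (Y * outerBase n δ) ^ (2 * α) :=
          (Real.mul_rpow (by linarith) hb1.le).symm
      _ ≤ N ^ (2 * α) := Real.rpow_le_rpow (by positivity) hYN (by linarith)
  rw [← hS]
  exact final_absorption hC ha hα0.le hσ0 hR0 hJ1 hJ2 hS0 hY hYN' hN1 hN2 hN4 h1 h2 h4

end ParabolicCarleman

theorem theorem3p1 (n : ℕ) (hn : 1 ≤ n) (Λ M : ℝ) (hΛ : 1 ≤ Λ) (hM : 0 ≤ M) :
    ∃ N δ : ℝ, 1 < N ∧ 0 < δ ∧ δ < 1 ∧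
      ∀ (A : E n → ℝ → Matrix (Fin n) (Fin n) ℝ)
        (b : E n → ℝ → E n)
        (V : E n → ℝ → ℝ),
        IsAdmissible Λ M A →
        A 0 0 = 1 →
        (∀ i, FiniteNorm (fun x t => b x t i)) →
        FiniteNorm V →
        ∀ α lam : ℝ,
          N * (1 + (vectorNorm b).toReal
            + (scalarNorm V).toReal ^ (1 / 2 : ℝ)) ≤ α →
          lam = α / δ ^ 2 →
          ∀ w : E n → ℝ → ℝ,
            IsTestFunction (1 / (4 * lam)) w →
            ∀ a : ℝ, 0 < a → a ≤ 1 / (4 * lam) →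
              α ^ 2 * (∫ p in Metric.ball (0 : E n) 4 ×ˢ
                    Ico (0 : ℝ) (1 / (4 * lam)),
                  sigma lam (p.2 + a) ^ (-2 * α) * w p.1 p.2 ^ 2
                    * gaussG p.1 (p.2 + a))
                + α * (∫ p in Metric.ball (0 : E n) 4 ×ˢ
                    Ico (0 : ℝ) (1 / (4 * lam)),
                  sigma lam (p.2 + a) ^ (1 - 2 * α)
                    * ‖gradX w p.1 p.2‖ ^ 2
                    * gaussG p.1 (p.2 + a))
              ≤ N * (∫ p in Metric.ball (0 : E n) 4 ×ˢ
                    Ico (0 : ℝ) (1 / (4 * lam)),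
                  sigma lam (p.2 + a) ^ (1 - 2 * α)
                    * opL A b V w p.1 p.2 ^ 2
                    * gaussG p.1 (p.2 + a))
                + N ^ (2 * α) * α ^ (2 * α)
                  * (⨆ t : Ici (0 : ℝ), ∫ x : E n,
                      (w x t ^ 2 + ‖gradX w x t‖ ^ 2))
                + sigma lam a ^ (-2 * α)
                  * (-(a / N) * (∫ x : E n,
                        ‖gradX w x 0‖ ^ 2 * gaussG x a)
                    + N * α * (∫ x : E n,
                        w x 0 ^ 2 * gaussG x a)) := by
  have hθ := thetaConst_ge_one
  have hnM : (0 : ℝ) ≤ n ^ 2 * M := by positivity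
  have hn0 : (0 : ℝ) ≤ n := Nat.cast_nonneg n
  obtain ⟨c, hc⟩ : ∃ c : ℝ, c = n + n ^ 2 * M := ⟨_, rfl⟩
  -- C is the sum of everything it must dominate and depends only on n, Λ and M. Then δ is chosen
  -- from C and n, and N from C, n and δ, so no circularity arises.
  obtain ⟨C, hCdef⟩ : ∃ C : ℝ, C = Λ + n + 1 + 4 * (n ^ 2 * M) + thetaConst
    + Real.exp (4 * thetaConst) + Real.exp (16 * thetaConst) + 16 * (n * c) ^ 2 := ⟨_, rfl⟩
  have q1 : 0 < Real.exp (4 * thetaConst) := Real.exp_pos _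
  have q2 : 0 < Real.exp (16 * thetaConst) := Real.exp_pos _
  have q3 : 0 ≤ 16 * (n * c) ^ 2 := by positivity
  have hC : 1 ≤ C := by linarith
  have hC0 : 0 < C := by linarith
  have hk : 1 ≤ Real.sqrt (16 + 2 * (n : ℝ)) := Real.one_le_sqrt.2 (by linarith)
  obtain ⟨δ, hδ, hδ1, hδC, hδk, hδθ, hδ3⟩ := exists_small_parameter hC hk
  have hbase := outerBase_ge_one (n := n) hδ hδ1.le
  obtain ⟨Y, hY⟩ : ∃ Y : ℝ, Y = 10000000 * C ^ 10 + 512 * C ^ 4 := ⟨_, rfl⟩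
  have hY1 : 1 ≤ Y := by
    have h1 : 1 ≤ C ^ 10 := one_le_pow₀ hC
    have h2 : 1 ≤ C ^ 4 := one_le_pow₀ hC
    linarith
  -- Again a sum of all required lower bounds; the term 16C² ensures α ≥ 16C², and Y · `outerBase n
  -- δ` covers the exponential error.
  obtain ⟨N, hN⟩ : ∃ N : ℝ, N = 24 * C ^ 3 + 88 * C ^ 5 + 16 * C ^ 2 + Y * outerBase n δ + 2 :=
    ⟨_, rfl⟩
  have p3 : 0 < C ^ 3 := by positivity
  have p5 : 0 < C ^ 5 := by positivity
  have p2 : 0 < C ^ 2 := by positivity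
  have pY : 0 < Y * outerBase n δ := by positivity
  refine ⟨N, δ, by linarith, hδ, hδ1, ?_⟩
  intro A b V hA h0 hb hV α lam hα hlam w ⟨hw, K, hK, hKs, hv⟩ a ha haT
  exact carleman_of_constants (c := c) hn hΛ hM hC (by linarith) (by linarith) (by linarith)
    (by linarith) (by linarith) (by linarith) (by linarith) (by linarith) (by linarith) hδ hδ1.le
    hδC hδk hδθ hδ3 hY hY1 (by linarith) (by linarith) (by linarith) (by linarith) (by linarith)
    hA h0 hb hV hα hlam hw rfl hK hKs hv ha haT
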